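/- Let $T$ be a text of length $n$ over an integer alphabet $\Sigma$ of size $\sigma = n^{O(1)}$, with suffix array $\mathsf{SA}$ (the permutation of the text positions that sorts the suffixes of $T$ lexicographically). For a string $\gamma\in\Sigma^*$ that occurs in $T$, let $\mathcal I(\gamma)=[b(\gamma)..e(\gamma)]$ be its suffix array interval, i.e. the set of all $i$ such that the suffix of $T$ starting at position $\mathsf{SA}[i]$ has $\gamma$ as a prefix. The model is the word RAM with words of $\Theta(\lg n)$ bits, with access to a compressed suffix tree of $T$ that answers each of its queries (entries of $\mathsf{SA}$, of $\mathsf{SA}^{-1}$ and of the LCP array, text characters, lowest common ancestors, path labels, edge labels, parents, number of children and $k$-th child of a node; labels are returned as a text position and a length) in time $t_{\mathsf{SA}}\ge 1$. Given the compressed suffix tree of $T$, there is a data structure of size $O(n)$ bits that allows us to merge two suffix array intervals in $O(t_{\mathsf{SA}}\lg\lg n)$ sequential worst-case time: there is one fixed program that, for every text $T$ and all strings $\alpha,\beta\in\Sigma^*$ that occur in $T$, given $n$, the intervals $\mathcal I(\alpha)$ and $\mathcal I(\beta)$ and the lengths $|\alpha|$ and $|\beta|$, computes $\mathcal I(\alpha\beta)$,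 or reports that $\alpha\beta$ does not occur in $T$, in at most $C\, t_{\mathsf{SA}}\max(1,\lg\lg n)$ steps, using the compressed suffix tree of $T$ and a stored sequence of at most $C n$ bits that depends only on $T$. The program, the constant $C$ and the constant in the word size depend only on the constants in the bound $\sigma=n^{O(1)}$. -/

import Mathlib

/-! ### Texts, suffix arrays and suffix array intervals

A text is a list `T` over the alphabet `Fin σ`.  Text positions and suffix array positions are
counted from `0`; the suffix of `T` at position `p` is `T.drop p`. -/

/-- The suffix array: the permutation of the text positions that sorts the suffixes of `T`
lexicographically. -/
def suffixArray {σ : ℕ} (T : List (Fin σ)) : Equiv.Perm (Fin T.length) :=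
  Tuple.sort fun p : Fin T.length => T.drop p

theorem suffixArray_strictMono {σ : ℕ} (T : List (Fin σ)) :
    StrictMono fun i : Fin T.length => T.drop (suffixArray T i) := by
  have hm : Monotone ((fun p : Fin T.length => T.drop p) ∘ suffixArray T) :=
    Tuple.monotone_sort _
  refine hm.strictMono_of_injective fun i j h => ?_
  have hl := congrArg List.length h
  simp only [Function.comp, List.length_drop] at hl
  have h1 := (suffixArray T i).isLt
  have h2 := (suffixArray T j).isLt
  exact (suffixArray T).injective (Fin.ext (by omega))

/-- The suffix of `T` with lexicographic rank `i` (the empty list if `i` is out of range). -/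
def rankedSuffix {σ : ℕ} (T : List (Fin σ)) (i : ℕ) : List (Fin σ) :=
  if h : i < T.length then T.drop (suffixArray T ⟨i, h⟩) else []

/-- The length of the longest common prefix of two strings. -/
def lcpLength {σ : ℕ} : List (Fin σ) → List (Fin σ) → ℕ
  | a :: s, b :: t => if a = b then lcpLength s t + 1 else 0
  | _, _ => 0

/-- The suffix array positions of the suffixes that start with `γ`. -/
def occPositions {σ : ℕ} (T γ : List (Fin σ)) : Set ℕ :=
  {i | i < T.length ∧ γ <+: rankedSuffix T i}

/-- `[b..e]` is the suffix array interval of `γ`.  As `b ≤ e` is required, `γ` occurs in `T`. -/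
def IsSAInterval {σ : ℕ} (T γ : List (Fin σ)) (b e : ℕ) : Prop :=
  b ≤ e ∧ occPositions T γ = Set.Icc b e

/-! ### The suffix tree

A node `v` of the suffix tree is handled through the interval `[v.1..v.2]` of the (ranks of the)
leaves below it.  (So a root with a single child, which occurs only if all characters of the text
are equal, is identified with that child.) -/

/-- `v` is a node of the suffix tree of `T`: the leaf of a suffix, or the locus of a string that
occurs in `T`.  (The text need not end in a unique end marker: each suffix has a leaf of its own,
as if the text were followed by an end marker.) -/
def IsNode {σ : ℕ} (T : List (Fin σ)) (v : ℕ × ℕ) : Prop :=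
  v.1 ≤ v.2 ∧ v.2 < T.length ∧ (v.1 = v.2 ∨ ∃ γ, occPositions T γ = Set.Icc v.1 v.2)

/-- The node `v` lies in the subtree of the node `u` (`u = v` is allowed). -/
def Below (v u : ℕ × ℕ) : Prop := u.1 ≤ v.1 ∧ v.2 ≤ u.2

/-- `w` is the lowest common ancestor of the nodes `u` and `v`. -/
def IsLCA {σ : ℕ} (T : List (Fin σ)) (u v w : ℕ × ℕ) : Prop :=
  IsNode T u ∧ IsNode T v ∧ IsNode T w ∧ Below u w ∧ Below v w ∧
    ∀ x, IsNode T x → Below u x → Below v x → Below w x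

/-- `u` is the parent of the node `v`. -/
def IsParent {σ : ℕ} (T : List (Fin σ)) (u v : ℕ × ℕ) : Prop :=
  IsNode T u ∧ IsNode T v ∧ Below v u ∧ v ≠ u ∧
    ∀ x, IsNode T x → Below v x → v ≠ x → Below u x

/-- The length of the path label of a node: the path label is the longest common prefix of all
suffixes below the node, hence of the first and the last of them. -/
def strDepth {σ : ℕ} (T : List (Fin σ)) (v : ℕ × ℕ) : ℕ :=
  lcpLength (rankedSuffix T v.1) (rankedSuffix T v.2)

/-! ### The queries of the compressed suffix tree -/

/-- The queries that a compressed suffix tree supports.  In a program the arguments are the names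
of the registers that hold the actual arguments; a node takes two registers. -/
inductive CSTQuery where
  /-- the entry `i` of the suffix array -/
  | sa (i : ℕ)
  /-- the entry `p` of the inverse suffix array -/
  | isa (p : ℕ)
  /-- the entry `i` of the LCP array -/
  | lcp (i : ℕ)
  /-- the character at text position `p` -/
  | text (p : ℕ)
  /-- the lowest common ancestor of two nodes -/
  | lca (u v : ℕ × ℕ)
  /-- the path label of a node, as a text position and a length -/
  | pathlabel (v : ℕ × ℕ)
  /-- the label of the edge from the parent of `v` to `v`, as a text position and a length -/
  | label (v : ℕ × ℕ)
  /-- the parent of a node -/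
  | parent (v : ℕ × ℕ)
  /-- the number of children of a node -/
  | degree (v : ℕ × ℕ)
  /-- the child number `k` of a node, from left to right -/
  | child (v : ℕ × ℕ) (k : ℕ)

/-- Replace the register names in a query by the contents of the registers. -/
def CSTQuery.eval (s : ℕ → ℕ) : CSTQuery → CSTQuery
  | .sa i => .sa (s i)
  | .isa p => .isa (s p)
  | .lcp i => .lcp (s i)
  | .text p => .text (s p)
  | .lca u v => .lca (s u.1, s u.2) (s v.1, s v.2)
  | .pathlabel v => .pathlabel (s v.1, s v.2)
  | .label v => .label (s v.1, s v.2)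
  | .parent v => .parent (s v.1, s v.2)
  | .degree v => .degree (s v.1, s v.2)
  | .child v k => .child (s v.1, s v.2) (s k)

/-- `Answers T q x`: on the text `T`, the query `q` (with actual arguments) has the answer `x`.
An answer that is a single number comes with a second component `0`.  Queries with arguments that
make no sense (a position out of range, the parent of the root) have no answer. -/
def Answers {σ : ℕ} (T : List (Fin σ)) : CSTQuery → ℕ × ℕ → Prop
  | .sa i, x => ∃ h : i < T.length, x = ((suffixArray T ⟨i, h⟩ : ℕ), 0)
  | .isa p, x => ∃ h : p < T.length, x = (((suffixArray T).symm ⟨p, h⟩ : ℕ), 0)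
  | .lcp i, x => i + 1 < T.length ∧ x = (lcpLength (rankedSuffix T i) (rankedSuffix T (i + 1)), 0)
  | .text p, x => ∃ h : p < T.length, x = ((T[p] : ℕ), 0)
  | .lca u v, x => IsLCA T u v x
  | .pathlabel v, x => IsNode T v ∧ ∃ h : v.1 < T.length,
      x = ((suffixArray T ⟨v.1, h⟩ : ℕ), strDepth T v)
  | .label v, x => ∃ u, IsParent T u v ∧ ∃ h : v.1 < T.length,
      x = (suffixArray T ⟨v.1, h⟩ + strDepth T u, strDepth T v - strDepth T u)
  | .parent v, x => IsParent T x v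
  | .degree v, x => IsNode T v ∧ x = ({w | IsParent T v w}.ncard, 0)
  | .child v k, x => IsParent T v x ∧ {w | IsParent T v w ∧ w.1 < x.1}.ncard = k

/-! ### A word RAM with access to a compressed suffix tree -/

/-- The arithmetic, logical and comparison operations of the word RAM. -/
inductive BinOp where
  | add | sub | mul | div | mod | and | or | xor | shl | shr | lt | eq

/-- The value of an operation, before it is reduced to the word size.  Subtraction is truncated at
`0`, a division by `0` gives `0`, and a comparison gives `1` or `0`. -/
def BinOp.eval : BinOp → ℕ → ℕ → ℕ
  | .add, x, y => x + y
  | .sub, x, y => x - y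
  | .mul, x, y => x * y
  | .div, x, y => x / y
  | .mod, x, y => x % y
  | .and, x, y => x &&& y
  | .or, x, y => x ||| y
  | .xor, x, y => x ^^^ y
  | .shl, x, y => x <<< y
  | .shr, x, y => x >>> y
  | .lt, x, y => if x < y then 1 else 0
  | .eq, x, y => if x = y then 1 else 0

/-- Word RAM programs.  A program works on registers, named by natural numbers, each of which holds
one word; being finite, it uses a constant number of them.  The words of the stored data structure
can be read, at computed addresses, but not written. -/
inductive Prog where
  | skip
  /-- put the constant `c` into register `d` -/
  | const (d c : ℕ)
  /-- put the result of an operation on the registers `a` and `b` into register `d` -/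
  | op (o : BinOp) (d a b : ℕ)
  /-- put the word of the data structure with the address in register `a` into register `d` -/
  | load (d a : ℕ)
  /-- query the compressed suffix tree, put the answer into the registers `d₁` and `d₂` -/
  | ask (q : CSTQuery) (d₁ d₂ : ℕ)
  | seq (P Q : Prog)
  /-- run `P` if register `a` is not `0`, and `Q` otherwise -/
  | ite (a : ℕ) (P Q : Prog)
  /-- repeat `P` as long as register `a` is not `0` -/
  | while (a : ℕ) (P : Prog)

/-- `Exec w t T D P s s' c`: on words of `w` bits, with the compressed suffix tree of `T` at hand,
which answers each query in time `t`, and with the data structure stored as the words `D`, the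
program `P` started with register contents `s` halts with register contents `s'` after time `c`.
Every step other than a query takes one unit of time. -/
inductive Exec {σ : ℕ} (w t : ℕ) (T : List (Fin σ)) (D : List ℕ) :
    Prog → (ℕ → ℕ) → (ℕ → ℕ) → ℕ → Prop where
  | skip (s : ℕ → ℕ) : Exec w t T D .skip s s 1
  | const (d c : ℕ) (s : ℕ → ℕ) :
      Exec w t T D (.const d c) s (Function.update s d (c % 2 ^ w)) 1
  | op (o : BinOp) (d a b : ℕ) (s : ℕ → ℕ) :
      Exec w t T D (.op o d a b) s (Function.update s d (o.eval (s a) (s b) % 2 ^ w)) 1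
  | load (d a : ℕ) (s : ℕ → ℕ) :
      Exec w t T D (.load d a) s (Function.update s d (D.getD (s a) 0 % 2 ^ w)) 1
  | ask (q : CSTQuery) (d₁ d₂ : ℕ) (s : ℕ → ℕ) (x : ℕ × ℕ) (hx : Answers T (q.eval s) x) :
      Exec w t T D (.ask q d₁ d₂) s
        (Function.update (Function.update s d₂ (x.2 % 2 ^ w)) d₁ (x.1 % 2 ^ w)) t
  | seq {P Q : Prog} {s s' s'' : ℕ → ℕ} {c c' : ℕ} (h : Exec w t T D P s s' c)
      (h' : Exec w t T D Q s' s'' c') : Exec w t T D (.seq P Q) s s'' (c + c')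
  | ite_true {a : ℕ} {P Q : Prog} {s s' : ℕ → ℕ} {c : ℕ} (ha : s a ≠ 0)
      (h : Exec w t T D P s s' c) : Exec w t T D (.ite a P Q) s s' (c + 1)
  | ite_false {a : ℕ} {P Q : Prog} {s s' : ℕ → ℕ} {c : ℕ} (ha : s a = 0)
      (h : Exec w t T D Q s s' c) : Exec w t T D (.ite a P Q) s s' (c + 1)
  | while_true {a : ℕ} {P : Prog} {s s' s'' : ℕ → ℕ} {c c' : ℕ} (ha : s a ≠ 0)
      (h : Exec w t T D P s s' c) (h' : Exec w t T D (.while a P) s' s'' c') :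
      Exec w t T D (.while a P) s s'' (c + c' + 1)
  | while_false {a : ℕ} {P : Prog} {s : ℕ → ℕ} (ha : s a = 0) :
      Exec w t T D (.while a P) s s 1

/-- The registers at the start of a merge query: the two intervals `[b₁..e₁]` and `[b₂..e₂]`, the
lengths `m₁` and `m₂` of the two patterns, and the length `n` of the text. -/
def mergeInput (b₁ e₁ m₁ b₂ e₂ m₂ n : ℕ) (r : ℕ) : ℕ :=
  [b₁, e₁, m₁, b₂, e₂, m₂, n].getD r 0

/-- The registers `s` hold the answer of a merge query for the pattern `γ`: a `1` and the interval
of `γ`, or a `0` if `γ` does not occur in `T`. -/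
def IsMergeOutput {σ : ℕ} (T γ : List (Fin σ)) (s : ℕ → ℕ) : Prop :=
  (s 0 = 1 ∧ IsSAInterval T γ (s 1) (s 2)) ∨ (s 0 = 0 ∧ occPositions T γ = ∅)

/-! ### Queries have unique answers and programs are deterministic -/

theorem Below.antisymm {u v : ℕ × ℕ} (h : Below u v) (h' : Below v u) : u = v :=
  Prod.ext (le_antisymm h'.1 h.1) (le_antisymm h.2 h'.2)

theorem finite_setOf_isParent {σ : ℕ} (T : List (Fin σ)) (u : ℕ × ℕ) :
    {w | IsParent T u w}.Finite := by
  refine ((Set.finite_Iio T.length).prod (Set.finite_Iio T.length)).subset ?_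
  rintro w ⟨-, ⟨h1, h2, -⟩, -⟩
  exact ⟨lt_of_le_of_lt h1 h2, h2⟩

theorem IsParent.eq_of_fst_eq {σ : ℕ} {T : List (Fin σ)} {u v w : ℕ × ℕ} (hv : IsParent T u v)
    (hw : IsParent T u w) (h : v.1 = w.1) : v = w := by
  by_contra hne
  rcases le_total v.2 w.2 with h2 | h2
  · exact hw.2.2.2.1 (hw.2.2.1.antisymm (hv.2.2.2.2 w hw.2.1 ⟨h.ge, h2⟩ hne))
  · exact hv.2.2.2.1 (hv.2.2.1.antisymm (hw.2.2.2.2 v hv.2.1 ⟨h.le, h2⟩ (Ne.symm hne)))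

theorem IsParent.unique {σ : ℕ} {T : List (Fin σ)} {u u' v : ℕ × ℕ} (h : IsParent T u v)
    (h' : IsParent T u' v) : u = u' :=
  (h.2.2.2.2 u' h'.1 h'.2.2.1 h'.2.2.2.1).antisymm (h'.2.2.2.2 u h.1 h.2.2.1 h.2.2.2.1)

theorem Answers.unique {σ : ℕ} {T : List (Fin σ)} {q : CSTQuery} {x y : ℕ × ℕ}
    (hx : Answers T q x) (hy : Answers T q y) : x = y := by
  cases q with
  | sa i => obtain ⟨_, rfl⟩ := hx; obtain ⟨_, rfl⟩ := hy; rfl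
  | isa i => obtain ⟨_, rfl⟩ := hx; obtain ⟨_, rfl⟩ := hy; rfl
  | lcp i => obtain ⟨_, rfl⟩ := hx; obtain ⟨_, rfl⟩ := hy; rfl
  | text i => obtain ⟨_, rfl⟩ := hx; obtain ⟨_, rfl⟩ := hy; rfl
  | lca u v =>
    obtain ⟨_, _, hx1, hx2, hx3, hx4⟩ := hx
    obtain ⟨_, _, hy1, hy2, hy3, hy4⟩ := hy
    exact (hx4 y hy1 hy2 hy3).antisymm (hy4 x hx1 hx2 hx3)
  | pathlabel v => obtain ⟨_, _, rfl⟩ := hx; obtain ⟨_, _, rfl⟩ := hy; rfl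
  | label v =>
    obtain ⟨u, hu, _, rfl⟩ := hx
    obtain ⟨u', hu', _, rfl⟩ := hy
    rw [hu.unique hu']
  | parent v => exact IsParent.unique hx hy
  | degree v => obtain ⟨_, rfl⟩ := hx; obtain ⟨_, rfl⟩ := hy; rfl
  | child v k =>
    have key : ∀ x y : ℕ × ℕ, Answers T (.child v k) x → Answers T (.child v k) y →
        ¬ x.1 < y.1 := by
      rintro x y ⟨hx, hxk⟩ ⟨hy, hyk⟩ hlt
      have hss : {w | IsParent T v w ∧ w.1 < x.1} ⊂ {w | IsParent T v w ∧ w.1 < y.1} :=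
        ⟨fun w hw => ⟨hw.1, lt_trans hw.2 hlt⟩, fun h => lt_irrefl _ (h ⟨hx, hlt⟩).2⟩
      have := Set.ncard_lt_ncard hss ((finite_setOf_isParent T v).subset fun w hw => hw.1)
      omega
    exact IsParent.eq_of_fst_eq hx.1 hy.1
      (le_antisymm (not_lt.1 (key y x hy hx)) (not_lt.1 (key x y hx hy)))

theorem Exec.unique {σ : ℕ} {w t : ℕ} {T : List (Fin σ)} {D : List ℕ} {P : Prog}
    {s s₁ s₂ : ℕ → ℕ} {c₁ c₂ : ℕ} (h₁ : Exec w t T D P s s₁ c₁) (h₂ : Exec w t T D P s s₂ c₂) :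
    s₁ = s₂ ∧ c₁ = c₂ := by
  induction h₁ generalizing s₂ c₂ with
  | skip | const | op | load => cases h₂; exact ⟨rfl, rfl⟩
  | ask q d₁ d₂ s x hx =>
    cases h₂ with
    | ask _ _ _ _ y hy => rw [hx.unique hy]; exact ⟨rfl, rfl⟩
  | seq _ _ ih ih' =>
    cases h₂ with
    | seq h h' =>
      obtain ⟨rfl, rfl⟩ := ih h
      obtain ⟨rfl, rfl⟩ := ih' h'
      exact ⟨rfl, rfl⟩
  | ite_true ha _ ih =>
    cases h₂ with
    | ite_true _ h => obtain ⟨rfl, rfl⟩ := ih h; exact ⟨rfl, rfl⟩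
    | ite_false hb _ => exact absurd hb ha
  | ite_false ha _ ih =>
    cases h₂ with
    | ite_true hb _ => exact absurd ha hb
    | ite_false _ h => obtain ⟨rfl, rfl⟩ := ih h; exact ⟨rfl, rfl⟩
  | while_true ha _ _ ih ih' =>
    cases h₂ with
    | while_true _ h h' =>
      obtain ⟨rfl, rfl⟩ := ih h
      obtain ⟨rfl, rfl⟩ := ih' h'
      exact ⟨rfl, rfl⟩
    | while_false hb => exact absurd hb ha
  | while_false ha =>
    cases h₂ with
    | while_true hb _ _ => exact absurd ha hb
    | while_false _ => exact ⟨rfl, rfl⟩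

/-! ### Longest common prefixes and the lexicographic order -/

/-! Inside the interval of `α` every suffix is `α` followed by another suffix of `T`, and the order
of the former is the order of the latter. So `α ++ β` occurs exactly where the rank of this rest
falls into the interval of `β`, and the answer is delimited by the insertion points of `α` followed
by the first and by the last suffix that starts with `β` (`mem_occPositions_append_iff`). One
comparison costs one `SA` and at most one inverse `SA` query, but a plain binary search over the
whole interval may need about `lg n` of them.

Write `s` for the number of binary digits of `n`. Every `s ^ 3`-th suffix in rank order is a sample.
Between two consecutive samples a binary search takes `O(lg s)` rounds, so it remains to locate the
searched string `X` among the samples in the interval of `α`. If there are any, take the smallest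
aligned block of `2 ^ k` samples that contains them all. Its centre is one of them
(`blockCenter_mem`), hence starts with `α`, and the longest common prefix of `X` with the centre has
length `|α|` plus the string depth of a lowest common ancestor of two leaves.

Relative to a fixed centre, a string is encoded by an integer of `2 * s + 1` bits: the length of its
common prefix with the centre, reflected if the string is larger, followed by the rank of what
remains. These keys compare like the strings (`stringKey_lt_stringKey`). The position of a key among
the keys of a block is found as in an x-fast trie: all prefixes of all keys are stored in a perfect
hash table together with the first and the last sample that has this prefix, and a binary search
over the `2 * s + 2` prefix lengths finds the longest stored prefix of the query
(`lt_iff_of_least_shift`). The position narrows the insertion point down to one gap between samples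
(`insertionPoint_window`).

Each of the `n / s ^ 3` samples contributes `O(s)` blocks times `O(s)` prefixes of `O(s)` bits,
which makes `O(n)` bits in total. All loops are binary searches with `O(lg s) = O(lg lg n)` rounds,
and none is nested in another. -/

theorem lcpLength_nil_left {σ : ℕ} (y : List (Fin σ)) : lcpLength [] y = 0 := by
  cases y <;> rfl

theorem lcpLength_nil_right {σ : ℕ} (x : List (Fin σ)) : lcpLength x [] = 0 := by
  cases x <;> rfl

theorem lcpLength_cons_self {σ : ℕ} (a : Fin σ) (x y : List (Fin σ)) :
    lcpLength (a :: x) (a :: y) = lcpLength x y + 1 := by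
  simp [lcpLength]

theorem lcpLength_cons_of_ne {σ : ℕ} {a b : Fin σ} (h : a ≠ b) (x y : List (Fin σ)) :
    lcpLength (a :: x) (b :: y) = 0 := by
  simp [lcpLength, h]

theorem lcpLength_self {σ : ℕ} (x : List (Fin σ)) : lcpLength x x = x.length := by
  induction x with
  | nil => rfl
  | cons a x ih => simp [lcpLength, ih]

theorem lcpLength_append_left {σ : ℕ} (γ x y : List (Fin σ)) :
    lcpLength (γ ++ x) (γ ++ y) = γ.length + lcpLength x y := by
  induction γ with
  | nil => simp
  | cons a γ ih => simp [lcpLength, ih]; omega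

theorem lcpLength_comm {σ : ℕ} (x y : List (Fin σ)) : lcpLength x y = lcpLength y x := by
  induction x generalizing y with
  | nil => rw [lcpLength_nil_left, lcpLength_nil_right]
  | cons a x ih =>
    cases y with
    | nil => rw [lcpLength_nil_left, lcpLength_nil_right]
    | cons b y =>
      by_cases h : a = b
      · subst h; simp [lcpLength, ih]
      · rw [lcpLength_cons_of_ne h, lcpLength_cons_of_ne (Ne.symm h)]

theorem lcpLength_le_left {σ : ℕ} (x y : List (Fin σ)) : lcpLength x y ≤ x.length := by
  induction x generalizing y with
  | nil => simp [lcpLength_nil_left]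
  | cons a x ih =>
    cases y with
    | nil => simp [lcpLength_nil_right]
    | cons b y =>
      by_cases h : a = b
      · subst h; simpa [lcpLength] using ih y
      · simp [lcpLength_cons_of_ne h]

theorem lcpLength_le_right {σ : ℕ} (x y : List (Fin σ)) : lcpLength x y ≤ y.length :=
  lcpLength_comm x y ▸ lcpLength_le_left y x

theorem le_lcpLength_iff {σ : ℕ} {γ x : List (Fin σ)} (h : γ <+: x) (y : List (Fin σ)) :
    γ.length ≤ lcpLength x y ↔ γ <+: y := by
  induction γ generalizing x y with
  | nil => simp
  | cons a γ ih =>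
    obtain ⟨z, rfl⟩ := h
    cases y with
    | nil => simp [lcpLength_nil_right]
    | cons b y =>
      by_cases hab : a = b
      · subst hab
        simp [lcpLength, ← ih (List.prefix_append γ z) y]
      · simp [lcpLength, hab]

theorem take_lcpLength_prefix {σ : ℕ} (x y : List (Fin σ)) : x.take (lcpLength x y) <+: y := by
  rw [← le_lcpLength_iff (List.take_prefix _ x)]
  simp

theorem nil_lt_iff {σ : ℕ} (x : List (Fin σ)) : [] < x ↔ x ≠ [] := by
  cases x <;> simp

theorem append_lt_append_iff {σ : ℕ} (γ x y : List (Fin σ)) : γ ++ x < γ ++ y ↔ x < y := by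
  induction γ with
  | nil => simp
  | cons a γ ih => simp [ih]

theorem append_le_append_iff {σ : ℕ} (γ x y : List (Fin σ)) : γ ++ x ≤ γ ++ y ↔ x ≤ y := by
  rw [← not_lt, append_lt_append_iff, not_lt]

/-- At the place where `y` departs from `z`, the strings `x` and `z` still agree, so `y` lies on the
same side of both. -/
theorem lt_iff_lt_of_lcpLength_lt {σ : ℕ} {x y z : List (Fin σ)}
    (h : lcpLength y z < lcpLength x z) : y < z ↔ y < x := by
  induction z generalizing x y with
  | nil => simp [lcpLength_nil_right] at h
  | cons c z ih =>
    cases x with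
    | nil => simp [lcpLength_nil_left] at h
    | cons a x =>
      by_cases ha : a = c
      · subst ha
        cases y with
        | nil => simp
        | cons b y =>
          by_cases hb : b = a
          · subst hb
            simp only [lcpLength_cons_self, add_lt_add_iff_right] at h
            simp [ih h]
          · simp [List.cons_lt_cons_iff, hb]
      · simp [lcpLength_cons_of_ne ha] at h

theorem eq_take_append_drop_lcpLength {σ : ℕ} (x z : List (Fin σ)) :
    x = z.take (lcpLength x z) ++ x.drop (lcpLength x z) := by
  have h := List.prefix_iff_eq_take.1 (take_lcpLength_prefix x z)
  rw [List.length_take, min_eq_left (lcpLength_le_left x z)] at h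
  rw [← h, List.take_append_drop]

theorem lt_iff_drop_lt_drop {σ : ℕ} {x y z : List (Fin σ)}
    (h : lcpLength y z = lcpLength x z) :
    y < x ↔ y.drop (lcpLength y z) < x.drop (lcpLength x z) := by
  conv_lhs => rw [eq_take_append_drop_lcpLength y z, eq_take_append_drop_lcpLength x z, h]
  rw [append_lt_append_iff, h]

/-- If `y` departed from `x` within `γ`, it would lie on the same side of `x` and of `z`, not
between them. This is why occurrences form intervals. -/
theorem prefix_of_le_of_le {σ : ℕ} {γ x y z : List (Fin σ)} (hx : γ <+: x) (hz : γ <+: z)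
    (hxy : x ≤ y) (hyz : y ≤ z) : γ <+: y := by
  by_contra hy
  rw [← le_lcpLength_iff hx, not_le, lcpLength_comm] at hy
  have h1 := (le_lcpLength_iff hx z).2 hz
  have h2 := lt_iff_lt_of_lcpLength_lt (x := z) (y := y) (z := x)
    (lt_of_lt_of_le hy (lcpLength_comm x z ▸ h1))
  have hne : y ≠ z := by rintro rfl; rw [lcpLength_comm] at hy; omega
  exact absurd (h2.2 (lt_of_le_of_ne hyz hne)) (not_lt.2 hxy)

/-! ### Ranks of suffixes -/

theorem rankedSuffix_of_lt {σ : ℕ} {T : List (Fin σ)} {i : ℕ} (h : i < T.length) :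
    rankedSuffix T i = T.drop (suffixArray T ⟨i, h⟩) := by
  simp [rankedSuffix, h]

theorem rankedSuffix_lt_iff {σ : ℕ} {T : List (Fin σ)} {i j : ℕ} (hi : i < T.length)
    (hj : j < T.length) : rankedSuffix T i < rankedSuffix T j ↔ i < j := by
  rw [rankedSuffix_of_lt hi, rankedSuffix_of_lt hj]
  exact (suffixArray_strictMono T).lt_iff_lt (a := ⟨i, hi⟩) (b := ⟨j, hj⟩)

theorem rankedSuffix_le_iff {σ : ℕ} {T : List (Fin σ)} {i j : ℕ} (hi : i < T.length)
    (hj : j < T.length) : rankedSuffix T i ≤ rankedSuffix T j ↔ i ≤ j := by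
  rw [← not_lt, rankedSuffix_lt_iff hj hi, not_lt]

/-- The entry `i` of the suffix array (and `0` if `i` is out of range). -/
def saEntry {σ : ℕ} (T : List (Fin σ)) (i : ℕ) : ℕ :=
  if h : i < T.length then suffixArray T ⟨i, h⟩ else 0

theorem saEntry_of_lt {σ : ℕ} {T : List (Fin σ)} {i : ℕ} (h : i < T.length) :
    saEntry T i = suffixArray T ⟨i, h⟩ := by
  simp [saEntry, h]

theorem saEntry_lt {σ : ℕ} {T : List (Fin σ)} {i : ℕ} (h : i < T.length) :
    saEntry T i < T.length := by
  rw [saEntry_of_lt h]; exact (suffixArray T ⟨i, h⟩).2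

theorem rankedSuffix_eq_drop {σ : ℕ} {T : List (Fin σ)} {i : ℕ} (h : i < T.length) :
    rankedSuffix T i = T.drop (saEntry T i) := by
  rw [rankedSuffix_of_lt h, saEntry_of_lt h]

/-- The number of nonempty suffixes that are at most the suffix at position `p ≤ T.length`. -/
def suffixCount {σ : ℕ} (T : List (Fin σ)) (p : ℕ) : ℕ :=
  if h : p < T.length then (suffixArray T).symm ⟨p, h⟩ + 1 else 0

theorem suffixCount_le {σ : ℕ} (T : List (Fin σ)) (p : ℕ) : suffixCount T p ≤ T.length := by
  unfold suffixCount
  split_ifs with h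
  · exact ((suffixArray T).symm ⟨p, h⟩).2
  · exact Nat.zero_le _

theorem suffixCount_of_lt {σ : ℕ} {T : List (Fin σ)} {p : ℕ} (h : p < T.length) :
    suffixCount T p = (suffixArray T).symm ⟨p, h⟩ + 1 := by
  simp [suffixCount, h]

theorem suffixCount_length {σ : ℕ} (T : List (Fin σ)) : suffixCount T T.length = 0 := by
  simp [suffixCount]

theorem rankedSuffix_suffixCount {σ : ℕ} {T : List (Fin σ)} {p : ℕ} (h : p < T.length) :
    rankedSuffix T (suffixCount T p - 1) = T.drop p := by
  rw [suffixCount_of_lt h, Nat.add_sub_cancel, rankedSuffix_of_lt (Fin.is_lt _)]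
  simp

theorem suffixCount_saEntry {σ : ℕ} {T : List (Fin σ)} {i : ℕ} (h : i < T.length) :
    suffixCount T (saEntry T i) = i + 1 := by
  rw [suffixCount_of_lt (saEntry_lt h)]
  simp [saEntry_of_lt h]

/-- `suffixCount` is the rank plus one, which leaves the value `0` for the empty suffix at `p =
T.length`. That suffix has no rank, but it does arise as the rest behind a pattern. -/
theorem suffixCount_lt_iff {σ : ℕ} {T : List (Fin σ)} {p q : ℕ} (hp : p ≤ T.length)
    (hq : q ≤ T.length) : suffixCount T p < suffixCount T q ↔ T.drop p < T.drop q := by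
  rcases hq.eq_or_lt with rfl | hq
  · simp [suffixCount_length]
  rcases hp.eq_or_lt with rfl | hp
  · simp [suffixCount_length, suffixCount_of_lt hq, nil_lt_iff, hq]
  rw [← rankedSuffix_suffixCount hp, ← rankedSuffix_suffixCount hq, rankedSuffix_lt_iff]
  · rw [suffixCount_of_lt hp, suffixCount_of_lt hq]; omega
  · rw [suffixCount_of_lt hp]; exact Fin.is_lt _
  · rw [suffixCount_of_lt hq]; exact Fin.is_lt _

theorem IsSAInterval.lt_length {σ : ℕ} {T γ : List (Fin σ)} {b e : ℕ} (h : IsSAInterval T γ b e) :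
    e < T.length := by
  have : e ∈ occPositions T γ := h.2 ▸ ⟨h.1, le_rfl⟩
  exact this.1

theorem IsSAInterval.prefix_iff {σ : ℕ} {T γ : List (Fin σ)} {b e i : ℕ}
    (h : IsSAInterval T γ b e) (hi : i < T.length) : γ <+: rankedSuffix T i ↔ b ≤ i ∧ i ≤ e := by
  have : i ∈ occPositions T γ ↔ i ∈ Set.Icc b e := by rw [h.2]
  simpa [occPositions, hi] using this

/-- A nonempty set of occurrences is an interval. -/
theorem exists_isSAInterval {σ : ℕ} {T γ : List (Fin σ)} {i : ℕ} (hi : i ∈ occPositions T γ) :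
    ∃ b e, IsSAInterval T γ b e ∧ b ≤ i ∧ i ≤ e := by
  have hfin : (occPositions T γ).Finite := (Set.finite_Iio T.length).subset fun j hj => hj.1
  have hne : hfin.toFinset.Nonempty := ⟨i, by simpa using hi⟩
  have hb := (hfin.mem_toFinset).1 (Finset.min'_mem _ hne)
  have he := (hfin.mem_toFinset).1 (Finset.max'_mem _ hne)
  have hib := Finset.min'_le _ i (hfin.mem_toFinset.2 hi)
  have hie := Finset.le_max' _ i (hfin.mem_toFinset.2 hi)
  refine ⟨_, _, ⟨hib.trans hie, ?_⟩, hib, hie⟩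
  ext j
  constructor
  · intro hj
    exact ⟨Finset.min'_le _ j (hfin.mem_toFinset.2 hj), Finset.le_max' _ j (hfin.mem_toFinset.2 hj)⟩
  · rintro ⟨h1, h2⟩
    have hj := lt_of_le_of_lt h2 he.1
    exact ⟨hj, prefix_of_le_of_le hb.2 he.2 ((rankedSuffix_le_iff hb.1 hj).2 h1)
      ((rankedSuffix_le_iff hj he.1).2 h2)⟩

/-! ### Lowest common ancestors of leaves -/

theorem isNode_leaf {σ : ℕ} {T : List (Fin σ)} {i : ℕ} (hi : i < T.length) : IsNode T (i, i) :=
  ⟨le_rfl, hi, Or.inl rfl⟩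

/-- Two leaves have a lowest common ancestor, and its string depth is the length of the longest
common prefix of the two suffixes. -/
theorem exists_isLCA_leaf {σ : ℕ} {T : List (Fin σ)} {i j : ℕ} (hi : i < T.length)
    (hj : j < T.length) : ∃ w, IsLCA T (i, i) (j, j) w ∧
      strDepth T w = lcpLength (rankedSuffix T i) (rankedSuffix T j) := by
  rcases eq_or_ne i j with rfl | hij
  · exact ⟨(i, i), ⟨isNode_leaf hi, isNode_leaf hi, isNode_leaf hi, ⟨le_rfl, le_rfl⟩,
      ⟨le_rfl, le_rfl⟩, fun x _ h _ => h⟩, rfl⟩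
  -- The lowest common ancestor is the locus of the longest common prefix `γ` of the two suffixes.
  set γ := (rankedSuffix T i).take (lcpLength (rankedSuffix T i) (rankedSuffix T j)) with hγ
  have hγl : γ.length = lcpLength (rankedSuffix T i) (rankedSuffix T j) := by
    simp [hγ, lcpLength_le_left]
  have hγi : γ <+: rankedSuffix T i := List.take_prefix _ _
  have hγj : γ <+: rankedSuffix T j := take_lcpLength_prefix _ _
  obtain ⟨b, e, hbe, hbi, hie⟩ := exists_isSAInterval (T := T) (γ := γ) (i := i) ⟨hi, hγi⟩
  obtain ⟨hbj, hje⟩ := (hbe.prefix_iff hj).1 hγj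
  have he := hbe.lt_length
  have hb := lt_of_le_of_lt hbe.1 he
  refine ⟨(b, e), ⟨isNode_leaf hi, isNode_leaf hj, ⟨hbe.1, he, Or.inr ⟨γ, hbe.2⟩⟩, ⟨hbi, hie⟩,
    ⟨hbj, hje⟩, ?_⟩, ?_⟩
  · rintro ⟨xb, xe⟩ ⟨hx1, hx2, hx3⟩ ⟨hx4, hx5⟩ ⟨hx6, hx7⟩
    simp only at *
    rcases hx3 with rfl | ⟨δ, hδ⟩
    · omega
    · have hint : IsSAInterval T δ xb xe := ⟨hx1, hδ⟩
      have h1 := (hint.prefix_iff hi).2 ⟨hx4, hx5⟩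
      have h2 := (hint.prefix_iff hj).2 ⟨hx6, hx7⟩
      -- A common ancestor is the locus of a common prefix `δ` of both suffixes. As `δ` is a prefix
      -- of `γ`, its interval contains that of `γ`.
      have h3 : δ <+: γ := List.prefix_of_prefix_length_le h1 hγi
        (hγl ▸ (le_lcpLength_iff h1 _).2 h2)
      exact ⟨((hint.prefix_iff hb).1 (h3.trans ((hbe.prefix_iff hb).2 ⟨le_rfl, hbe.1⟩))).1,
        ((hint.prefix_iff he).1 (h3.trans ((hbe.prefix_iff he).2 ⟨hbe.1, le_rfl⟩))).2⟩
  · rw [← hγl]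
    have h1 := (hbe.prefix_iff hb).2 ⟨le_rfl, hbe.1⟩
    have h2 := (hbe.prefix_iff he).2 ⟨hbe.1, le_rfl⟩
    refine le_antisymm ?_ ((le_lcpLength_iff h1 _).2 h2)
    -- The full path label `δ` is shared by all suffixes in between, in particular by `i` and `j`,
    -- so it is no longer than `γ`.
    set δ := (rankedSuffix T b).take (strDepth T (b, e)) with hδ
    have hδl : δ.length = strDepth T (b, e) := by
      simp [hδ, strDepth, lcpLength_le_left]
    have hδb : δ <+: rankedSuffix T b := List.take_prefix _ _
    have hδe : δ <+: rankedSuffix T e := take_lcpLength_prefix _ _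
    have hδi := prefix_of_le_of_le hδb hδe ((rankedSuffix_le_iff hb hi).2 hbi)
      ((rankedSuffix_le_iff hi he).2 hie)
    have hδj := prefix_of_le_of_le hδb hδe ((rankedSuffix_le_iff hb hj).2 hbj)
      ((rankedSuffix_le_iff hj he).2 hje)
    rw [← hδl, hγl]
    exact (le_lcpLength_iff hδi _).2 hδj


/-! ### Searching for a string in a suffix array interval -/

/-- `x` is the number of suffixes of `T` that are smaller than `X`. -/
def IsInsertionPoint {σ : ℕ} (T X : List (Fin σ)) (x : ℕ) : Prop :=
  x ≤ T.length ∧ ∀ i < T.length, i < x ↔ rankedSuffix T i < X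

theorem exists_isInsertionPoint {σ : ℕ} (T X : List (Fin σ)) : ∃ x, IsInsertionPoint T X x := by
  classical
  have h : ∃ x, T.length ≤ x ∨ ¬ rankedSuffix T x < X := ⟨_, Or.inl le_rfl⟩
  have hle : Nat.find h ≤ T.length := Nat.find_min' h (Or.inl le_rfl)
  refine ⟨Nat.find h, hle, fun i hi => ⟨fun hlt => ?_, fun hlt => ?_⟩⟩
  · have := Nat.find_min h hlt
    push Not at this
    exact this.2
  · by_contra hge
    rw [not_lt] at hge
    have hx := lt_of_le_of_lt hge hi
    rcases Nat.find_spec h with h1 | h1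
    · omega
    · exact h1 (lt_of_le_of_lt ((rankedSuffix_le_iff hx hi).2 hge) hlt)

namespace IsSAInterval

variable {σ : ℕ} {T α : List (Fin σ)} {b e : ℕ}

theorem saEntry_add_le (h : IsSAInterval T α b e) {i : ℕ} (hb : b ≤ i) (he : i ≤ e) :
    saEntry T i + α.length ≤ T.length := by
  have hi := lt_of_le_of_lt he h.lt_length
  have := ((h.prefix_iff hi).2 ⟨hb, he⟩).length_le
  rw [rankedSuffix_eq_drop hi, List.length_drop] at this
  have := saEntry_lt hi
  omega

theorem rankedSuffix_eq (h : IsSAInterval T α b e) {i : ℕ} (hb : b ≤ i) (he : i ≤ e) :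
    rankedSuffix T i = α ++ T.drop (saEntry T i + α.length) := by
  have hi := lt_of_le_of_lt he h.lt_length
  obtain ⟨z, hz⟩ := (h.prefix_iff hi).2 ⟨hb, he⟩
  rw [← hz, ← List.drop_drop, ← rankedSuffix_eq_drop hi, ← hz, List.drop_left]

/-- The common prefix `α` cancels, and what remains are two suffixes of `T`, which are compared
through their ranks. This makes a comparison affordable: the characters are never inspected. -/
theorem rankedSuffix_lt_append_iff (h : IsSAInterval T α b e) {i r : ℕ} (hb : b ≤ i) (he : i ≤ e)
    (hr : r < T.length) : rankedSuffix T i < α ++ rankedSuffix T r ↔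
      suffixCount T (saEntry T i + α.length) < r + 1 := by
  rw [h.rankedSuffix_eq hb he, append_lt_append_iff, rankedSuffix_eq_drop hr,
    ← suffixCount_lt_iff (h.saEntry_add_le hb he) (saEntry_lt hr).le, suffixCount_saEntry hr]

theorem lt_append_of_lt (h : IsSAInterval T α b e) {i : ℕ} (hi : i < b) (z : List (Fin σ)) :
    rankedSuffix T i < α ++ z := by
  by_contra hlt
  have he := h.lt_length
  have hb := lt_of_le_of_lt h.1 he
  have hp := prefix_of_le_of_le (List.prefix_append α z) ((h.prefix_iff hb).2 ⟨le_rfl, h.1⟩)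
    (not_lt.1 hlt) ((rankedSuffix_le_iff (hi.trans hb) hb).2 hi.le)
  have := (h.prefix_iff (hi.trans hb)).1 hp
  omega

theorem append_lt_of_lt (h : IsSAInterval T α b e) {i : ℕ} (hi : e < i) (hn : i < T.length)
    (z : List (Fin σ)) : α ++ z < rankedSuffix T i := by
  by_contra hlt
  have he := h.lt_length
  have hp := prefix_of_le_of_le ((h.prefix_iff he).2 ⟨h.1, le_rfl⟩) (List.prefix_append α z)
    ((rankedSuffix_le_iff he hn).2 hi.le) (not_lt.1 hlt)
  have := (h.prefix_iff hn).1 hp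
  omega

theorem insertionPoint_mem (h : IsSAInterval T α b e) {z : List (Fin σ)} {x : ℕ}
    (hx : IsInsertionPoint T (α ++ z) x) : b ≤ x ∧ x ≤ e + 1 := by
  have he := h.lt_length
  have := h.1
  constructor
  · by_contra hlt
    exact lt_irrefl _ ((hx.2 x (by omega)).2 (h.lt_append_of_lt (not_le.1 hlt) z))
  · by_contra hlt
    have h1 := hx.1
    have h2 := (hx.2 (e + 1) (by omega)).1 (by omega)
    exact lt_asymm h2 (h.append_lt_of_lt (Nat.lt_succ_self e) (by omega) z)

theorem lt_insertionPoint_iff (h : IsSAInterval T α b e) {r x i : ℕ} (hr : r < T.length)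
    (hx : IsInsertionPoint T (α ++ rankedSuffix T r) x) (hb : b ≤ i) (he : i ≤ e) :
    i < x ↔ suffixCount T (saEntry T i + α.length) < r + 1 := by
  rw [hx.2 i (lt_of_le_of_lt he h.lt_length), h.rankedSuffix_lt_append_iff hb he hr]

/-- The occurrences of `α ++ β` in terms of two insertion points. -/
theorem mem_occPositions_append_iff (h : IsSAInterval T α b e) {β : List (Fin σ)} (hβ : β ≠ [])
    {b' e' x y y' : ℕ} (h' : IsSAInterval T β b' e')
    (hx : IsInsertionPoint T (α ++ rankedSuffix T b') x)
    (hy : IsInsertionPoint T (α ++ rankedSuffix T e') y)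
    (hy' : y' = if y ≤ e ∧ suffixCount T (saEntry T y + α.length) = e' + 1 then y + 1 else y)
    (i : ℕ) : i ∈ occPositions T (α ++ β) ↔ x ≤ i ∧ i < y' := by
  have he := h.lt_length
  have he' := h'.lt_length
  have hb' : b' < T.length := lt_of_le_of_lt h'.1 he'
  have hxm := h.insertionPoint_mem hx
  have hym := h.insertionPoint_mem hy
  -- The rest behind `α` must have its rank in `[b'..e']`. An empty rest has count `0` and fails the
  -- right-hand side; `hβ` makes it fail the left-hand side as well.
  have key : ∀ i, b ≤ i → i ≤ e → (i ∈ occPositions T (α ++ β) ↔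
      b' + 1 ≤ suffixCount T (saEntry T i + α.length) ∧
        suffixCount T (saEntry T i + α.length) ≤ e' + 1) := by
    intro i hbi hie
    have hi := lt_of_le_of_lt hie he
    have hle := h.saEntry_add_le hbi hie
    simp only [occPositions, Set.mem_ofPred_eq, hi, true_and]
    rw [h.rankedSuffix_eq hbi hie, List.prefix_append_right_inj]
    rcases hle.eq_or_lt with heq | hlt
    · rw [heq, suffixCount_length, List.drop_length]
      simp [hβ]
    · rw [← rankedSuffix_suffixCount hlt, h'.prefix_iff]
      · rw [suffixCount_of_lt hlt]; omega
      · rw [suffixCount_of_lt hlt]; exact Fin.is_lt _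
  constructor
  · intro hi
    have hmem := (h.prefix_iff hi.1).1 ((List.prefix_append α β).trans hi.2)
    have h1 := (key i hmem.1 hmem.2).1 hi
    have h2 := h.lt_insertionPoint_iff hb' hx hmem.1 hmem.2
    have h3 := h.lt_insertionPoint_iff he' hy hmem.1 hmem.2
    refine ⟨by omega, ?_⟩
    rcases lt_or_ge i y with hlt | hge
    · split_ifs at hy' <;> omega
    · have h4 := h.lt_insertionPoint_iff (i := y) he' hy hym.1 (by omega)
      -- The insertion point `y` counts only suffixes below `α` followed by suffix `e'`. Equality is
      -- possible at the index `y` alone, because counts are strictly increasing on `[b..e]`; this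
      -- is the correction made in `y'`.
      rcases hge.eq_or_lt with rfl | hlt
      · rw [if_pos ⟨hmem.2, by omega⟩] at hy'
        omega
      · exfalso
        have h5 := (rankedSuffix_lt_iff (by omega) hi.1).2 hlt
        rw [h.rankedSuffix_eq hym.1 (by omega), h.rankedSuffix_eq hmem.1 hmem.2,
          append_lt_append_iff, ← suffixCount_lt_iff (h.saEntry_add_le hym.1 (by omega))
            (h.saEntry_add_le hmem.1 hmem.2)] at h5
        omega
  · rintro ⟨h1, h2⟩
    have h6 : i ≤ e := by split_ifs at hy' <;> omega
    have h7 := h.lt_insertionPoint_iff hb' hx (by omega : b ≤ i) h6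
    have h3 := h.lt_insertionPoint_iff he' hy (by omega : b ≤ i) h6
    refine (key i (by omega) h6).2 ⟨by omega, ?_⟩
    split_ifs at hy' with hc
    · rcases Nat.lt_succ_iff_lt_or_eq.1 (hy' ▸ h2) with h8 | rfl
      · omega
      · exact hc.2.le
    · omega

end IsSAInterval

/-! ### Integer keys that compare like strings -/

/-- A string `Y` is compared with other strings relative to a fixed string `C`: the key of `Y`
consists of the length of the longest common prefix with `C` (reflected if `Y` is larger than `C`)
and the rank of the rest of `Y`, which is the suffix of `T` at position `p`. -/
def stringKey {σ : ℕ} (T C Y : List (Fin σ)) (p : ℕ) : ℕ :=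
  (if Y ≤ C then lcpLength Y C else 2 * T.length + 1 - lcpLength Y C) * 2 ^ Nat.size T.length +
    suffixCount T p

/-- Among strings up to `C` a longer agreement with `C` means a larger string, among strings above
`C` a smaller one, whence the reflection. The values `0..n` and `n + 1..2 * n + 1` keep the two
sides apart. On the same side and with the same agreement, the rests decide. -/
theorem stringKey_lt_stringKey {σ : ℕ} {T C X Y : List (Fin σ)} {p q : ℕ}
    (hC : C.length ≤ T.length) (hp : p ≤ T.length) (hq : q ≤ T.length)
    (hY : T.drop p = Y.drop (lcpLength Y C)) (hX : T.drop q = X.drop (lcpLength X C))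
    (h : Y < X) : stringKey T C Y p < stringKey T C X q := by
  have hW := Nat.lt_size_self T.length
  have hcp := suffixCount_le T p
  have hY' := lcpLength_le_right Y C
  have hX' := lcpLength_le_right X C
  have step : ∀ u v c d W : ℕ, u < v → c < W → u * W + c < v * W + d := by
    intro u v c d W huv hc
    nlinarith
  unfold stringKey
  rcases lt_trichotomy (lcpLength Y C) (lcpLength X C) with hl | hl | hl
  · have h1 := lt_iff_lt_of_lcpLength_lt hl
    rw [if_pos (h1.2 h).le]
    exact step _ _ _ _ _ (by split_ifs <;> omega) (by omega)
  · have h1 := (suffixCount_lt_iff hp hq).2 (by rw [hY, hX]; exact (lt_iff_drop_lt_drop hl).1 h)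
    by_cases hXC : X ≤ C
    · rw [if_pos hXC, if_pos (h.le.trans hXC), hl]
      omega
    · rw [if_neg hXC]
      split_ifs with hYC
      · exact step _ _ _ _ _ (by omega) (by omega)
      · rw [hl]; omega
  · have h1 := lt_iff_lt_of_lcpLength_lt hl
    have hXC : ¬ X ≤ C := by
      rw [le_iff_lt_or_eq, not_or]
      constructor
      · intro hXC; exact lt_asymm h (h1.1 hXC)
      · rintro rfl
        rw [lcpLength_self] at hl
        omega
    rw [if_neg hXC]
    exact step _ _ _ _ _ (by split_ifs <;> omega) (by omega)

theorem stringKey_lt_iff {σ : ℕ} {T C X Y : List (Fin σ)} {p q : ℕ}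
    (hC : C.length ≤ T.length) (hp : p ≤ T.length) (hq : q ≤ T.length)
    (hY : T.drop p = Y.drop (lcpLength Y C)) (hX : T.drop q = X.drop (lcpLength X C)) :
    stringKey T C Y p < stringKey T C X q ↔ Y < X := by
  refine ⟨fun h => ?_, stringKey_lt_stringKey hC hp hq hY hX⟩
  rcases lt_trichotomy Y X with h1 | rfl | h1
  · exact h1
  · have h2 : suffixCount T p = suffixCount T q := by
      refine le_antisymm ?_ ?_ <;> rw [← not_lt, suffixCount_lt_iff] <;> first | assumption | skip
      all_goals rw [hY, hX]; exact lt_irrefl _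
    simp [stringKey, h2] at h
  · exact absurd h (lt_asymm (stringKey_lt_stringKey hC hq hp hX hY h1))

theorem stringKey_lt {σ : ℕ} (T C Y : List (Fin σ)) (p : ℕ) (hC : C.length ≤ T.length) :
    stringKey T C Y p < 2 ^ (2 * Nat.size T.length + 1) := by
  have hW := Nat.lt_size_self T.length
  have hcp := suffixCount_le T p
  have hY' := lcpLength_le_right Y C
  have h1 : (if Y ≤ C then lcpLength Y C else 2 * T.length + 1 - lcpLength Y C) + 1 ≤
      2 * 2 ^ Nat.size T.length := by split_ifs <;> omega
  have h2 : 2 ^ (2 * Nat.size T.length + 1) =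
      2 * 2 ^ Nat.size T.length * 2 ^ Nat.size T.length := by
    rw [pow_succ, two_mul, pow_add]; ring
  rw [h2, stringKey]
  nlinarith

theorem rankedSuffix_length_le {σ : ℕ} (T : List (Fin σ)) (i : ℕ) :
    (rankedSuffix T i).length ≤ T.length := by
  unfold rankedSuffix
  split_ifs <;> simp

/-! ### Sampled suffixes -/

/-- The rank of the sampled suffix number `j`. -/
def sampleRank (L j : ℕ) : ℕ := L * j + L - 1

/-- The sample that serves as the centre of the block of the `2 ^ k` samples `j` with
`j / 2 ^ k = t`. -/
def blockCenter (k t : ℕ) : ℕ := if k = 0 then t else (2 * t + 1) * 2 ^ (k - 1)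

/-- The key of the sample `j` in its block of size `2 ^ k`. -/
def sampleKey {σ : ℕ} (T : List (Fin σ)) (L k j : ℕ) : ℕ :=
  stringKey T (rankedSuffix T (sampleRank L (blockCenter k (j / 2 ^ k))))
    (rankedSuffix T (sampleRank L j))
    (saEntry T (sampleRank L j) + lcpLength (rankedSuffix T (sampleRank L j))
      (rankedSuffix T (sampleRank L (blockCenter k (j / 2 ^ k)))))

theorem sampleKey_lt {σ : ℕ} (T : List (Fin σ)) (L k j : ℕ) :
    sampleKey T L k j < 2 ^ (2 * Nat.size T.length + 1) :=
  stringKey_lt _ _ _ _ (rankedSuffix_length_le _ _)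

theorem sampleRank_lt {L n j : ℕ} (hL : 0 < L) (hj : j < n / L) : sampleRank L j < n := by
  have h1 : L * (j + 1) ≤ L * (n / L) := Nat.mul_le_mul_left _ hj
  have h2 := Nat.mul_div_le n L
  unfold sampleRank
  rw [mul_add] at h1
  omega

theorem saEntry_add_lcpLength {σ : ℕ} {T : List (Fin σ)} {i : ℕ} (hi : i < T.length)
    (z : List (Fin σ)) : saEntry T i + lcpLength (rankedSuffix T i) z ≤ T.length ∧
      T.drop (saEntry T i + lcpLength (rankedSuffix T i) z) =
        (rankedSuffix T i).drop (lcpLength (rankedSuffix T i) z) := by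
  have h1 := lcpLength_le_left (rankedSuffix T i) z
  have h2 := saEntry_lt hi
  constructor
  · rw [rankedSuffix_eq_drop hi, List.length_drop] at h1
    rw [rankedSuffix_eq_drop hi]
    omega
  · rw [← List.drop_drop, ← rankedSuffix_eq_drop hi]

/-- The stored keys of a block and the key of a query string are comparable because they refer to
the same centre. A last, incomplete block may have a centre out of range, which then reads as the
empty string; this is harmless, since the bounds on keys need no more than the length of the centre.
-/
theorem sampleKey_lt_stringKey_iff {σ : ℕ} {T X : List (Fin σ)} {L k j p : ℕ} (hL : 0 < L)
    (hj : j < T.length / L) (hp : p ≤ T.length)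
    (hX : T.drop p = X.drop (lcpLength X
      (rankedSuffix T (sampleRank L (blockCenter k (j / 2 ^ k)))))) :
    sampleKey T L k j < stringKey T
      (rankedSuffix T (sampleRank L (blockCenter k (j / 2 ^ k)))) X p ↔
        rankedSuffix T (sampleRank L j) < X :=
  have h := saEntry_add_lcpLength (sampleRank_lt hL hj)
    (rankedSuffix T (sampleRank L (blockCenter k (j / 2 ^ k))))
  stringKey_lt_iff (rankedSuffix_length_le _ _) h.1 hp h.2 hX

theorem sampleKey_strictMono {σ : ℕ} {T : List (Fin σ)} {L k i j : ℕ} (hL : 0 < L)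
    (hij : i < j) (hj : j < T.length / L) (hk : i / 2 ^ k = j / 2 ^ k) :
    sampleKey T L k i < sampleKey T L k j := by
  have hi := sampleRank_lt hL (hij.trans hj)
  have hj' := sampleRank_lt hL hj
  have h := saEntry_add_lcpLength hi
    (rankedSuffix T (sampleRank L (blockCenter k (j / 2 ^ k))))
  have h' := saEntry_add_lcpLength hj'
    (rankedSuffix T (sampleRank L (blockCenter k (j / 2 ^ k))))
  unfold sampleKey
  rw [hk]
  refine stringKey_lt_stringKey (rankedSuffix_length_le _ _) h.1 h'.1 h.2 h'.2 ?_
  rw [rankedSuffix_lt_iff hi hj']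
  unfold sampleRank
  nlinarith [Nat.mul_le_mul_left L (Nat.succ_le_of_lt hij), Nat.succ_le_of_lt hij,
    Nat.sub_add_cancel (by omega : 1 ≤ L * i + L), Nat.sub_add_cancel (by omega : 1 ≤ L * j + L)]

/-! ### The centre of the smallest block that contains an interval -/

/-- By minimality of the block, `a` and `b` lie in different halves, and the centre is the first
element of the right half. The formula in terms of `b` is the one that the program evaluates;
truncated subtraction makes it correct for `k = 0` too. -/
theorem blockCenter_mem {a b k : ℕ} (hab : a ≤ b) (hk : a / 2 ^ k = b / 2 ^ k)
    (hmin : ∀ i < k, a / 2 ^ i ≠ b / 2 ^ i) :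
    blockCenter k (a / 2 ^ k) = b / 2 ^ (k - 1) * 2 ^ (k - 1) ∧
      a ≤ blockCenter k (a / 2 ^ k) ∧ blockCenter k (a / 2 ^ k) ≤ b := by
  rcases Nat.eq_zero_or_pos k with rfl | hk0
  · simp only [pow_zero, Nat.div_one] at hk
    subst hk
    simp [blockCenter]
  · obtain ⟨m, rfl⟩ : ∃ m, k = m + 1 := ⟨k - 1, by omega⟩
    have hm := hmin m (Nat.lt_succ_self m)
    have hle : a / 2 ^ m ≤ b / 2 ^ m := Nat.div_le_div_right hab
    rw [pow_succ, ← Nat.div_div_eq_div_mul, ← Nat.div_div_eq_div_mul] at hk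
    have e1 : blockCenter (m + 1) (a / 2 ^ (m + 1)) = b / 2 ^ m * 2 ^ m := by
      rw [blockCenter, if_neg (Nat.succ_ne_zero m), Nat.add_sub_cancel, pow_succ,
        ← Nat.div_div_eq_div_mul]
      congr 1
      omega
    rw [e1, Nat.add_sub_cancel]
    refine ⟨rfl, ?_, Nat.div_mul_le_self b _⟩
    have h1 : a < (a / 2 ^ m + 1) * 2 ^ m := by
      have := Nat.lt_div_mul_add (a := a) (b := 2 ^ m) (by positivity)
      linarith
    exact h1.le.trans (Nat.mul_le_mul_right _ (by omega))

/-! ### Successor search through the longest prefix -/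

/-- If `l` is the least number such that the key of some element of `J` agrees with `q` above the
lowest `l` bits, then the position of `q` among the keys is one end of the class of these
elements. -/
theorem lt_iff_of_least_shift {J : Set ℕ} {f : ℕ → ℕ} (hf : StrictMonoOn f J) {q l j₁ j₂ : ℕ}
    (h₁ : IsLeast {j | j ∈ J ∧ f j / 2 ^ l = q / 2 ^ l} j₁)
    (h₂ : IsGreatest {j | j ∈ J ∧ f j / 2 ^ l = q / 2 ^ l} j₂)
    (hl : ∀ i < l, ∀ j ∈ J, f j / 2 ^ i ≠ q / 2 ^ i) {j : ℕ} (hj : j ∈ J) :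
    j < (if l = 0 ∨ q / 2 ^ (l - 1) % 2 = 0 then j₁ else j₂ + 1) ↔ f j < q := by
  have mono : ∀ i j, i ∈ J → j ∈ J → i ≤ j → f i ≤ f j := fun i j hi hj h => hf.monotoneOn hi hj h
  have hdiv : ∀ x y : ℕ, x / 2 ^ l < y / 2 ^ l → x < y := fun x y h => by
    by_contra hc; exact absurd (Nat.div_le_div_right (not_lt.1 hc)) (not_le.2 h)
  have hj₁ := mono j₁ j h₁.1.1 hj
  have hj₁' := mono j j₁ hj h₁.1.1
  have hj₂ := mono j₂ j h₂.1.1 hj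
  have hj₂' := mono j j₂ hj h₂.1.1
  have c₁ := h₁.1.2
  have c₂ := h₂.1.2
  rcases Nat.eq_zero_or_pos l with rfl | hl0
  · simp only [pow_zero, Nat.div_one] at c₁
    simp only [true_or, if_true]
    rw [← c₁]
    exact (hf.lt_iff_lt hj h₁.1.1).symm
  obtain ⟨m, rfl⟩ : ∃ m, l = m + 1 := ⟨l - 1, by omega⟩
  simp only [Nat.succ_ne_zero, false_or, Nat.add_sub_cancel]
  -- By minimality of `l = m + 1`, each key in the class of `q` differs from `q` in bit `m`. So all
  -- of them lie on the same side of `q`, and bit `m` of `q` tells on which.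
  have hcls : ∀ i, i ∈ J → f i / 2 ^ (m + 1) = q / 2 ^ (m + 1) →
      (f i < q ↔ q / 2 ^ m % 2 ≠ 0) := by
    intro i hi hc
    have hne := hl m (Nat.lt_succ_self m) i hi
    rw [pow_succ, ← Nat.div_div_eq_div_mul, ← Nat.div_div_eq_div_mul] at hc
    have hdm : ∀ x y : ℕ, x / 2 ^ m < y / 2 ^ m → x < y := fun x y h => by
      by_contra hc; exact absurd (Nat.div_le_div_right (not_lt.1 hc)) (not_le.2 h)
    constructor
    · intro hlt
      have : f i / 2 ^ m ≤ q / 2 ^ m := Nat.div_le_div_right hlt.le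
      omega
    · intro hb
      exact hdm _ _ (by omega)
  by_cases hb : q / 2 ^ m % 2 = 0
  · rw [if_pos hb]
    constructor
    · intro hlt
      have h3 : f j / 2 ^ (m + 1) ≠ q / 2 ^ (m + 1) := fun h =>
        absurd (h₁.2 ⟨hj, h⟩) (not_le.2 hlt)
      have h4 : f j / 2 ^ (m + 1) ≤ f j₁ / 2 ^ (m + 1) := Nat.div_le_div_right (hj₁' hlt.le)
      exact hdiv _ _ (by omega)
    · intro hlt
      by_contra hge
      have h5 := (hcls j₁ h₁.1.1 c₁).not.2 (by simpa using hb)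
      have := hj₁ (not_lt.1 hge)
      omega
  · rw [if_neg hb]
    constructor
    · intro hlt
      have h5 := (hcls j₂ h₂.1.1 c₂).2 hb
      exact lt_of_le_of_lt (hj₂' (Nat.lt_succ_iff.1 hlt)) h5
    · intro hlt
      by_contra hge
      have h3 : f j / 2 ^ (m + 1) ≠ q / 2 ^ (m + 1) := fun h => by
        have := h₂.2 ⟨hj, h⟩
        omega
      have h4 : f j₂ / 2 ^ (m + 1) ≤ f j / 2 ^ (m + 1) := Nat.div_le_div_right (hj₂ (by omega))
      exact lt_asymm hlt (hdiv _ _ (by omega))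

/-- An insertion point into the samples of a block that covers all samples in `[b..e]` narrows down
the insertion point into the suffix array. -/
theorem IsSAInterval.insertionPoint_window {σ : ℕ} {T α : List (Fin σ)} {b e : ℕ}
    (h : IsSAInterval T α b e) {z : List (Fin σ)} {x L k j : ℕ} (hL : 0 < L)
    (hx : IsInsertionPoint T (α ++ z) x) (hab : b / L < (e + 1) / L)
    (hk : b / L / 2 ^ k = ((e + 1) / L - 1) / 2 ^ k)
    (hj : ∀ i < T.length / L, i / 2 ^ k = b / L / 2 ^ k →
      (i < j ↔ rankedSuffix T (sampleRank L i) < α ++ z))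
    (hj₁ : b / L / 2 ^ k * 2 ^ k ≤ j) (hj₂ : j ≤ (b / L / 2 ^ k + 1) * 2 ^ k)
    (hj₃ : j ≤ T.length / L) :
    max b (L * j) ≤ x ∧ x ≤ min (e + 1) (L * j + L - 1) := by
  obtain ⟨hbx, hxe⟩ := h.insertionPoint_mem hx
  have hen : (e + 1) / L ≤ T.length / L := Nat.div_le_div_right h.lt_length
  have hdiv : ∀ i t : ℕ, t * 2 ^ k ≤ i → i < (t + 1) * 2 ^ k → i / 2 ^ k = t := fun i t h1 h2 =>
    Nat.div_eq_of_lt_le h1 h2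
  have hN : ∀ i < T.length / L, sampleRank L i < T.length := fun i hi => sampleRank_lt hL hi
  have hbL := Nat.mul_div_le b L
  have heL : e + 1 < (e + 1) / L * L + L := Nat.lt_div_mul_add hL
  generalize b / L = a at *
  generalize (e + 1) / L = c at *
  generalize T.length / L = N at *
  have hak := Nat.div_mul_le_self a (2 ^ k)
  have hck := Nat.lt_div_mul_add (a := c - 1) (b := 2 ^ k) (by positivity)
  rw [← hk] at hck
  generalize a / 2 ^ k = t at *
  rw [add_mul, one_mul] at hj₂
  simp only [add_mul, one_mul] at hdiv
  refine ⟨max_le hbx ?_, le_min hxe ?_⟩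
  -- Either the interval itself gives the lower bound, or sample `j - 1` lies in the block and is
  -- smaller than the string.
  · rcases le_or_gt j a with hle | hgt
    · exact (Nat.mul_le_mul_left L hle).trans (hbL.trans hbx)
    · have h1 : j - 1 < N := by omega
      have h2 : (j - 1) / 2 ^ k = t := hdiv _ _ (by omega) (by omega)
      have h3 := (hx.2 _ (hN _ h1)).2 ((hj _ h1 h2).1 (by omega))
      obtain ⟨i, rfl⟩ : ∃ i, j = i + 1 := ⟨j - 1, by omega⟩
      rw [sampleRank, Nat.add_sub_cancel] at h3
      rw [mul_add, mul_one]
      omega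
  -- Likewise from above: either sample `j` is not smaller than the string, or all samples up to `e`
  -- precede `j`, and then less than one distance is left.
  · rcases lt_or_ge j c with hlt | hge
    · have h1 : j < N := by omega
      have h3 := (hx.2 _ (hN _ h1)).not.2
        ((hj _ h1 (hdiv _ _ hj₁ (by omega))).not.1 (lt_irrefl j))
      rw [sampleRank] at h3
      omega
    · have h2 := Nat.mul_le_mul_left L hge
      rw [mul_comm] at heL
      omega


/-! ### Perfect hashing with two levels -/

theorem card_filter_dvd_sub_le (p r : ℕ) :
    ((Finset.Ioc 0 (p - 1)).filter fun d => r ∣ p - d).card ≤ (p - 1) / r := by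
  rw [← Nat.Ioc_filter_dvd_card_eq_div]
  refine Finset.card_le_card_of_injOn (fun d => p - d) ?_ ?_
  · intro d hd
    simp only [Finset.coe_filter, Finset.mem_Ioc, Set.mem_ofPred_eq] at hd ⊢
    exact ⟨by omega, hd.2⟩
  · intro d hd e he h
    simp only [Finset.coe_filter, Finset.mem_Ioc, Set.mem_ofPred_eq] at hd he h
    omega

/-- For two different keys, few multipliers lead to a collision. -/
theorem card_filter_collision_le {p : ℕ} (hp : p.Prime) (r : ℕ) {x y : ℕ} (hx : x < p)
    (hy : y < p) (hxy : x ≠ y) :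
    ((Finset.Ico 1 p).filter fun a => a * x % p % r = a * y % p % r).card ≤
      2 * ((p - 1) / r) := by
  wlog h : x < y generalizing x y
  · have := this hy hx hxy.symm (by omega)
    simpa only [eq_comm] using this
  have hp0 := hp.pos
  obtain ⟨δ, rfl⟩ : ∃ δ, y = x + δ := ⟨y - x, by omega⟩
  have hδ : ∀ a, 0 < a → a < p → ¬ p ∣ a * δ := fun a h1 h2 h3 => by
    rcases hp.dvd_mul.1 h3 with h4 | h4
    · exact absurd (Nat.le_of_dvd h1 h4) (by omega)
    · exact absurd (Nat.le_of_dvd (by omega) h4) (by omega)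
  -- With `d = a * δ % p`, the residue of `a * y` is that of `a * x` plus `d`, or this minus `p`. So
  -- a collision modulo `r` forces `r ∣ d` or `r ∣ p - d`, and each case has at most `(p - 1) / r`
  -- solutions `d`. Multiplication by `δ` is injective modulo `p`, so this also bounds the number of
  -- multipliers.
  have hsub : ((Finset.Ico 1 p).filter
      fun a => a * x % p % r = a * (x + δ) % p % r).image (fun a => a * δ % p) ⊆
      ((Finset.Ioc 0 (p - 1)).filter fun d => r ∣ d) ∪
        ((Finset.Ioc 0 (p - 1)).filter fun d => r ∣ p - d) := by
    intro d hd
    simp only [Finset.mem_image, Finset.mem_filter, Finset.mem_Ico] at hd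
    obtain ⟨a, ⟨⟨ha1, ha2⟩, ha⟩, rfl⟩ := hd
    have hd0 : 0 < a * δ % p :=
      Nat.pos_of_ne_zero fun h0 => hδ a ha1 ha2 (Nat.dvd_of_mod_eq_zero h0)
    have hd1 := Nat.mod_lt (a * δ) hp0
    have hu := Nat.mod_lt (a * x) hp0
    have hadd : (a * x % p + a * δ % p) % p = a * (x + δ) % p := by
      rw [← Nat.add_mod, mul_add]
    simp only [Finset.mem_union, Finset.mem_filter, Finset.mem_Ioc]
    rw [← hadd] at ha
    rcases lt_or_ge (a * x % p + a * δ % p) p with hlt | hge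
    · left
      rw [Nat.mod_eq_of_lt hlt] at ha
      refine ⟨by omega, ?_⟩
      have := (Nat.modEq_iff_dvd' (n := r) (Nat.le_add_right (a * x % p) (a * δ % p))).1 ha
      simpa using this
    · right
      have hlt : a * x % p + a * δ % p - p < p := by omega
      rw [Nat.mod_eq_sub_mod hge, Nat.mod_eq_of_lt hlt] at ha
      refine ⟨by omega, ?_⟩
      have := (Nat.modEq_iff_dvd' (n := r) (by omega :
        a * x % p + a * δ % p - p ≤ a * x % p)).1 (Eq.symm ha)
      rwa [show a * x % p - (a * x % p + a * δ % p - p) = p - a * δ % p by omega] at this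
  rw [← Finset.card_image_of_injOn (f := fun a => a * δ % p)]
  · refine (Finset.card_le_card hsub).trans ((Finset.card_union_le _ _).trans ?_)
    rw [Nat.Ioc_filter_dvd_card_eq_div]
    have := card_filter_dvd_sub_le p r
    omega
  · have key : ∀ a b, a < b → b < p → a * δ % p ≠ b * δ % p := by
      intro a b hab hb heq
      have := (Nat.modEq_iff_dvd' (n := p) (Nat.mul_le_mul_right δ hab.le)).1 heq
      rw [← Nat.sub_mul] at this
      exact hδ (b - a) (by omega) (by omega) this
    intro a ha b hb hab
    simp only [Finset.coe_filter, Finset.mem_Ico, Set.mem_ofPred_eq] at ha hb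
    rcases lt_trichotomy a b with h1 | h1 | h1
    · exact absurd hab (key a b h1 hb.1.2)
    · exact h1
    · exact absurd hab.symm (key b a h1 ha.1.2)

/-- Some multiplier leads to few collisions. -/
theorem exists_few_collisions {p : ℕ} (hp : p.Prime) (r : ℕ) (S : Finset ℕ)
    (hS : ∀ x ∈ S, x < p) : ∃ a < p,
      (S.offDiag.filter fun z => a * z.1 % p % r = a * z.2 % p % r).card * r ≤
        2 * S.offDiag.card := by
  by_contra hcon
  push Not at hcon
  -- Averaging: the collisions are counted pair by pair over all `p - 1` multipliers.
  have h1 : ∑ a ∈ Finset.Ico 1 p,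
      (S.offDiag.filter fun z => a * z.1 % p % r = a * z.2 % p % r).card ≤
        S.offDiag.card * (2 * ((p - 1) / r)) := by
    have hcomm := Finset.sum_card_bipartiteAbove_eq_sum_card_bipartiteBelow
      (s := Finset.Ico 1 p) (t := S.offDiag)
      (fun a (z : ℕ × ℕ) => a * z.1 % p % r = a * z.2 % p % r)
    simp only [Finset.bipartiteAbove, Finset.bipartiteBelow] at hcomm
    rw [hcomm]
    refine Finset.sum_le_card_nsmul _ _ _ fun z hz => ?_
    rw [Finset.mem_offDiag] at hz
    exact card_filter_collision_le hp r (hS _ hz.1) (hS _ hz.2.1) hz.2.2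
  have h2 : ∑ _a ∈ Finset.Ico 1 p, (2 * S.offDiag.card) < ∑ a ∈ Finset.Ico 1 p,
      (S.offDiag.filter fun z => a * z.1 % p % r = a * z.2 % p % r).card * r :=
    Finset.sum_lt_sum_of_nonempty ⟨1, by simp [hp.one_lt]⟩
      fun a ha => hcon a (Finset.mem_Ico.1 ha).2
  rw [Finset.sum_const, Nat.card_Ico, smul_eq_mul, ← Finset.sum_mul] at h2
  have h3 := Nat.mul_le_mul_right r h1
  have h4 : S.offDiag.card * (2 * ((p - 1) / r)) * r ≤ (p - 1) * (2 * S.offDiag.card) := by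
    calc S.offDiag.card * (2 * ((p - 1) / r)) * r
        = 2 * S.offDiag.card * ((p - 1) / r * r) := by ring
      _ ≤ 2 * S.offDiag.card * (p - 1) := Nat.mul_le_mul_left _ (Nat.div_mul_le_self _ _)
      _ = _ := by ring
  omega

/-- The table size exceeds twice the number of ordered pairs, so the bound on collisions drops below
one. -/
theorem exists_injOn_hash {p : ℕ} (hp : p.Prime) (S : Finset ℕ) (hS : ∀ x ∈ S, x < p) :
    ∃ a < p, Set.InjOn (fun x => a * x % p % (2 * S.offDiag.card + 1)) S := by
  obtain ⟨a, ha, h⟩ := exists_few_collisions hp (2 * S.offDiag.card + 1) S hS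
  refine ⟨a, ha, fun x hx y hy hxy => ?_⟩
  by_contra hne
  have : 0 < (S.offDiag.filter fun z => a * z.1 % p % (2 * S.offDiag.card + 1) =
      a * z.2 % p % (2 * S.offDiag.card + 1)).card :=
    Finset.card_pos.2 ⟨(x, y), Finset.mem_filter.2 ⟨Finset.mem_offDiag.2 ⟨hx, hy, hne⟩, hxy⟩⟩
  nlinarith

/-- The slot of the key `x` under two-level hashing: the bucket `a * x % p % r` selects the
multiplier, the size and the offset of a hash table for the keys in this bucket. -/
def hashSlot (p a r : ℕ) (A R O : ℕ → ℕ) (x : ℕ) : ℕ :=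
  O (a * x % p % r) + A (a * x % p % r) * x % p % R (a * x % p % r)

/-- The Fredman–Komlós–Szemerédi scheme. With `m = S.card + 1` buckets some multiplier causes at
most `2 * m` colliding ordered pairs. Each bucket gets an injective table of size twice its number
of pairs plus one; the sizes add up to at most `2 * (2 * m) + m = 5 * m`. -/
theorem exists_perfect_hash {p : ℕ} (hp : p.Prime) (S : Finset ℕ) (hS : ∀ x ∈ S, x < p) :
    ∃ (a : ℕ) (A R O : ℕ → ℕ), a < p ∧ (∀ i, A i < p) ∧ (∀ i, 0 < R i) ∧
      (∀ i < S.card + 1, O i + R i ≤ 5 * (S.card + 1)) ∧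
      Set.InjOn (hashSlot p a (S.card + 1) A R O) S := by
  obtain ⟨a, ha, hcoll⟩ := exists_few_collisions hp (S.card + 1) S hS
  let B : ℕ → Finset ℕ := fun i => S.filter fun x => a * x % p % (S.card + 1) = i
  have hB : ∀ i, ∃ A < p, Set.InjOn (fun x => A * x % p % (2 * (B i).offDiag.card + 1)) (B i) :=
    fun i => exists_injOn_hash hp (B i) fun x hx => hS x (Finset.mem_filter.1 hx).1
  choose A hA hinj using hB
  let R : ℕ → ℕ := fun i => 2 * (B i).offDiag.card + 1
  let O : ℕ → ℕ := fun i => ∑ j ∈ Finset.range i, R j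
  have hmono : ∀ i j, i < j → O i + R i ≤ O j := fun i j hij => by
    rw [← Finset.sum_range_succ]
    exact Finset.sum_le_sum_of_subset (Finset.range_subset_range.2 hij)
  have hsum : ∑ i ∈ Finset.range (S.card + 1), (B i).offDiag.card ≤ 2 * (S.card + 1) := by
    have hdis : ∑ i ∈ Finset.range (S.card + 1), (B i).offDiag.card ≤ (S.offDiag.filter fun z =>
        a * z.1 % p % (S.card + 1) = a * z.2 % p % (S.card + 1)).card := by
      rw [← Finset.card_biUnion]
      · refine Finset.card_le_card fun z hz => ?_
        obtain ⟨i, -, hz⟩ := Finset.mem_biUnion.1 hz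
        simp only [B, Finset.mem_offDiag, Finset.mem_filter] at hz ⊢
        exact ⟨⟨hz.1.1, hz.2.1.1, hz.2.2⟩, hz.1.2.trans hz.2.1.2.symm⟩
      · intro i _ j _ hij
        refine Finset.disjoint_left.2 fun z h1 h2 => hij ?_
        simp only [B, Finset.mem_offDiag, Finset.mem_filter] at h1 h2
        exact h1.1.2.symm.trans h2.1.2
    refine hdis.trans (Nat.le_of_mul_le_mul_right (hcoll.trans ?_) (Nat.succ_pos S.card))
    rw [Finset.offDiag_card, mul_assoc]
    exact Nat.mul_le_mul_left 2 ((Nat.sub_le _ _).trans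
      (Nat.mul_le_mul (Nat.le_succ _) (Nat.le_succ _)))
  have htot : O (S.card + 1) ≤ 5 * (S.card + 1) := by
    simp only [O, R, Finset.sum_add_distrib, ← Finset.mul_sum, Finset.sum_const,
      Finset.card_range, smul_eq_mul]
    omega
  refine ⟨a, A, R, O, ha, hA, fun i => Nat.succ_pos _,
    fun i hi => (hmono i _ hi).trans htot, fun x hx y hy hxy => ?_⟩
  simp only [hashSlot] at hxy
  have hR : ∀ i, 0 < R i := fun i => Nat.succ_pos _
  have hx' := Nat.mod_lt (A (a * x % p % (S.card + 1)) * x % p)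
    (hR (a * x % p % (S.card + 1)))
  have hy' := Nat.mod_lt (A (a * y % p % (S.card + 1)) * y % p)
    (hR (a * y % p % (S.card + 1)))
  rcases lt_trichotomy (a * x % p % (S.card + 1)) (a * y % p % (S.card + 1)) with h | h | h
  · have := hmono _ _ h
    omega
  · refine hinj (a * x % p % (S.card + 1)) (Finset.mem_filter.2 ⟨hx, rfl⟩)
      (Finset.mem_filter.2 ⟨hy, h.symm⟩) ?_
    rw [← h] at hxy
    exact Nat.add_left_cancel hxy
  · have := hmono _ _ h
    omega


/-! ### Costs and frames of programs -/

/-- An upper bound for the running time if no loop runs for more than `N` rounds. -/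
def Prog.cost (t N : ℕ) : Prog → ℕ
  | .skip => 1
  | .const _ _ => 1
  | .op _ _ _ _ => 1
  | .load _ _ => 1
  | .ask _ _ _ => t
  | .seq P Q => P.cost t N + Q.cost t N
  | .ite _ P Q => P.cost t N + Q.cost t N + 1
  | .while _ P => N * (P.cost t N + 1) + 1

def Prog.loopFree : Prog → Bool
  | .seq P Q => P.loopFree && Q.loopFree
  | .ite _ P Q => P.loopFree && Q.loopFree
  | .while _ _ => false
  | _ => true

/-- No loop is nested in another one. -/
def Prog.flat : Prog → Bool
  | .seq P Q => P.flat && Q.flat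
  | .ite _ P Q => P.flat && Q.flat
  | .while _ P => P.loopFree
  | _ => true

theorem Prog.cost_le_of_loopFree {t N : ℕ} (ht : 1 ≤ t) {P : Prog} (h : P.loopFree) :
    P.cost t N ≤ P.cost 1 1 * t := by
  induction P with
  | skip | const | op | load => simpa [Prog.cost] using ht
  | ask => simp [Prog.cost]
  | seq P Q ihP ihQ =>
    simp only [Prog.loopFree, Bool.and_eq_true] at h
    have := ihP h.1
    have := ihQ h.2
    simp only [Prog.cost]
    nlinarith
  | ite a P Q ihP ihQ =>
    simp only [Prog.loopFree, Bool.and_eq_true] at h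
    have := ihP h.1
    have := ihQ h.2
    simp only [Prog.cost]
    nlinarith
  | _ => simp [Prog.loopFree] at h

/-- Without nested loops the cost is linear in `N`, and the coefficient is a constant of the
program. The time analysis thus reduces to bounding the rounds of each single loop. -/
theorem Prog.cost_le_of_flat {t N : ℕ} (ht : 1 ≤ t) (hN : 1 ≤ N) {P : Prog} (h : P.flat) :
    P.cost t N ≤ P.cost 1 1 * (t * N) := by
  have htN : 1 ≤ t * N := Nat.mul_pos ht hN
  induction P with
  | skip | const | op | load => simpa [Prog.cost] using htN
  | ask => simpa [Prog.cost] using Nat.le_mul_of_pos_right t hN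
  | seq P Q ihP ihQ =>
    simp only [Prog.flat, Bool.and_eq_true] at h
    have := ihP h.1
    have := ihQ h.2
    simp only [Prog.cost]
    nlinarith
  | ite a P Q ihP ihQ =>
    simp only [Prog.flat, Bool.and_eq_true] at h
    have := ihP h.1
    have := ihQ h.2
    simp only [Prog.cost]
    nlinarith
  | _ =>
    rename_i P ih
    have := Prog.cost_le_of_loopFree (N := N) ht (P := P) h
    simp only [Prog.cost]
    have h3 : N * (P.cost t N + 1) ≤ N * (P.cost 1 1 * t + t) :=
      Nat.mul_le_mul_left N (by omega)
    nlinarith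

/-- Whether a program writes into the register `r`. -/
def Prog.writes : Prog → ℕ → Bool
  | .skip, _ => false
  | .const d _, r => d == r
  | .op _ d _ _, r => d == r
  | .load d _, r => d == r
  | .ask _ d₁ d₂, r => d₁ == r || d₂ == r
  | .seq P Q, r => P.writes r || Q.writes r
  | .ite _ P Q, r => P.writes r || Q.writes r
  | .while _ P, r => P.writes r

section Calculus

variable {σ : ℕ} {w t N : ℕ} {T : List (Fin σ)} {D : List ℕ}

theorem Exec.eq_of_not_writes {P : Prog} {s s' : ℕ → ℕ} {c : ℕ} (h : Exec w t T D P s s' c)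
    {r : ℕ} (hr : P.writes r = false) : s' r = s r := by
  induction h with
  | skip | while_false => rfl
  | const | op | load =>
    simp only [Prog.writes, beq_eq_false_iff_ne] at hr
    rw [Function.update_of_ne hr.symm]
  | ask =>
    simp only [Prog.writes, Bool.or_eq_false_iff, beq_eq_false_iff_ne] at hr
    rw [Function.update_of_ne hr.1.symm, Function.update_of_ne hr.2.symm]
  | seq _ _ ih ih' =>
    simp only [Prog.writes, Bool.or_eq_false_iff] at hr
    rw [ih' hr.2, ih hr.1]
  | ite_true _ _ ih =>
    simp only [Prog.writes, Bool.or_eq_false_iff] at hr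
    exact ih hr.1
  | ite_false _ _ ih =>
    simp only [Prog.writes, Bool.or_eq_false_iff] at hr
    exact ih hr.2
  | while_true _ _ _ ih ih' => rw [ih' hr, ih hr]

theorem Exec.lt_two_pow {P : Prog} {s s' : ℕ → ℕ} {c : ℕ} (h : Exec w t T D P s s' c)
    (hs : ∀ r, s r < 2 ^ w) : ∀ r, s' r < 2 ^ w := by
  have upd : ∀ (s : ℕ → ℕ) (d x : ℕ), (∀ r, s r < 2 ^ w) →
      ∀ r, Function.update s d (x % 2 ^ w) r < 2 ^ w := by
    intro s d x hs r
    rcases eq_or_ne r d with rfl | hr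
    · simpa using Nat.mod_lt x (by positivity)
    · rw [Function.update_of_ne hr]; exact hs r
  induction h with
  | skip | while_false => exact hs
  | const | op | load => exact upd _ _ _ hs
  | ask => exact upd _ _ _ (upd _ _ _ hs)
  | seq _ _ ih ih' => exact ih' (ih hs)
  | ite_true _ _ ih => exact ih hs
  | ite_false _ _ ih => exact ih hs
  | while_true _ _ _ ih ih' => exact ih' (ih hs)

/-! ### Expressions -/

/-- Arithmetic expressions over the registers and the stored words. -/
inductive Expr where
  | var (r : ℕ)
  | num (c : ℕ)
  | load (x : Expr)
  | bin (o : BinOp) (x y : Expr)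

def Expr.val (D : List ℕ) (v : ℕ → ℕ) : Expr → ℕ
  | .var r => v r
  | .num c => c
  | .load x => D.getD (x.val D v) 0
  | .bin o x y => o.eval (x.val D v) (y.val D v)

/-- The expression can be evaluated without an overflow. -/
def Expr.Fits (w : ℕ) (D : List ℕ) (v : ℕ → ℕ) : Expr → Prop
  | .var _ => True
  | .num c => c < 2 ^ w
  | .load x => x.Fits w D v
  | .bin .add x y => x.Fits w D v ∧ y.Fits w D v ∧ x.val D v + y.val D v < 2 ^ w
  | .bin .mul x y => x.Fits w D v ∧ y.Fits w D v ∧ x.val D v * y.val D v < 2 ^ w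
  | .bin .shl x y => x.Fits w D v ∧ y.Fits w D v ∧ x.val D v <<< y.val D v < 2 ^ w
  | .bin _ x y => x.Fits w D v ∧ y.Fits w D v

/-- The registers from `100` on hold intermediate results; the expression does not use them. -/
def Expr.named : Expr → Bool
  | .var r => r < 100
  | .num _ => true
  | .load x => x.named
  | .bin _ x y => x.named && y.named

/-- Compute the value of an expression in the register `k`. -/
def Expr.code : Expr → ℕ → Prog
  | .var r, k => .op .or k r r
  | .num c, k => .const k c
  | .load x, k => .seq (x.code k) (.load k k)
  | .bin o x y, k => .seq (x.code k) (.seq (y.code (k + 1)) (.op o k k (k + 1)))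

theorem BinOp.eval_lt_two_pow {x y : ℕ} (hw : 1 ≤ w) (hx : x < 2 ^ w) (hy : y < 2 ^ w)
    (o : BinOp) (h : o = .add ∨ o = .mul ∨ o = .shl → o.eval x y < 2 ^ w) :
    o.eval x y < 2 ^ w := by
  have h1 : 1 < 2 ^ w := Nat.one_lt_two_pow (by omega)
  cases o with
  | add | mul | shl => exact h (by simp)
  | sub => exact lt_of_le_of_lt (Nat.sub_le _ _) hx
  | div => exact lt_of_le_of_lt (Nat.div_le_self _ _) hx
  | mod => exact lt_of_le_of_lt (Nat.mod_le _ _) hx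
  | and => exact Nat.and_lt_two_pow _ hy
  | or => exact Nat.or_lt_two_pow hx hy
  | xor => exact Nat.xor_lt_two_pow hx hy
  | shr => exact lt_of_le_of_lt (Nat.shiftRight_le _ _) hx
  | lt | eq => simp only [BinOp.eval]; split_ifs <;> omega

theorem Expr.fits_bin {v : ℕ → ℕ} {o : BinOp} {x y : Expr} (h : (Expr.bin o x y).Fits w D v) :
    x.Fits w D v ∧ y.Fits w D v ∧ (o = .add ∨ o = .mul ∨ o = .shl →
      o.eval (x.val D v) (y.val D v) < 2 ^ w) := by
  cases o <;> simp only [Expr.Fits] at h <;> simp [h] <;> exact h.2.2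

/-- The registers from `k` on serve as a stack: the second operand is evaluated at `k + 1` and
leaves the first one, in register `k`, intact. -/
theorem Expr.exec_code (hw : 1 ≤ w) (hD : ∀ x ∈ D, x < 2 ^ w) {v : ℕ → ℕ} {e : Expr}
    (hf : e.Fits w D v) (he : e.named) {k : ℕ} (hk : 100 ≤ k) {s : ℕ → ℕ}
    (hs : ∀ r, s r < 2 ^ w) (hsv : ∀ r < 100, s r = v r) :
    ∃ s', Exec w t T D (e.code k) s s' ((e.code k).cost t N) ∧ s' k = e.val D v ∧
      (∀ r < k, s' r = s r) := by
  have hDv : ∀ i, D.getD i 0 < 2 ^ w := by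
    intro i
    rcases lt_or_ge i D.length with h | h
    · rw [List.getD_eq_getElem _ _ h]; exact hD _ (List.getElem_mem h)
    · rw [List.getD_eq_default _ _ h]; positivity
  induction e generalizing k s with
  | var r =>
    have hr : r < 100 := by simpa [Expr.named] using he
    refine ⟨_, Exec.op _ _ _ _ _, ?_, fun q hq => Function.update_of_ne (by omega) _ _⟩
    simp [BinOp.eval, Expr.val, hsv r hr, Nat.mod_eq_of_lt (hsv r hr ▸ hs r)]
  | num c =>
    refine ⟨_, Exec.const _ _ _, ?_, fun q hq => Function.update_of_ne (by omega) _ _⟩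
    simpa [Expr.val] using Nat.mod_eq_of_lt hf
  | load x ih =>
    obtain ⟨s₁, h₁, h₂, h₃⟩ := ih hf he hk hs hsv
    refine ⟨_, Exec.seq h₁ (Exec.load _ _ _), ?_,
      fun q hq => (Function.update_of_ne (by omega) _ _).trans (h₃ q hq)⟩
    simpa only [Function.update_self, Expr.val, h₂] using Nat.mod_eq_of_lt (hDv _)
  | bin o x y ihx ihy =>
    simp only [Expr.named, Bool.and_eq_true] at he
    obtain ⟨hfx, hfy, hfo⟩ := Expr.fits_bin hf
    obtain ⟨s₁, h₁, h₂, h₃⟩ := ihx hfx he.1 hk hs hsv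
    have hs₁ := h₁.lt_two_pow hs
    obtain ⟨s₂, h₄, h₅, h₆⟩ := ihy hfy he.2 (k := k + 1) (by omega) hs₁
      fun r hr => (h₃ r (by omega)).trans (hsv r hr)
    have hs₂ := h₄.lt_two_pow hs₁
    refine ⟨_, Exec.seq h₁ (Exec.seq h₄ (Exec.op _ _ _ _ _)), ?_, fun q hq =>
      (Function.update_of_ne (by omega) _ _).trans ((h₆ q (by omega)).trans (h₃ q hq))⟩
    have e1 : s₂ k = x.val D v := (h₆ k (by omega)).trans h₂
    rw [Function.update_self, h₅, e1]
    refine Nat.mod_eq_of_lt (BinOp.eval_lt_two_pow hw (e1 ▸ hs₂ _) (h₅ ▸ hs₂ _) o hfo)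

/-! ### Reasoning about programs

Only the registers below `100` are visible in assertions. -/

/-- If the program `P` is started with the visible register contents `v`, then it halts in such a
way that the visible register contents satisfy `Q`, and its running time is at most its cost. -/
def Run (w t N : ℕ) (T : List (Fin σ)) (D : List ℕ) (P : Prog) (v : ℕ → ℕ)
    (Q : (ℕ → ℕ) → Prop) : Prop :=
  ∀ s : ℕ → ℕ, (∀ r, s r < 2 ^ w) → (∀ r < 100, s r = v r) →
    ∃ s' c v', Exec w t T D P s s' c ∧ c ≤ P.cost t N ∧ (∀ r < 100, s' r = v' r) ∧ Q v'

namespace Run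

variable {P P' : Prog} {v : ℕ → ℕ} {Q Q' : (ℕ → ℕ) → Prop}

theorem mono (h : Run w t N T D P v Q) (hQ : ∀ v', Q v' → Q' v') : Run w t N T D P v Q' := by
  intro s hs hsv
  obtain ⟨s', c, v', h1, h2, h3, h4⟩ := h s hs hsv
  exact ⟨s', c, v', h1, h2, h3, hQ v' h4⟩

/-- Postconditions need to mention only what a subprogram computes; that other registers survive is
settled by evaluating `Prog.writes`. -/
theorem frame (h : Run w t N T D P v Q) :
    Run w t N T D P v fun v' => Q v' ∧ ∀ r < 100, P.writes r = false → v' r = v r := by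
  intro s hs hsv
  obtain ⟨s', c, v', h1, h2, h3, h4⟩ := h s hs hsv
  exact ⟨s', c, v', h1, h2, h3, h4, fun r hr hw => by
    rw [← h3 r hr, h1.eq_of_not_writes hw, hsv r hr]⟩

theorem skip (h : Q v) : Run w t N T D .skip v Q := fun s _ hsv =>
  ⟨s, 1, v, Exec.skip s, le_rfl, hsv, h⟩

theorem seq (h : Run w t N T D P v fun v' => Run w t N T D P' v' Q) :
    Run w t N T D (.seq P P') v Q := by
  intro s hs hsv
  obtain ⟨s₁, c₁, v₁, h1, h2, h3, h4⟩ := h s hs hsv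
  obtain ⟨s₂, c₂, v₂, h5, h6, h7, h8⟩ := h4 s₁ (h1.lt_two_pow hs) h3
  exact ⟨s₂, _, v₂, Exec.seq h1 h5, Nat.add_le_add h2 h6, h7, h8⟩

theorem ite {a : ℕ} (ha : a < 100) (h : v a ≠ 0 → Run w t N T D P v Q)
    (h' : v a = 0 → Run w t N T D P' v Q) : Run w t N T D (.ite a P P') v Q := by
  intro s hs hsv
  by_cases h0 : v a = 0
  · obtain ⟨s', c, v', h1, h2, h3, h4⟩ := h' h0 s hs hsv
    exact ⟨s', _, v', Exec.ite_false (by rw [hsv a ha, h0]) h1, by simp only [Prog.cost]; omega,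
      h3, h4⟩
  · obtain ⟨s', c, v', h1, h2, h3, h4⟩ := h h0 s hs hsv
    exact ⟨s', _, v', Exec.ite_true (by rwa [hsv a ha]) h1, by simp only [Prog.cost]; omega,
      h3, h4⟩

/-- The variant `m` bounds the number of rounds. -/
theorem loop {a : ℕ} (ha : a < 100) (I : ℕ → (ℕ → ℕ) → Prop)
    (h : ∀ m v, I m v → v a ≠ 0 → ∃ m', m = m' + 1 ∧ Run w t N T D P v (I m')) {m : ℕ}
    (hm : m ≤ N) (hI : I m v) :
    Run w t N T D (.while a P) v fun v' => v' a = 0 ∧ ∃ m', I m' v' := by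
  have key : ∀ m v, I m v → ∀ s : ℕ → ℕ, (∀ r, s r < 2 ^ w) → (∀ r < 100, s r = v r) →
      ∃ s' c v', Exec w t T D (.while a P) s s' c ∧ c ≤ m * (P.cost t N + 1) + 1 ∧
        (∀ r < 100, s' r = v' r) ∧ v' a = 0 ∧ ∃ m', I m' v' := by
    intro m
    induction m with
    | zero =>
      intro v hI s hs hsv
      by_cases h0 : v a = 0
      · exact ⟨s, 1, v, Exec.while_false (by rw [hsv a ha, h0]), by omega, hsv, h0, _, hI⟩
      · obtain ⟨m', hm', -⟩ := h 0 v hI h0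
        omega
    | succ m ih =>
      intro v hI s hs hsv
      by_cases h0 : v a = 0
      · exact ⟨s, 1, v, Exec.while_false (by rw [hsv a ha, h0]), by omega, hsv, h0, _, hI⟩
      · obtain ⟨m', hm', hR⟩ := h _ v hI h0
        obtain rfl : m = m' := by omega
        obtain ⟨s₁, c₁, v₁, h1, h2, h3, h4⟩ := hR s hs hsv
        obtain ⟨s₂, c₂, v₂, h5, h6, h7, h8⟩ := ih v₁ h4 s₁ (h1.lt_two_pow hs) h3
        refine ⟨s₂, _, v₂, Exec.while_true (by rwa [hsv a ha]) h1 h5, ?_, h7, h8⟩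
        rw [add_mul, one_mul]
        omega
  intro s hs hsv
  obtain ⟨s', c, v', h1, h2, h3⟩ := key m v hI s hs hsv
  exact ⟨s', c, v', h1, h2.trans (Nat.add_le_add_right (Nat.mul_le_mul_right _ hm) 1), h3⟩

end Run

/-- Assign the value of an expression to a register. -/
def assign (d : ℕ) (e : Expr) : Prog := .seq (e.code 100) (.op .or d 100 100)

theorem Run.assign (hw : 1 ≤ w) (hD : ∀ x ∈ D, x < 2 ^ w) {d : ℕ} {e : Expr} {v : ℕ → ℕ}
    {Q : (ℕ → ℕ) → Prop} (he : e.named = true) (hf : e.Fits w D v)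
    (h : Q (Function.update v d (e.val D v))) : Run w t N T D (assign d e) v Q := by
  intro s hs hsv
  obtain ⟨s', h1, h2, h3⟩ := e.exec_code (t := t) (N := N) (T := T) hw hD hf he le_rfl hs hsv
  have hlt := h1.lt_two_pow hs 100
  refine ⟨_, _, _, Exec.seq h1 (Exec.op _ _ _ _ _), le_rfl, fun r hr => ?_, h⟩
  rcases eq_or_ne r d with rfl | hrd
  · rw [Function.update_self, Function.update_self, ← h2]
    simp [BinOp.eval, Nat.mod_eq_of_lt hlt]
  · rw [Function.update_of_ne hrd, Function.update_of_ne hrd, h3 r hr, hsv r hr]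

theorem Run.ask {q : CSTQuery} {d₁ d₂ : ℕ} {v : ℕ → ℕ} {x : ℕ × ℕ} {Q : (ℕ → ℕ) → Prop}
    (hq : ∀ s : ℕ → ℕ, (∀ r < 100, s r = v r) → q.eval s = q.eval v)
    (hx : Answers T (q.eval v) x) (h₁ : x.1 < 2 ^ w) (h₂ : x.2 < 2 ^ w)
    (h : Q (Function.update (Function.update v d₂ x.2) d₁ x.1)) :
    Run w t N T D (.ask q d₁ d₂) v Q := by
  intro s hs hsv
  refine ⟨_, _, _, Exec.ask q d₁ d₂ s x (hq s hsv ▸ hx), le_rfl, fun r hr => ?_, h⟩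
  rw [Nat.mod_eq_of_lt h₁, Nat.mod_eq_of_lt h₂]
  rcases eq_or_ne r d₁ with rfl | hr1
  · simp
  rw [Function.update_of_ne hr1, Function.update_of_ne hr1]
  rcases eq_or_ne r d₂ with rfl | hr2
  · simp
  rw [Function.update_of_ne hr2, Function.update_of_ne hr2, hsv r hr]

/-! ### Binary search -/

/-- Binary search in the range `[lo..hi]` given by the registers `40` and `41`.  The program `body`
decides whether the candidate in register `42` is large enough and puts the answer into register
`43`.  The result is put into register `40`. -/
def binarySearch (body : Prog) : Prog :=
  .seq (assign 43 (.bin .lt (.var 40) (.var 41)))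
    (.while 43
      (.seq (assign 42 (.bin .div (.bin .add (.var 40) (.var 41)) (.num 2)))
      (.seq body
      (.seq (.ite 43 (assign 41 (.var 42)) (assign 40 (.bin .add (.var 42) (.num 1))))
      (assign 43 (.bin .lt (.var 40) (.var 41)))))))

theorem Run.binarySearch (hw : 2 ≤ w) (hD : ∀ x ∈ D, x < 2 ^ w) {body : Prog} {v : ℕ → ℕ}
    {x : ℕ} (hb : ∀ r < 43, body.writes r = false)
    (h : ∀ v', (∀ r < 40, v' r = v r) → v 40 ≤ v' 42 → v' 42 < v 41 →
      Run w t N T D body v' fun v'' => v'' 43 ≠ 0 ↔ x ≤ v' 42)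
    (hx₁ : v 40 ≤ x) (hx₂ : x ≤ v 41) (hlt : 2 * v 41 < 2 ^ w) (hN : v 41 - v 40 < 2 ^ N) :
    Run w t N T D (binarySearch body) v fun v' => v' 40 = x ∧ ∀ r < 40, v' r = v r := by
  have h2w : 2 < 2 ^ w := lt_of_lt_of_le (by norm_num) (Nat.pow_le_pow_right two_pos hw)
  refine Run.seq (Run.assign (by omega) hD rfl (by simp [Expr.Fits]) ?_)
  -- The variant `m` bounds the range by `2 ^ m`; each round halves the range and so lowers `m` by
  -- one.
  refine Run.mono (Run.loop (by norm_num) (fun m v' => v' 41 - v' 40 < 2 ^ m ∧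
    (∀ r < 40, v' r = v r) ∧ v 40 ≤ v' 40 ∧ v' 41 ≤ v 41 ∧ v' 40 ≤ x ∧ x ≤ v' 41 ∧
      (v' 43 = if v' 40 < v' 41 then 1 else 0)) ?_ le_rfl ?_) ?_
  · rintro m v₁ ⟨h1, h2, h3, h4, h5, h6, h7⟩ h8
    have hlo : v₁ 40 < v₁ 41 := by
      by_contra hc
      simp [hc] at h7
      exact h8 h7
    obtain ⟨m', rfl⟩ : ∃ m', m = m' + 1 := by
      rcases m with _ | m'
      · simp at h1; omega
      · exact ⟨m', rfl⟩
    refine ⟨m', rfl, ?_⟩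
    rw [pow_succ] at h1
    refine Run.seq (Run.assign (by omega) hD rfl ?_ ?_)
    · simp only [Expr.Fits, Expr.val]
      exact ⟨⟨trivial, trivial, by omega⟩, h2w⟩
    simp only [Expr.val, BinOp.eval]
    set v₂ := Function.update v₁ 42 ((v₁ 40 + v₁ 41) / 2) with hv₂
    have hv₂' : ∀ r, r ≠ 42 → v₂ r = v₁ r := fun r hr => Function.update_of_ne hr _ _
    have hmid : v₂ 42 = (v₁ 40 + v₁ 41) / 2 := Function.update_self _ _ _
    refine Run.seq (Run.mono (Run.frame (h v₂ (fun r hr => ?_) (by omega) (by omega))) ?_)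
    · rw [hv₂' r (by omega), h2 r hr]
    rintro v₃ ⟨h9, h10⟩
    have h11 : ∀ r < 43, v₃ r = v₂ r := fun r hr => h10 r (by omega) (hb r hr)
    have e40 : v₃ 40 = v₁ 40 := by rw [h11 40 (by norm_num), hv₂' 40 (by norm_num)]
    have e41 : v₃ 41 = v₁ 41 := by rw [h11 41 (by norm_num), hv₂' 41 (by norm_num)]
    have e42 : v₃ 42 = (v₁ 40 + v₁ 41) / 2 := by rw [h11 42 (by norm_num), hmid]
    have elt : ∀ r < 40, v₃ r = v r := fun r hr => by
      rw [h11 r (by omega), hv₂' r (by omega), h2 r hr]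
    rw [hmid] at h9
    refine Run.seq (Run.ite (by norm_num) (fun hc => ?_) fun hc => ?_)
    · refine Run.assign (by omega) hD rfl (by simp [Expr.Fits]) ?_
      refine Run.assign (by omega) hD rfl (by simp [Expr.Fits]) ?_
      have := h9.1 hc
      simp only [Expr.val, BinOp.eval]
      refine ⟨?_, fun r hr => ?_, ?_, ?_, ?_, ?_, ?_⟩
      · simp [e40, e42]; omega
      · rw [Function.update_of_ne (by omega), Function.update_of_ne (by omega), elt r hr]
      all_goals simp [e40, e42]
      all_goals omega
    · refine Run.assign (by omega) hD rfl ?_ ?_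
      · simp only [Expr.Fits, Expr.val]
        exact ⟨trivial, by omega, by omega⟩
      refine Run.assign (by omega) hD rfl (by simp [Expr.Fits]) ?_
      have : ¬ x ≤ (v₁ 40 + v₁ 41) / 2 := fun h' => h9.2 h' hc
      simp only [Expr.val, BinOp.eval]
      refine ⟨?_, fun r hr => ?_, ?_, ?_, ?_, ?_, ?_⟩
      · simp [e41, e42]; omega
      · rw [Function.update_of_ne (by omega), Function.update_of_ne (by omega), elt r hr]
      all_goals simp [e41, e42]
      all_goals omega
  · simp only [Expr.val, BinOp.eval]
    refine ⟨by simpa using hN, fun r hr => Function.update_of_ne (by omega) _ _, ?_, ?_, ?_, ?_, ?_⟩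
    · simp
    · simp
    · simpa using hx₁
    · simpa using hx₂
    · by_cases h0 : v 40 < v 41 <;> simp [h0]
  · rintro v' ⟨h1, m', h2, h3, h4, h5, h6, h7, h8⟩
    refine ⟨?_, h3⟩
    by_contra hne
    rw [if_pos (by omega)] at h8
    omega

end Calculus


/-! ### A static dictionary in memory -/

/-- The address of the directory entry of the bucket of the key `x`. -/
def bucketAddr (D : List ℕ) (x : ℕ) : ℕ :=
  8 + 3 * (D.getD 5 0 * x % D.getD 4 0 % D.getD 6 0)

/-- The address of the table entry of the key `x`. -/
def entryAddr (D : List ℕ) (x : ℕ) : ℕ :=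
  D.getD (bucketAddr D x + 2) 0 +
    3 * (D.getD (bucketAddr D x) 0 * x % D.getD 4 0 % D.getD (bucketAddr D x + 1) 0)

/-- The memory `D` contains a dictionary with the keys `S ⊆ [0..U)`; the two values stored with a
key `x` are `f₁ x` and `f₂ x`. -/
def IsDict (w : ℕ) (D : List ℕ) (S : Finset ℕ) (f₁ f₂ : ℕ → ℕ) (U : ℕ) : Prop :=
  ∀ x < U, (D.getD (entryAddr D x) 0 = x + 1 ↔ x ∈ S) ∧
    (x ∈ S → D.getD (entryAddr D x + 1) 0 = f₁ x ∧ D.getD (entryAddr D x + 2) 0 = f₂ x) ∧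
    D.getD 5 0 * x < 2 ^ w ∧ D.getD (bucketAddr D x) 0 * x < 2 ^ w ∧
    bucketAddr D x + 2 < 2 ^ w ∧ entryAddr D x + 2 < 2 ^ w

theorem getD_map_range (f : ℕ → ℕ) {i n : ℕ} (h : i < n) :
    ((List.range n).map f).getD i 0 = f i := by
  simp [List.getD, h]

/-- For every set of keys there is a memory with a dictionary, with four free words in front. -/
theorem exists_isDict {w U : ℕ} (S : Finset ℕ) (hS : ∀ x ∈ S, x < U) (f₁ f₂ h : ℕ → ℕ)
    (hU₀ : 1 ≤ U) (hU : 4 * U * U ≤ 2 ^ w) (hf₁ : ∀ x ∈ S, f₁ x < 2 ^ w)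
    (hf₂ : ∀ x ∈ S, f₂ x < 2 ^ w) (hh : ∀ i < 4, h i < 2 ^ w)
    (hw : 26 * (S.card + 1) < 2 ^ w) :
    ∃ D : List ℕ, D.length = 8 + 18 * (S.card + 1) ∧ (∀ x ∈ D, x < 2 ^ w) ∧
      (∀ i < 4, D.getD i 0 = h i) ∧ IsDict w D S f₁ f₂ U := by
  classical
  obtain ⟨p, hp, hUp, hpU⟩ := Nat.exists_prime_lt_and_le_two_mul U (by omega)
  obtain ⟨a, A, R, O, ha, hA, hR, hO, hinj⟩ :=
    exists_perfect_hash hp S fun x hx => (hS x hx).trans hUp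
  set m := S.card + 1 with hm
  have hm0 : 0 < m := by omega
  -- The key is stored plus one, so that `0` marks an empty slot.
  let table : ℕ → ℕ → ℕ := fun q i =>
    if hx : ∃ x ∈ S, hashSlot p a m A R O x = q then
      if i = 0 then hx.choose + 1 else if i = 1 then f₁ hx.choose else f₂ hx.choose
    else 0
  -- Layout: four free words, then the modulus, the outer multiplier, the number of buckets and one
  -- padding word; then `m` directory entries (multiplier, size, address) and `5 * m` table entries,
  -- of three words each.
  let mem : ℕ → ℕ := fun i =>
    if i < 4 then h i else if i = 4 then p else if i = 5 then a else if i = 6 then m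
    else if i < 8 then 0
    else if i < 8 + 3 * m then
      if (i - 8) % 3 = 0 then A ((i - 8) / 3) else if (i - 8) % 3 = 1 then R ((i - 8) / 3)
      else 8 + 3 * m + 3 * O ((i - 8) / 3)
    else table ((i - (8 + 3 * m)) / 3) ((i - (8 + 3 * m)) % 3)
  have htable : ∀ x ∈ S, ∀ i, table (hashSlot p a m A R O x) i =
      if i = 0 then x + 1 else if i = 1 then f₁ x else f₂ x := by
    intro x hx i
    have hex : ∃ y ∈ S, hashSlot p a m A R O y = hashSlot p a m A R O x := ⟨x, hx, rfl⟩
    have hy : hex.choose = x := hinj hex.choose_spec.1 hx hex.choose_spec.2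
    simp only [table, dif_pos hex, hy]
  have hUU : 4 * U ≤ 2 ^ w := le_trans (Nat.le_mul_of_pos_right _ hU₀) hU
  have hpw : 2 * p ≤ 2 ^ w := by omega
  have hmul : ∀ y < p, ∀ x < U, y * x < 2 ^ w := by
    intro y hy x hx
    have h1 : y * x ≤ 2 * U * U := Nat.mul_le_mul (by omega) hx.le
    have h2 : 0 < U * U := Nat.mul_pos hU₀ hU₀
    have h3 : 4 * U * U = 2 * (2 * U * U) := by ring
    have h4 : 2 * U * U = 2 * (U * U) := by ring
    omega
  have htable_lt : ∀ q i, table q i < 2 ^ w := by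
    intro q i
    simp only [table]
    split_ifs with hx h1 h2
    · have := hS _ hx.choose_spec.1
      omega
    · exact hf₁ _ hx.choose_spec.1
    · exact hf₂ _ hx.choose_spec.1
    · positivity
  have hmem_lt : ∀ i, mem i < 2 ^ w := by
    intro i
    simp only [mem]
    split_ifs with h1 h2 h3 h4 h5 h6 h7 h8
    · exact hh i h1
    · have := hp.pos; omega
    · omega
    · omega
    · positivity
    · have := hA ((i - 8) / 3); omega
    · have := hO ((i - 8) / 3) (by omega); omega
    · have := hO ((i - 8) / 3) (by omega); omega
    · exact htable_lt _ _
  refine ⟨(List.range (8 + 18 * m)).map mem, by simp, ?_, ?_, ?_⟩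
  · intro x hx
    obtain ⟨i, -, rfl⟩ := List.mem_map.1 hx
    exact hmem_lt i
  · intro i hi
    rw [getD_map_range _ (by omega)]
    simp [mem, hi]
  · intro x hx
    set D := (List.range (8 + 18 * m)).map mem with hD
    have hget : ∀ i, i < 8 + 18 * m → D.getD i 0 = mem i := fun i hi => getD_map_range _ hi
    have h4 : D.getD 4 0 = p := by rw [hget 4 (by omega)]; simp [mem]
    have h5 : D.getD 5 0 = a := by rw [hget 5 (by omega)]; simp [mem]
    have h6 : D.getD 6 0 = m := by rw [hget 6 (by omega)]; simp [mem]
    have hb : bucketAddr D x = 8 + 3 * (a * x % p % m) := by rw [bucketAddr, h4, h5, h6]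
    have hu : a * x % p % m < m := Nat.mod_lt _ hm0
    have hOR := hO _ hu
    generalize hu' : a * x % p % m = u at *
    have hb0 : D.getD (bucketAddr D x) 0 = A u := by
      rw [hb, hget _ (by omega)]
      simp only [mem]
      rw [if_neg (by omega), if_neg (by omega), if_neg (by omega), if_neg (by omega),
        if_neg (by omega), if_pos (by omega), if_pos (by omega)]
      congr 1; omega
    have hb1 : D.getD (bucketAddr D x + 1) 0 = R u := by
      rw [hb, hget _ (by omega)]
      simp only [mem]
      rw [if_neg (by omega), if_neg (by omega), if_neg (by omega), if_neg (by omega),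
        if_neg (by omega), if_pos (by omega), if_neg (by omega), if_pos (by omega)]
      congr 1; omega
    have hb2 : D.getD (bucketAddr D x + 2) 0 = 8 + 3 * m + 3 * O u := by
      rw [hb, hget _ (by omega)]
      simp only [mem]
      rw [if_neg (by omega), if_neg (by omega), if_neg (by omega), if_neg (by omega),
        if_neg (by omega), if_pos (by omega), if_neg (by omega), if_neg (by omega)]
      congr 3; omega
    have he : entryAddr D x = 8 + 3 * m + 3 * hashSlot p a m A R O x := by
      rw [entryAddr, hb0, hb1, hb2, h4, hashSlot, hu']
      ring
    have hslot : hashSlot p a m A R O x < 5 * m := by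
      have := Nat.mod_lt (A u * x % p) (hR u)
      rw [hashSlot, hu']
      omega
    have hent : ∀ i < 3, D.getD (entryAddr D x + i) 0 = table (hashSlot p a m A R O x) i := by
      intro i hi
      rw [he, hget _ (by omega)]
      simp only [mem]
      rw [if_neg (by omega), if_neg (by omega), if_neg (by omega), if_neg (by omega),
        if_neg (by omega), if_neg (by omega)]
      congr 1 <;> omega
    have hent0 := hent 0 (by omega)
    rw [Nat.add_zero] at hent0
    refine ⟨⟨fun hx0 => ?_, fun hxS => ?_⟩, fun hxS => ⟨?_, ?_⟩, ?_, ?_, ?_, ?_⟩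
    · rw [hent0] at hx0
      simp only [table] at hx0
      split_ifs at hx0 with hex
      have := hex.choose_spec.1
      rwa [Nat.succ.inj hx0] at this
    · rw [hent0, htable x hxS]; rfl
    · rw [hent 1 (by omega), htable x hxS]; rfl
    · rw [hent 2 (by omega), htable x hxS]; rfl
    · rw [h5]; exact hmul a ha x hx
    · rw [hb0]; exact hmul _ (hA u) x hx
    · omega
    · omega

/-! ### The dictionary of key prefixes -/

/-- Combine four numbers into one. -/
def packKey (B k t l y : ℕ) : ℕ := ((k * B + t) * B + l) * B + y

theorem packKey_inj {B k t l y k' t' l' y' : ℕ} (ht : t < B) (hl : l < B) (hy : y < B)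
    (ht' : t' < B) (hl' : l' < B) (hy' : y' < B)
    (h : packKey B k t l y = packKey B k' t' l' y') : k = k' ∧ t = t' ∧ l = l' ∧ y = y' := by
  have step : ∀ u v c d : ℕ, c < B → d < B → u * B + c = v * B + d → u = v ∧ c = d := by
    intro u v c d hc hd he
    have h1 : (u * B + c) / B = u := Nat.div_eq_of_lt_le (by omega) (by rw [add_mul]; omega)
    have h2 : (v * B + d) / B = v := Nat.div_eq_of_lt_le (by omega) (by rw [add_mul]; omega)
    obtain rfl : u = v := by rw [← h1, ← h2, he]
    exact ⟨rfl, by omega⟩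
  obtain ⟨h1, h2⟩ := step _ _ _ _ hy hy' h
  obtain ⟨h3, h4⟩ := step _ _ _ _ hl hl' h1
  obtain ⟨h5, h6⟩ := step _ _ _ _ ht ht' h3
  exact ⟨h5, h6, h4, h2⟩

theorem packKey_lt {B k t l y : ℕ} (hk : k < B) (ht : t < B) (hl : l < B) (hy : y < B) :
    packKey B k t l y < B ^ 4 := by
  have step : ∀ u c M : ℕ, u < M → c < B → u * B + c < M * B := by
    intro u c M hu hc
    calc u * B + c < (u + 1) * B := by rw [add_mul]; omega
      _ ≤ M * B := Nat.mul_le_mul_right _ hu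
  have := step _ _ _ (step _ _ _ (step _ _ _ hk ht) hl) hy
  calc packKey B k t l y < B * B * B * B := this
    _ = B ^ 4 := by ring

section Prefixes

variable (F : ℕ → ℕ → ℕ) (s N : ℕ)

/-- The keys `F k j` of the samples `j < N` in their blocks of size `2 ^ k` have at most `2 * s + 1`
bits.  The dictionary contains their prefixes. -/
def prefixKeys : Finset ℕ :=
  (Finset.range (s + 1) ×ˢ Finset.range N ×ˢ Finset.range (2 * s + 2)).image fun z =>
    packKey (2 ^ (4 * s)) z.1 (z.2.1 / 2 ^ z.1) z.2.2 (F z.1 z.2.1 / 2 ^ z.2.2)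

/-- The samples whose keys have the prefix that is encoded by `x`. -/
def samplesWithPrefix (x : ℕ) : Set ℕ :=
  {j | j < N ∧ ∃ k ≤ s, ∃ l ≤ 2 * s + 1,
    packKey (2 ^ (4 * s)) k (j / 2 ^ k) l (F k j / 2 ^ l) = x}

variable {F s N}

theorem card_prefixKeys_le : (prefixKeys F s N).card ≤ (s + 1) * (N * (2 * s + 2)) := by
  refine Finset.card_image_le.trans ?_
  simp

theorem mem_prefixKeys_iff {x : ℕ} :
    x ∈ prefixKeys F s N ↔ (samplesWithPrefix F s N x).Nonempty := by
  simp only [prefixKeys, Finset.mem_image, Finset.mem_product, Finset.mem_range, Prod.exists,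
    samplesWithPrefix]
  constructor
  · rintro ⟨k, j, l, ⟨h1, h2, h3⟩, h4⟩
    exact ⟨j, h2, k, by omega, l, by omega, h4⟩
  · rintro ⟨j, h2, k, h1, l, h3, h4⟩
    exact ⟨k, j, l, ⟨by omega, h2, by omega⟩, h4⟩

theorem two_mul_add_two_le (hs : 1 ≤ s) :
    2 * s + 2 ≤ 2 ^ (2 * s) ∧ 2 ^ (2 * s + 1) ≤ 2 ^ (4 * s) := by
  constructor
  · have := Nat.lt_two_pow_self (n := s)
    rw [two_mul s, pow_add]
    nlinarith
  · exact Nat.pow_le_pow_right two_pos (by omega)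

theorem field_bounds (hs : 1 ≤ s) : 2 * s + 1 < 2 ^ (4 * s) ∧ 2 ^ (2 * s + 1) ≤ 2 ^ (4 * s) := by
  have h1 := two_mul_add_two_le hs
  have : 2 ^ (2 * s) ≤ 2 ^ (4 * s) := Nat.pow_le_pow_right two_pos (by omega)
  exact ⟨by omega, h1.2⟩

theorem prefixKeys_lt (hs : 1 ≤ s) (hN : N < 2 ^ s) (hF : ∀ k j, F k j < 2 ^ (2 * s + 1)) :
    ∀ x ∈ prefixKeys F s N, x < 2 ^ (16 * s) := by
  intro x hx
  obtain ⟨j, hj, k, hk, l, hl, rfl⟩ := mem_prefixKeys_iff.1 hx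
  have hb := field_bounds hs
  have h1 : 2 ^ s ≤ 2 ^ (4 * s) := Nat.pow_le_pow_right two_pos (by omega)
  refine (packKey_lt (by omega) (lt_of_le_of_lt (Nat.div_le_self _ _) (by omega)) (by omega)
    (lt_of_le_of_lt (Nat.div_le_self _ _) ((hF k j).trans_le hb.2))).trans_eq ?_
  rw [← pow_mul]
  congr 1
  ring

/-- The four fields can be decoded from the packed key, so its class consists of the samples of one
block whose keys share one prefix, as required by `lt_iff_of_least_shift`. -/
theorem samplesWithPrefix_packKey (hs : 1 ≤ s) (hN : N < 2 ^ s)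
    (hF : ∀ k j, F k j < 2 ^ (2 * s + 1)) {k t l y : ℕ} (hk : k ≤ s) (ht : t < 2 ^ s)
    (hl : l ≤ 2 * s + 1) (hy : y < 2 ^ (2 * s + 1)) :
    samplesWithPrefix F s N (packKey (2 ^ (4 * s)) k t l y) =
      {j | j ∈ {j | j < N ∧ j / 2 ^ k = t} ∧ F k j / 2 ^ l = y} := by
  have hb := field_bounds hs
  have h1 : 2 ^ s ≤ 2 ^ (4 * s) := Nat.pow_le_pow_right two_pos (by omega)
  ext j
  constructor
  · rintro ⟨hj, k', hk', l', hl', h⟩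
    obtain ⟨rfl, rfl, rfl, rfl⟩ := packKey_inj (lt_of_le_of_lt (Nat.div_le_self _ _) (by omega))
      (by omega) (lt_of_le_of_lt (Nat.div_le_self _ _) ((hF k' j).trans_le hb.2)) (by omega)
      (by omega) (by omega) h
    exact ⟨⟨hj, rfl⟩, rfl⟩
  · rintro ⟨⟨hj, rfl⟩, rfl⟩
    exact ⟨hj, k, hk, l, hl, rfl⟩

theorem isLeast_samplesWithPrefix {x : ℕ} (h : (samplesWithPrefix F s N x).Nonempty) :
    IsLeast (samplesWithPrefix F s N x) (sInf (samplesWithPrefix F s N x)) :=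
  ⟨Nat.sInf_mem h, fun _ hj => Nat.sInf_le hj⟩

theorem isGreatest_samplesWithPrefix {x : ℕ} (h : (samplesWithPrefix F s N x).Nonempty) :
    IsGreatest (samplesWithPrefix F s N x) (sSup (samplesWithPrefix F s N x)) := by
  have hbdd : BddAbove (samplesWithPrefix F s N x) := ⟨N, fun j hj => hj.1.le⟩
  exact ⟨Nat.sSup_mem h hbdd, fun j hj => le_csSup hbdd hj⟩

end Prefixes

/-! ### The stored data structure -/

/-- The distance of the samples. -/
def sampleDist (n : ℕ) : ℕ := Nat.size n ^ 3

/-- The memory `D` contains the data structure for the text `T`. -/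
structure IsMergeData {σ : ℕ} (w : ℕ) (T : List (Fin σ)) (D : List ℕ) : Prop where
  pos : 0 < T.length
  width : w = 64 * Nat.size T.length
  lt_two_pow : ∀ x ∈ D, x < 2 ^ w
  getD_zero : D.getD 0 0 = sampleDist T.length
  getD_one : D.getD 1 0 = Nat.size T.length
  getD_two : D.getD 2 0 = 2 ^ Nat.size T.length
  getD_three : D.getD 3 0 = 2 ^ (4 * Nat.size T.length)
  isDict : IsDict w D
    (prefixKeys (sampleKey T (sampleDist T.length)) (Nat.size T.length)
      (T.length / sampleDist T.length))
    (fun x => sInf (samplesWithPrefix (sampleKey T (sampleDist T.length)) (Nat.size T.length)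
      (T.length / sampleDist T.length) x))
    (fun x => sSup (samplesWithPrefix (sampleKey T (sampleDist T.length)) (Nat.size T.length)
      (T.length / sampleDist T.length) x))
    (2 ^ (16 * Nat.size T.length))

theorem pow_three_le (s : ℕ) : s ^ 3 ≤ 27 * 2 ^ s := by
  induction s with
  | zero => norm_num
  | succ s ih =>
    rcases lt_or_ge s 4 with h | h
    · interval_cases s <;> norm_num
    · rw [pow_succ 2 s]
      nlinarith [mul_le_mul h h (by omega) (by omega)]

theorem two_pow_size_le {n : ℕ} (hn : 0 < n) : 2 ^ Nat.size n ≤ 2 * n := by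
  have hs := Nat.size_pos.2 hn
  have h := Nat.lt_size.1 (Nat.sub_lt hs one_pos)
  calc 2 ^ Nat.size n = 2 ^ (Nat.size n - 1 + 1) := by congr 1; omega
    _ ≤ 2 * n := by rw [pow_succ]; omega

theorem sampleDist_le {n : ℕ} (hn : 0 < n) : sampleDist n ≤ 54 * n := by
  have h1 := pow_three_le (Nat.size n)
  have h2 := two_pow_size_le hn
  unfold sampleDist
  omega

/-- The sampling distance `s ^ 3` pays for the `O(s)` blocks per sample, the `O(s)` prefixes per key
and the `O(s)` bits per word. The constant `200000` is generous. -/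
theorem exists_isMergeData {σ : ℕ} (T : List (Fin σ)) (hT : 0 < T.length) :
    ∃ D : List ℕ, IsMergeData (64 * Nat.size T.length) T D ∧
      D.length * (64 * Nat.size T.length) ≤ 200000 * T.length := by
  set n := T.length with hn
  set s := Nat.size n with hs
  have hs1 : 1 ≤ s := Nat.size_pos.2 hT
  have hns : n < 2 ^ s := Nat.lt_size_self n
  have hL0 : 0 < sampleDist n := pow_pos hs1 3
  set N := n / sampleDist n with hN
  have hNn : N ≤ n := Nat.div_le_self _ _
  set F := sampleKey T (sampleDist n) with hF
  have hF' : ∀ k j, F k j < 2 ^ (2 * s + 1) := sampleKey_lt T _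
  have hcard : (prefixKeys F s N).card ≤ 8 * s ^ 2 * N := by
    refine card_prefixKeys_le.trans ?_
    calc (s + 1) * (N * (2 * s + 2)) = 2 * (s + 1) ^ 2 * N := by ring
      _ ≤ 8 * s ^ 2 * N := Nat.mul_le_mul_right _ (by nlinarith)
  have hbits : (prefixKeys F s N).card * s ≤ 8 * n := by
    calc (prefixKeys F s N).card * s ≤ 8 * s ^ 2 * N * s := Nat.mul_le_mul_right _ hcard
      _ = 8 * (sampleDist n * N) := by simp only [sampleDist, ← hs]; ring
      _ ≤ 8 * n := Nat.mul_le_mul_left _ (Nat.mul_div_le _ _)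
  have hcard' : (prefixKeys F s N).card ≤ 8 * n := le_trans (Nat.le_mul_of_pos_right _ hs1) hbits
  have hsn : s ≤ n := Nat.size_le.2 Nat.lt_two_pow_self
  have hpow : ∀ c d : ℕ, c ≤ d → 2 ^ (c * s) ≤ 2 ^ (d * s) := fun c d h =>
    Nat.pow_le_pow_right two_pos (Nat.mul_le_mul_right s h)
  have hn64 : 2000 * n < 2 ^ (64 * s) := by
    have h1 : 2 ^ (12 * s) = 2 ^ (11 * s) * 2 ^ s := by rw [← pow_add]; congr 1; ring
    have h2 : 2 ^ 11 ≤ 2 ^ (11 * s) := Nat.pow_le_pow_right two_pos (by omega)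
    have h3 := hpow 12 64 (by norm_num)
    nlinarith
  have hfirst : ∀ x ∈ prefixKeys F s N, sInf (samplesWithPrefix F s N x) < N := fun x hx =>
    (isLeast_samplesWithPrefix (mem_prefixKeys_iff.1 hx)).1.1
  have hlast : ∀ x ∈ prefixKeys F s N, sSup (samplesWithPrefix F s N x) < N := fun x hx =>
    (isGreatest_samplesWithPrefix (mem_prefixKeys_iff.1 hx)).1.1
  obtain ⟨D, hlen, hD, hhead, hdict⟩ := exists_isDict (w := 64 * s) (U := 2 ^ (16 * s))
    (prefixKeys F s N) (prefixKeys_lt hs1 (by omega) hF')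
    (fun x => sInf (samplesWithPrefix F s N x)) (fun x => sSup (samplesWithPrefix F s N x))
    (fun i => [sampleDist n, s, 2 ^ s, 2 ^ (4 * s)].getD i 0) Nat.one_le_two_pow
    -- Packed keys have `16 * s` bits; products in the hash functions need about twice as many,
    -- which fits into `64 * s`.
    (by
      calc 4 * 2 ^ (16 * s) * 2 ^ (16 * s) = 2 ^ (2 + 16 * s + 16 * s) := by
            rw [pow_add, pow_add]; norm_num
        _ ≤ 2 ^ (64 * s) := Nat.pow_le_pow_right two_pos (by omega))
    (fun x hx => by have := hfirst x hx; omega) (fun x hx => by have := hlast x hx; omega)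
    (by
      intro i hi
      have h1 := sampleDist_le hT
      have h2 : 2 ^ s < 2 ^ (64 * s) := Nat.pow_lt_pow_right (by norm_num) (by omega)
      have h3 : 2 ^ (4 * s) < 2 ^ (64 * s) := Nat.pow_lt_pow_right (by norm_num) (by omega)
      interval_cases i <;> simp <;> omega)
    (by omega)
  refine ⟨D, ⟨hT, rfl, hD, hhead 0 (by norm_num), hhead 1 (by norm_num), hhead 2 (by norm_num),
    hhead 3 (by norm_num), hdict⟩, ?_⟩
  rw [hlen]
  nlinarith


/-! ### The merge program

Registers: `0`-`6` input, `7` rank of the suffix of `β` that is searched for, `10` result of a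
search, `20` distance of the samples, `21`, `22` range of samples, `23` level of the block, `26`
count for the centre, `27` length of a common prefix, `28` key, `29` resulting sample, `40`-`43`
binary search, `50`-`52` dictionary lookup, `60`-`64` counting. -/

/-- Put `suffixCount` of the position in register `60` into register `61`. -/
def countProg : Prog :=
  .seq (assign 62 (.bin .lt (.var 60) (.var 6)))
    (.ite 62 (.seq (.ask (.isa 60) 61 63) (assign 61 (.bin .add (.var 61) (.num 1))))
      (assign 61 (.num 0)))

/-- Like `countProg`, for the position that results from the suffix array entry with the index in
register `64` by skipping the first pattern. -/
def countSAProg : Prog :=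
  .seq (.ask (.sa 64) 60 63)
    (.seq (assign 60 (.bin .add (.var 60) (.var 2))) countProg)

/-- Find the level of the smallest block that contains the samples in question. -/
def levelProg : Prog :=
  .seq (assign 40 (.num 0))
    (.seq (assign 41 (.load (.num 1)))
    (.seq (binarySearch (assign 43 (.bin .eq (.bin .shr (.var 21) (.var 42))
      (.bin .shr (.bin .sub (.var 22) (.num 1)) (.var 42)))))
    (assign 23 (.var 40))))

/-- Compare the searched string with the centre of the block. -/
def centreProg : Prog :=
  .seq (assign 24 (.bin .shl (.bin .shr (.bin .sub (.var 22) (.num 1))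
      (.bin .sub (.var 23) (.num 1))) (.bin .sub (.var 23) (.num 1))))
    (.seq (assign 64 (.bin .sub (.bin .add (.bin .mul (.var 20) (.var 24)) (.var 20)) (.num 1)))
    (.seq countSAProg
    (.seq (assign 26 (.var 61))
    (.ite 26
      (.seq (assign 32 (.bin .sub (.var 26) (.num 1)))
      (.seq (.ask (.lca (7, 7) (32, 32)) 33 34) (.ask (.pathlabel (33, 34)) 35 27)))
      (assign 27 (.num 0))))))

/-- Compute the key of the searched string. -/
def keyProg : Prog :=
  .seq (.ask (.sa 7) 60 63)
    (.seq (assign 60 (.bin .add (.var 60) (.var 27)))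
    (.seq countProg
    (.seq (assign 28 (.bin .add (.var 2) (.var 27)))
    (.seq (assign 36 (.bin .lt (.var 7) (.var 26)))
    (.seq (.ite 36 .skip (assign 28 (.bin .sub (.bin .add (.bin .mul (.num 2) (.var 6)) (.num 1))
      (.var 28))))
    (assign 28 (.bin .add (.bin .mul (.var 28) (.load (.num 2))) (.var 61))))))))

/-- Look up the prefix of the key without the lowest bits, whose number is in register `42`. -/
def lookupProg : Prog :=
  .seq (assign 50 (.bin .add (.bin .mul (.bin .add (.bin .mul (.bin .add (.bin .mul (.var 23)
      (.load (.num 3))) (.bin .shr (.var 21) (.var 23))) (.load (.num 3))) (.var 42))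
      (.load (.num 3))) (.bin .shr (.var 28) (.var 42))))
    (.seq (assign 51 (.bin .add (.num 8) (.bin .mul (.num 3) (.bin .mod (.bin .mod (.bin .mul
      (.load (.num 5)) (.var 50)) (.load (.num 4))) (.load (.num 6))))))
    (.seq (assign 52 (.bin .add (.load (.bin .add (.var 51) (.num 2))) (.bin .mul (.num 3)
      (.bin .mod (.bin .mod (.bin .mul (.load (.var 51)) (.var 50)) (.load (.num 4)))
      (.load (.bin .add (.var 51) (.num 1)))))))
    (assign 43 (.bin .eq (.load (.var 52)) (.bin .add (.var 50) (.num 1))))))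

/-- Find the position of the key among the keys of the samples in the block. -/
def prefixProg : Prog :=
  .seq (assign 40 (.num 0))
    (.seq (assign 41 (.bin .add (.bin .mul (.num 2) (.load (.num 1))) (.num 1)))
    (.seq (binarySearch lookupProg)
    (.seq (assign 42 (.var 40))
    (.seq lookupProg
    (.seq (assign 37 (.bin .mul (.bin .lt (.num 0) (.var 42)) (.bin .mod (.bin .shr (.var 28)
      (.bin .sub (.var 42) (.num 1))) (.num 2))))
    (.ite 37 (assign 29 (.bin .add (.load (.bin .add (.var 52) (.num 2))) (.num 1)))
      (assign 29 (.load (.bin .add (.var 52) (.num 1))))))))))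

/-- Find the insertion point between two samples. -/
def windowProg : Prog :=
  .seq (assign 40 (.bin .add (.var 0) (.bin .sub (.bin .mul (.var 20) (.var 29)) (.var 0))))
    (.seq (assign 30 (.bin .add (.var 1) (.num 1)))
    (.seq (assign 41 (.bin .sub (.var 30) (.bin .sub (.var 30) (.bin .sub (.bin .add
      (.bin .mul (.var 20) (.var 29)) (.var 20)) (.num 1)))))
    (.seq (binarySearch (.seq (assign 64 (.var 42)) (.seq countSAProg
      (assign 43 (.bin .lt (.var 7) (.var 61))))))
    (assign 10 (.var 40)))))

/-- Find the insertion point of the string that consists of the first pattern and the suffix with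
the rank in register `7`. -/
def searchProg : Prog :=
  .seq (assign 20 (.load (.num 0)))
    (.seq (assign 21 (.bin .div (.var 0) (.var 20)))
    (.seq (assign 22 (.bin .div (.bin .add (.var 1) (.num 1)) (.var 20)))
    (.seq (assign 29 (.var 21))
    (.seq (assign 23 (.bin .lt (.var 21) (.var 22)))
    (.seq (.ite 23 (.seq levelProg (.seq centreProg (.seq keyProg prefixProg))) .skip)
    windowProg)))))

/-- Merge two suffix array intervals. -/
def mergeProg : Prog :=
  .ite 5
    (.seq (assign 7 (.var 3))
    (.seq searchProg
    (.seq (assign 8 (.var 10))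
    (.seq (assign 7 (.var 4))
    (.seq searchProg
    (.seq (assign 9 (.var 10))
    (.seq (assign 11 (.bin .lt (.var 10) (.bin .add (.var 1) (.num 1))))
    (.seq (.ite 11 (.seq (assign 64 (.var 10)) (.seq countSAProg
      (assign 9 (.bin .add (.var 10) (.bin .eq (.var 61) (.bin .add (.var 4) (.num 1))))))) .skip)
    (.seq (assign 0 (.bin .lt (.var 8) (.var 9)))
    (.seq (assign 1 (.var 8))
    (assign 2 (.bin .sub (.var 9) (.num 1)))))))))))))
    (.seq (assign 2 (.var 1)) (.seq (assign 1 (.var 0)) (assign 0 (.num 1))))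

/-! ### Correctness of the subprograms -/

namespace IsMergeData

variable {σ : ℕ} {w t N : ℕ} {T : List (Fin σ)} {D : List ℕ} {v : ℕ → ℕ}

theorem size_pos (h : IsMergeData w T D) : 1 ≤ Nat.size T.length := Nat.size_pos.2 h.pos

theorem le_width (h : IsMergeData w T D) : 64 ≤ w := by
  have := h.size_pos
  rw [h.width]
  omega

theorem two_pow_le (h : IsMergeData w T D) : 2 ^ 64 ≤ 2 ^ w :=
  Nat.pow_le_pow_right two_pos h.le_width

/-- Numbers of this size fit into a word. -/
theorem mul_length_lt (h : IsMergeData w T D) : 2 ^ 32 * (T.length + 1) < 2 ^ w := by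
  have h0 := h.size_pos
  have h1 := Nat.lt_size_self T.length
  have h2 : 2 ^ 33 * 2 ^ Nat.size T.length ≤ 2 ^ w := by
    rw [h.width, ← pow_add]
    exact Nat.pow_le_pow_right two_pos (by omega)
  have h3 : 2 ^ 32 * (T.length + 1) ≤ 2 ^ 32 * 2 ^ Nat.size T.length := Nat.mul_le_mul_left _ h1
  have h4 : 0 < 2 ^ Nat.size T.length := by positivity
  omega

theorem run_countProg (h : IsMergeData w T D) (h6 : v 6 = T.length) :
    Run w t N T D countProg v fun v' => v' 61 = suffixCount T (v 60) := by
  have hw := h.le_width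
  have hn := h.mul_length_lt
  refine Run.seq (Run.assign (by omega) h.lt_two_pow rfl (by simp [Expr.Fits]) ?_)
  refine Run.ite (by norm_num) (fun hc => ?_) fun hc => ?_
  · have hlt : v 60 < T.length := by simpa [Expr.val, BinOp.eval, h6] using hc
    have hcl := suffixCount_le T (v 60)
    have hcp := suffixCount_of_lt hlt
    refine Run.seq (Run.ask (x := (suffixCount T (v 60) - 1, 0)) ?_ ?_ (by simp; omega)
      (by simp) ?_)
    · intro s hs
      simp [CSTQuery.eval, hs 60]
    · refine ⟨by simpa using hlt, ?_⟩
      simp [hcp]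
    · refine Run.assign (by omega) h.lt_two_pow rfl ?_ ?_
      · simp [Expr.Fits, Expr.val, BinOp.eval]
        omega
      · simp [Expr.val, BinOp.eval]
        omega
  · have hlt : ¬ v 60 < T.length := by simpa [Expr.val, BinOp.eval, h6] using hc
    refine Run.assign (by omega) h.lt_two_pow rfl (by simp [Expr.Fits]) ?_
    simp [Expr.val, suffixCount, hlt]

theorem run_countSAProg (h : IsMergeData w T D) (h6 : v 6 = T.length) (h64 : v 64 < T.length)
    (h2 : v 2 ≤ T.length) : Run w t N T D countSAProg v fun v' =>
      v' 61 = suffixCount T (saEntry T (v 64) + v 2) := by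
  have hw := h.le_width
  have hn := h.mul_length_lt
  have hsa := saEntry_lt h64
  refine Run.seq (Run.ask (x := (saEntry T (v 64), 0)) ?_ ?_ (by simp; omega) (by simp) ?_)
  · intro s hs
    simp [CSTQuery.eval, hs 64]
  · exact ⟨h64, by simp [saEntry_of_lt h64]⟩
  refine Run.seq (Run.assign (by omega) h.lt_two_pow rfl ?_ ?_)
  · simp [Expr.Fits, Expr.val]
    omega
  refine Run.mono (h.run_countProg (by simpa using h6)) fun v' hv' => ?_
  rw [hv']
  simp [Expr.val, BinOp.eval]

/-- Lying in a common block is monotone in the level, so the least level can be found by binary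
search among `0..s`. -/
theorem run_levelProg (h : IsMergeData w T D) {a c : ℕ} (h21 : v 21 = a) (h22 : v 22 = c)
    (hac : a < c) (hc : c ≤ T.length) (hN : Nat.size T.length < 2 ^ N) :
    Run w t N T D levelProg v fun v' => v' 23 ≤ Nat.size T.length ∧
      a / 2 ^ v' 23 = (c - 1) / 2 ^ v' 23 ∧ ∀ i < v' 23, a / 2 ^ i ≠ (c - 1) / 2 ^ i := by
  classical
  have hw := h.le_width
  have hn := h.mul_length_lt
  have hns := Nat.lt_size_self T.length
  have hsn : Nat.size T.length ≤ T.length := Nat.size_le.2 Nat.lt_two_pow_self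
  have hex : ∃ k, a / 2 ^ k = (c - 1) / 2 ^ k := ⟨Nat.size T.length, by
    rw [Nat.div_eq_of_lt (by omega), Nat.div_eq_of_lt (by omega)]⟩
  have hk : Nat.find hex ≤ Nat.size T.length := Nat.find_min' hex (by
    rw [Nat.div_eq_of_lt (by omega), Nat.div_eq_of_lt (by omega)])
  have hmono : ∀ i j, i ≤ j → a / 2 ^ i = (c - 1) / 2 ^ i → a / 2 ^ j = (c - 1) / 2 ^ j := by
    intro i j hij he
    obtain ⟨d, rfl⟩ := Nat.exists_eq_add_of_le hij
    rw [pow_add, ← Nat.div_div_eq_div_mul, ← Nat.div_div_eq_div_mul, he]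
  refine Run.seq (Run.assign (by omega) h.lt_two_pow rfl (by simp [Expr.Fits]) ?_)
  refine Run.seq (Run.assign (by omega) h.lt_two_pow rfl (by simp [Expr.Fits]; omega) ?_)
  refine Run.seq (Run.mono (Run.binarySearch (x := Nat.find hex) (by omega) h.lt_two_pow
    (by decide) ?_ ?_ ?_ ?_ ?_) ?_)
  · intro v' hv' _ _
    refine Run.assign (by omega) h.lt_two_pow rfl (by simp [Expr.Fits]; omega) ?_
    have e21 : v' 21 = a := by rw [hv' 21 (by norm_num)]; simpa using h21
    have e22 : v' 22 = c := by rw [hv' 22 (by norm_num)]; simpa using h22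
    simp only [Expr.val, BinOp.eval, Function.update_self, e21, e22, Nat.shiftRight_eq_div_pow]
    constructor
    · intro hne
      exact Nat.find_min' hex (by simpa using hne)
    · intro hle
      simpa using hmono _ _ hle (Nat.find_spec hex)
  · simp [Expr.val]
  · simpa [-List.getD_eq_getElem?_getD, Expr.val, h.getD_one] using hk
  · simp [-List.getD_eq_getElem?_getD, Expr.val, h.getD_one]; omega
  · simpa [-List.getD_eq_getElem?_getD, Expr.val, h.getD_one] using hN
  · rintro v' ⟨hv', -⟩
    refine Run.assign (by omega) h.lt_two_pow rfl (by simp [Expr.Fits]) ?_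
    simp only [Expr.val, Function.update_self, hv']
    exact ⟨hk, Nat.find_spec hex, fun i hi => Nat.find_min hex hi⟩

theorem run_lookupProg (h : IsMergeData w T D) {k a l q : ℕ} (h23 : v 23 = k) (h21 : v 21 = a)
    (h42 : v 42 = l) (h28 : v 28 = q) (hk : k ≤ Nat.size T.length) (ha : a < T.length)
    (hl : l ≤ 2 * Nat.size T.length + 1) (hq : q < 2 ^ (2 * Nat.size T.length + 1)) {x : ℕ}
    (hx : x = packKey (2 ^ (4 * Nat.size T.length)) k (a / 2 ^ k) l (q / 2 ^ l)) :
    Run w t N T D lookupProg v fun v' => v' 52 = entryAddr D x ∧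
      (v' 43 ≠ 0 ↔ D.getD (entryAddr D x) 0 = x + 1) := by
  have hw := h.le_width
  have hw' := h.two_pow_le
  have hns := Nat.lt_size_self T.length
  have hb := field_bounds h.size_pos
  have h1 : 2 ^ Nat.size T.length ≤ 2 ^ (4 * Nat.size T.length) :=
    Nat.pow_le_pow_right two_pos (by omega)
  have hxU : x < 2 ^ (16 * Nat.size T.length) := by
    rw [hx]
    refine (packKey_lt (by omega) (lt_of_le_of_lt (Nat.div_le_self _ _) (by omega)) (by omega)
      (lt_of_le_of_lt (Nat.div_le_self _ _) (hq.trans_le hb.2))).trans_eq ?_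
    rw [← pow_mul]; congr 1; ring
  have hxw : x + 1 < 2 ^ w := by
    have : 2 * 2 ^ (16 * Nat.size T.length) ≤ 2 ^ w := by
      rw [← pow_succ', h.width]
      exact Nat.pow_le_pow_right two_pos (by have := h.size_pos; omega)
    omega
  obtain ⟨-, -, d3, d4, d5, d6⟩ := h.isDict x hxU
  refine Run.seq (Run.assign (by omega) h.lt_two_pow rfl ?_ ?_)
  · simp only [Expr.Fits, Expr.val, BinOp.eval, h.getD_three, h23, h21, h42, h28,
      Nat.shiftRight_eq_div_pow]
    rw [packKey] at hx
    set B := 2 ^ (4 * Nat.size T.length) with hB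
    have hB0 : 0 < B := by positivity
    generalize q / 2 ^ l = y at *
    generalize a / 2 ^ k = t at *
    -- The evaluation by Horner's rule only grows, so the bound on the final value `x` rules out an
    -- overflow on the way.
    have m1 : k * B + t ≤ (k * B + t) * B := Nat.le_mul_of_pos_right _ hB0
    have m2 : (k * B + t) * B + l ≤ ((k * B + t) * B + l) * B := Nat.le_mul_of_pos_right _ hB0
    refine ⟨⟨⟨⟨⟨⟨trivial, ?_, ?_⟩, ⟨trivial, trivial⟩, ?_⟩, ?_, ?_⟩, trivial, ?_⟩, ?_, ?_⟩,
      ⟨trivial, trivial⟩, ?_⟩ <;> omega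
  have e50 : Expr.val D v (.bin .add (.bin .mul (.bin .add (.bin .mul (.bin .add (.bin .mul
      (.var 23) (.load (.num 3))) (.bin .shr (.var 21) (.var 23))) (.load (.num 3))) (.var 42))
      (.load (.num 3))) (.bin .shr (.var 28) (.var 42))) = x := by
    simp only [Expr.val, BinOp.eval, h.getD_three, h23, h21, h42, h28,
      Nat.shiftRight_eq_div_pow, hx, packKey]
  rw [e50]
  rw [bucketAddr] at d5
  refine Run.seq (Run.assign (by omega) h.lt_two_pow rfl ?_ ?_)
  · simp only [Expr.Fits, Expr.val, BinOp.eval, Function.update_self]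
    refine ⟨?_, ⟨?_, ⟨⟨⟨?_, trivial, d3⟩, ?_⟩, ?_⟩, ?_⟩, ?_⟩ <;> omega
  have e51 : Expr.val D (Function.update v 50 x) (.bin .add (.num 8) (.bin .mul (.num 3) (.bin .mod
      (.bin .mod (.bin .mul (.load (.num 5)) (.var 50)) (.load (.num 4))) (.load (.num 6))))) =
      bucketAddr D x := by
    simp only [Expr.val, BinOp.eval, Function.update_self, bucketAddr]
  rw [e51]
  rw [← bucketAddr] at d5
  rw [entryAddr] at d6
  refine Run.seq (Run.assign (by omega) h.lt_two_pow rfl ?_ ?_)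
  · simp [-List.getD_eq_getElem?_getD, Expr.Fits, Expr.val, BinOp.eval]
    refine ⟨⟨?_, ?_⟩, ⟨?_, ⟨⟨d4, ?_⟩, ?_, ?_⟩, ?_⟩, ?_⟩ <;> omega
  have e52 : Expr.val D (Function.update (Function.update v 50 x) 51 (bucketAddr D x))
      (.bin .add (.load (.bin .add (.var 51) (.num 2))) (.bin .mul (.num 3)
      (.bin .mod (.bin .mod (.bin .mul (.load (.var 51)) (.var 50)) (.load (.num 4)))
      (.load (.bin .add (.var 51) (.num 1)))))) = entryAddr D x := by
    simp [Expr.val, BinOp.eval, entryAddr]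
  rw [e52]
  refine Run.assign (by omega) h.lt_two_pow rfl ?_ ?_
  · simp [Expr.Fits, Expr.val]
    omega
  · simp [Expr.val, BinOp.eval]

end IsMergeData


/-- Sampling the last rank of each group of `L` lets the samples in `[b..e]` be delimited by the
quotients of `b` and `e + 1`. -/
theorem sampleRank_mem {L b e j : ℕ} (hL : 0 < L) (hb : b / L ≤ j) (he : j < (e + 1) / L) :
    b ≤ sampleRank L j ∧ sampleRank L j ≤ e := by
  have h1 : b < b / L * L + L := Nat.lt_div_mul_add hL
  have h2 := Nat.mul_div_le (e + 1) L
  have h3 : L * (b / L) ≤ L * j := Nat.mul_le_mul_left L hb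
  have h4 : L * (j + 1) ≤ L * ((e + 1) / L) := Nat.mul_le_mul_left L he
  rw [mul_comm] at h1
  rw [mul_add] at h4
  unfold sampleRank
  omega

theorem suffixCount_eq_zero_iff {σ : ℕ} {T : List (Fin σ)} {p : ℕ} (hp : p ≤ T.length) :
    suffixCount T p = 0 ↔ p = T.length := by
  rcases hp.eq_or_lt with rfl | h
  · simp [suffixCount_length]
  · simp [suffixCount_of_lt h, h.ne]

namespace IsMergeData

variable {σ : ℕ} {w t N : ℕ} {T : List (Fin σ)} {D : List ℕ} {v : ℕ → ℕ}

theorem sampleDist_pos (h : IsMergeData w T D) : 0 < sampleDist T.length :=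
  pow_pos h.size_pos 3

/-- The centre starts with `α`, so only its rest at `p` has to be compared with suffix `r`; the path
label of the lowest common ancestor of their leaves has the desired length. An empty rest has no
leaf and is treated separately. -/
theorem run_centreProg (h : IsMergeData w T D) {α : List (Fin σ)} {b e r k : ℕ}
    (hα : IsSAInterval T α b e) (hr : r < T.length) (h2 : v 2 = α.length) (h6 : v 6 = T.length)
    (h7 : v 7 = r) (h20 : v 20 = sampleDist T.length) (h22 : v 22 = (e + 1) / sampleDist T.length)
    (h23 : v 23 = k) (hab : b / sampleDist T.length < (e + 1) / sampleDist T.length)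
    (hk : b / sampleDist T.length / 2 ^ k = ((e + 1) / sampleDist T.length - 1) / 2 ^ k)
    (hmin : ∀ i < k, b / sampleDist T.length / 2 ^ i ≠ ((e + 1) / sampleDist T.length - 1) / 2 ^ i)
    {p : ℕ} (hp : p = saEntry T (sampleRank (sampleDist T.length)
      (blockCenter k (b / sampleDist T.length / 2 ^ k))) + α.length) :
    Run w t N T D centreProg v fun v' => v' 26 = suffixCount T p ∧
      v' 27 = lcpLength (rankedSuffix T r) (T.drop p) := by
  have hw := h.le_width
  have hn := h.mul_length_lt
  have hL := h.sampleDist_pos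
  have hL' := sampleDist_le h.pos
  have he := hα.lt_length
  obtain ⟨hc, hac, hcb⟩ := blockCenter_mem (by omega) hk hmin
  have hen : (e + 1) / sampleDist T.length ≤ T.length / sampleDist T.length :=
    Nat.div_le_div_right he
  have hdn : T.length / sampleDist T.length ≤ T.length := Nat.div_le_self _ _
  have hmul : sampleDist T.length * (T.length / sampleDist T.length) ≤ T.length :=
    Nat.mul_div_le _ _
  set C := blockCenter k (b / sampleDist T.length / 2 ^ k) with hC
  set c := (e + 1) / sampleDist T.length with hc'
  have hmulC : sampleDist T.length * C ≤ T.length :=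
    (Nat.mul_le_mul_left _ (by omega)).trans hmul
  have hb0 := Nat.zero_le (b / sampleDist T.length)
  obtain ⟨hbp, hpe⟩ := sampleRank_mem hL hac (e := e) (by omega)
  have hpl := hα.saEntry_add_le hbp hpe
  have hαn : α.length ≤ T.length := by omega
  rw [← hp] at hpl
  refine Run.seq (Run.assign (by omega) h.lt_two_pow rfl ?_ ?_)
  · simp only [Expr.Fits, Expr.val, BinOp.eval, h22, h23, Nat.shiftRight_eq_div_pow,
      Nat.shiftLeft_eq, ← hc]
    refine ⟨⟨⟨?_, ?_⟩, ?_, ?_⟩, ⟨?_, ?_⟩, ?_⟩ <;> first | trivial | omega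
  have e24 : Expr.val D v (.bin .shl (.bin .shr (.bin .sub (.var 22) (.num 1))
      (.bin .sub (.var 23) (.num 1))) (.bin .sub (.var 23) (.num 1))) = C := by
    simp only [Expr.val, BinOp.eval, h22, h23, Nat.shiftRight_eq_div_pow, Nat.shiftLeft_eq, hc]
  rw [e24]
  refine Run.seq (Run.assign (by omega) h.lt_two_pow rfl ?_ ?_)
  · simp [Expr.Fits, Expr.val, BinOp.eval, h20]
    omega
  have e64 : Expr.val D (Function.update v 24 C) (.bin .sub (.bin .add (.bin .mul (.var 20)
      (.var 24)) (.var 20)) (.num 1)) = sampleRank (sampleDist T.length) C := by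
    simp [Expr.val, BinOp.eval, h20, sampleRank]
  rw [e64]
  refine Run.seq (Run.mono (Run.frame (h.run_countSAProg (by simpa using h6)
    (by simpa using by omega) (by simpa [h2] using hαn))) ?_)
  rintro v₁ ⟨h61, hfr⟩
  have e61 : v₁ 61 = suffixCount T p := by
    rw [h61]; simp [h2, hp]
  have e7 : v₁ 7 = r := by rw [hfr 7 (by norm_num) rfl]; simpa using h7
  have hcl := suffixCount_le T p
  refine Run.seq (Run.assign (by omega) h.lt_two_pow rfl (by simp [Expr.Fits]) ?_)
  simp only [Expr.val, e61]
  refine Run.ite (by norm_num) (fun hne => ?_) fun h0 => ?_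
  · rw [Function.update_self] at hne
    have hpn : p < T.length := lt_of_le_of_ne hpl fun hc => hne ((suffixCount_eq_zero_iff hpl).2 hc)
    refine Run.seq (Run.assign (by omega) h.lt_two_pow rfl (by simp [Expr.Fits]; omega) ?_)
    obtain ⟨u, hu, hd⟩ := exists_isLCA_leaf (T := T) hr
      (show suffixCount T p - 1 < T.length by omega)
    have hu1 := hu.2.2.1
    have hu2 : u.1 < T.length := lt_of_le_of_lt hu1.1 hu1.2.1
    have hsa := (suffixArray T ⟨u.1, hu2⟩).2
    have hdle := lcpLength_le_left (rankedSuffix T r) (rankedSuffix T (suffixCount T p - 1))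
    have hrl := rankedSuffix_length_le T r
    refine Run.seq (Run.ask (x := u) ?_ ?_ (by omega) (by have := hu1.2.1; omega) ?_)
    · intro s hs
      simp [CSTQuery.eval, hs 7, hs 32]
    · simpa [Answers, CSTQuery.eval, Expr.val, BinOp.eval, e7] using hu
    · refine Run.ask (x := (suffixArray T ⟨u.1, hu2⟩, strDepth T u)) ?_ ?_ (by simp; omega)
        (by simp; omega) ?_
      · intro s hs
        simp [CSTQuery.eval, hs 33, hs 34]
      · simpa [Answers, CSTQuery.eval] using ⟨hu1, hu2⟩
      · simp [hd, rankedSuffix_suffixCount hpn]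
  · rw [Function.update_self] at h0
    refine Run.assign (by omega) h.lt_two_pow rfl (by simp [Expr.Fits]) ?_
    simp [Expr.val, (suffixCount_eq_zero_iff hpl).1 h0, lcpLength_nil_right]

/-- The prefix `α`, common to the searched string and the centre, adds `α.length` to the agreement
found before. Which side of the centre the string lies on is read off from `r` and the count of the
rest of the centre. -/
theorem run_keyProg (h : IsMergeData w T D) {α : List (Fin σ)} {b e r i p : ℕ}
    (hα : IsSAInterval T α b e) (hr : r < T.length) (h2 : v 2 = α.length) (h6 : v 6 = T.length)
    (h7 : v 7 = r) (hbi : b ≤ i) (hie : i ≤ e) (hp : p = saEntry T i + α.length)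
    (h26 : v 26 = suffixCount T p) (h27 : v 27 = lcpLength (rankedSuffix T r) (T.drop p)) :
    Run w t N T D keyProg v fun v' =>
      v' 28 = stringKey T (rankedSuffix T i) (α ++ rankedSuffix T r) (saEntry T r + v 27) := by
  have hw := h.le_width
  have hn := h.mul_length_lt
  have he := hα.lt_length
  have hpl := hα.saEntry_add_le hbi hie
  have hαn : α.length ≤ T.length := by omega
  have hsuf : rankedSuffix T i = α ++ T.drop p := by rw [hp]; exact hα.rankedSuffix_eq hbi hie
  have hlcp : lcpLength (α ++ rankedSuffix T r) (rankedSuffix T i) = α.length + v 27 := by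
    rw [hsuf, lcpLength_append_left, h27]
  have hle : α ++ rankedSuffix T r ≤ rankedSuffix T i ↔ r < suffixCount T p := by
    rw [hsuf, append_le_append_iff, ← not_lt, rankedSuffix_eq_drop hr,
      ← suffixCount_lt_iff (hp ▸ hpl) (saEntry_lt hr).le, suffixCount_saEntry hr]
    omega
  obtain ⟨hd, -⟩ := saEntry_add_lcpLength hr (T.drop p)
  rw [← h27] at hd
  have hsr := saEntry_lt hr
  have hkey := stringKey_lt T (rankedSuffix T i) (α ++ rankedSuffix T r) (saEntry T r + v 27)
    (rankedSuffix_length_le T i)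
  have hkw : 2 ^ (2 * Nat.size T.length + 1) ≤ 2 ^ w := by
    rw [h.width]
    exact Nat.pow_le_pow_right two_pos (by have := h.size_pos; omega)
  refine Run.seq (Run.ask (x := (saEntry T r, 0)) ?_ ?_ (by simp; omega) (by simp) ?_)
  · intro s hs
    simp [CSTQuery.eval, hs 7]
  · simp only [CSTQuery.eval, h7]
    exact ⟨hr, by rw [saEntry_of_lt hr]⟩
  refine Run.seq (Run.assign (by omega) h.lt_two_pow rfl ?_ ?_)
  · simp [Expr.Fits, Expr.val]
    omega
  refine Run.seq (Run.mono (Run.frame (h.run_countProg (by simpa using h6))) ?_)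
  rintro v₁ ⟨h61, hfr⟩
  have e61 : v₁ 61 = suffixCount T (saEntry T r + v 27) := by
    rw [h61]; simp [Expr.val, BinOp.eval]
  have e2 : v₁ 2 = α.length := by rw [hfr 2 (by norm_num) rfl]; simpa using h2
  have e6 : v₁ 6 = T.length := by rw [hfr 6 (by norm_num) rfl]; simpa using h6
  have e7 : v₁ 7 = r := by rw [hfr 7 (by norm_num) rfl]; simpa using h7
  have e26 : v₁ 26 = suffixCount T p := by rw [hfr 26 (by norm_num) rfl]; simpa using h26
  have e27 : v₁ 27 = v 27 := by rw [hfr 27 (by norm_num) rfl]; simp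
  refine Run.seq (Run.assign (by omega) h.lt_two_pow rfl ?_ ?_)
  · simp [Expr.Fits, Expr.val, e2, e27]
    omega
  refine Run.seq (Run.assign (by omega) h.lt_two_pow rfl (by simp [Expr.Fits]) ?_)
  refine Run.seq (Run.ite (by norm_num) (fun hc => ?_) fun hc => ?_)
  · have hXC : α ++ rankedSuffix T r ≤ rankedSuffix T i := by
      rw [hle]
      simpa [Expr.val, BinOp.eval, e7, e26] using hc
    rw [stringKey, if_pos hXC, hlcp] at hkey ⊢
    refine Run.skip (Run.assign (by omega) h.lt_two_pow rfl ?_ ?_)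
    · simp [-List.getD_eq_getElem?_getD, Expr.Fits, Expr.val, BinOp.eval, e2, e27, e61, h.getD_two]
      omega
    · simp [-List.getD_eq_getElem?_getD, Expr.val, BinOp.eval, e2, e27, e61, h.getD_two]
  · have hXC : ¬ α ++ rankedSuffix T r ≤ rankedSuffix T i := by
      rw [hle]
      simpa [Expr.val, BinOp.eval, e7, e26] using hc
    rw [stringKey, if_neg hXC, hlcp] at hkey ⊢
    refine Run.assign (by omega) h.lt_two_pow rfl ?_ (Run.assign (by omega) h.lt_two_pow rfl ?_ ?_)
    · simp [Expr.Fits, Expr.val, BinOp.eval, e6]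
      omega
    · simp [-List.getD_eq_getElem?_getD, Expr.Fits, Expr.val, BinOp.eval, e2, e27, e6, e61,
        h.getD_two]
      omega
    · simp [-List.getD_eq_getElem?_getD, Expr.val, BinOp.eval, e2, e6, e27, e61, h.getD_two]

/-- If a prefix of `q` is shared by a key of the block, so are all shorter ones. Hence membership in
the dictionary is monotone in the number of dropped bits, and at `2 * s + 1` dropped bits it holds
because the block contains `a`. -/
theorem run_prefixProg (h : IsMergeData w T D) {k a q : ℕ} (h23 : v 23 = k) (h21 : v 21 = a)
    (h28 : v 28 = q) (hk : k ≤ Nat.size T.length) (ha : a < T.length / sampleDist T.length)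
    (hq : q < 2 ^ (2 * Nat.size T.length + 1)) (hN : 2 * Nat.size T.length + 1 < 2 ^ N) :
    Run w t N T D prefixProg v fun v' =>
      (∀ i < T.length / sampleDist T.length, i / 2 ^ k = a / 2 ^ k →
        (i < v' 29 ↔ sampleKey T (sampleDist T.length) k i < q)) ∧
      a / 2 ^ k * 2 ^ k ≤ v' 29 ∧ v' 29 ≤ (a / 2 ^ k + 1) * 2 ^ k ∧
      v' 29 ≤ T.length / sampleDist T.length := by
  classical
  have hw := h.le_width
  have hw' := h.two_pow_le
  have hn := h.mul_length_lt
  have hns := Nat.lt_size_self T.length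
  have hsn : Nat.size T.length ≤ T.length := Nat.size_le.2 Nat.lt_two_pow_self
  have hMn : T.length / sampleDist T.length ≤ T.length := Nat.div_le_self _ _
  set s := Nat.size T.length with hs
  set L := sampleDist T.length with hL
  set M := T.length / L with hM
  set F := sampleKey T L with hF
  have hF' : ∀ k j, F k j < 2 ^ (2 * s + 1) := sampleKey_lt T L
  have hs1 : 1 ≤ s := h.size_pos
  have hdict := h.isDict
  rw [← hL, ← hs, ← hM, ← hF] at hdict
  let J : Set ℕ := {j | j < M ∧ j / 2 ^ k = a / 2 ^ k}
  have hJ : StrictMonoOn (F k) J := fun i hi j hj hij =>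
    sampleKey_strictMono h.sampleDist_pos hij hj.1 (hi.2.trans hj.2.symm)
  have haJ : a ∈ J := ⟨ha, rfl⟩
  let x : ℕ → ℕ := fun l => packKey (2 ^ (4 * s)) k (a / 2 ^ k) l (q / 2 ^ l)
  have hx : ∀ l ≤ 2 * s + 1,
      samplesWithPrefix F s M (x l) = {j | j ∈ J ∧ F k j / 2 ^ l = q / 2 ^ l} :=
    fun l hl => samplesWithPrefix_packKey hs1 (by omega) hF' hk
      (lt_of_le_of_lt (Nat.div_le_self _ _) (by omega)) hl
      (lt_of_le_of_lt (Nat.div_le_self _ _) hq)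
  have hxU : ∀ l ≤ 2 * s + 1, x l < 2 ^ (16 * s) := by
    intro l hl
    have hb := field_bounds hs1
    have h1 : 2 ^ s ≤ 2 ^ (4 * s) := Nat.pow_le_pow_right two_pos (by omega)
    refine (packKey_lt (by omega) (lt_of_le_of_lt (Nat.div_le_self _ _) (by omega)) (by omega)
      (lt_of_le_of_lt (Nat.div_le_self _ _) (hq.trans_le hb.2))).trans_eq ?_
    rw [← pow_mul]; congr 1; ring
  have hex : ∃ l, ∃ j ∈ J, F k j / 2 ^ l = q / 2 ^ l := ⟨2 * s + 1, a, haJ, by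
    rw [Nat.div_eq_of_lt (hF' _ _), Nat.div_eq_of_lt hq]⟩
  have hl : Nat.find hex ≤ 2 * s + 1 := Nat.find_min' hex ⟨a, haJ, by
    rw [Nat.div_eq_of_lt (hF' _ _), Nat.div_eq_of_lt hq]⟩
  have hmono : ∀ i j, i ≤ j → (∃ y ∈ J, F k y / 2 ^ i = q / 2 ^ i) →
      ∃ y ∈ J, F k y / 2 ^ j = q / 2 ^ j := by
    rintro i j hij ⟨y, hy, he⟩
    obtain ⟨d, rfl⟩ := Nat.exists_eq_add_of_le hij
    exact ⟨y, hy, by rw [pow_add, ← Nat.div_div_eq_div_mul, ← Nat.div_div_eq_div_mul, he]⟩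
  have hfind : ∀ l ≤ 2 * s + 1, (D.getD (entryAddr D (x l)) 0 = x l + 1 ↔ Nat.find hex ≤ l) := by
    intro l hl
    rw [(hdict (x l) (hxU l hl)).1, mem_prefixKeys_iff, hx l hl]
    constructor
    · rintro ⟨j, hj⟩
      exact Nat.find_min' hex ⟨j, hj⟩
    · intro hle
      obtain ⟨j, hj⟩ := hmono _ _ hle (Nat.find_spec hex)
      exact ⟨j, hj⟩
  refine Run.seq (Run.assign (by omega) h.lt_two_pow rfl (by simp [Expr.Fits]) ?_)
  refine Run.seq (Run.assign (by omega) h.lt_two_pow rfl ?_ ?_)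
  · simp [-List.getD_eq_getElem?_getD, Expr.Fits, Expr.val, BinOp.eval, h.getD_one]
    omega
  have e41 : Expr.val D (Function.update v 40 (Expr.val D v (.num 0))) (.bin .add (.bin .mul (.num 2)
      (.load (.num 1))) (.num 1)) = 2 * s + 1 := by
    simp only [Expr.val, BinOp.eval, h.getD_one, hs]
  rw [e41]
  refine Run.seq (Run.mono (Run.binarySearch (x := Nat.find hex) (by omega) h.lt_two_pow
    (by decide) ?_ ?_ ?_ ?_ ?_) ?_)
  · intro v' hv' _ hlt
    rw [Function.update_self] at hlt
    refine Run.mono (h.run_lookupProg (k := k) (a := a) (q := q) (l := v' 42) (x := x (v' 42))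
      ?_ ?_ rfl ?_ hk (by omega) hlt.le hq rfl) fun v'' hv'' => ?_
    · rw [hv' 23 (by norm_num)]; simpa using h23
    · rw [hv' 21 (by norm_num)]; simpa using h21
    · rw [hv' 28 (by norm_num)]; simpa using h28
    · rw [hv''.2, hfind _ hlt.le]
  · simp [Expr.val]
  · simpa using hl
  · simp only [Function.update_self]; omega
  · simpa [Expr.val] using hN
  rintro v₁ ⟨h40, hfr⟩
  have e21 : v₁ 21 = a := by rw [hfr 21 (by norm_num)]; simpa using h21
  have e23 : v₁ 23 = k := by rw [hfr 23 (by norm_num)]; simpa using h23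
  have e28 : v₁ 28 = q := by rw [hfr 28 (by norm_num)]; simpa using h28
  set l := Nat.find hex with hldef
  refine Run.seq (Run.assign (by omega) h.lt_two_pow rfl (by simp [Expr.Fits]) ?_)
  simp only [Expr.val, h40]
  -- The lookup is repeated because the last probe of the binary search need not have been at `l`.
  refine Run.seq (Run.mono (Run.frame (h.run_lookupProg (k := k) (a := a) (q := q) (l := l)
    (x := x l) (by simpa using e23) (by simpa using e21) (by simp) (by simpa using e28) hk
    (by omega) hl hq rfl)) ?_)
  rintro v₂ ⟨⟨h52, -⟩, hfr₂⟩
  have f28 : v₂ 28 = q := by rw [hfr₂ 28 (by norm_num) rfl]; simpa using e28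
  have f42 : v₂ 42 = l := by rw [hfr₂ 42 (by norm_num) rfl]; simp
  have hne : (samplesWithPrefix F s M (x l)).Nonempty := by
    rw [hx l hl]
    obtain ⟨j, hj⟩ := Nat.find_spec hex
    exact ⟨j, hj⟩
  obtain ⟨-, hval, -, -, -, hfit⟩ := hdict (x l) (hxU l hl)
  obtain ⟨hv1, hv2⟩ : D.getD (entryAddr D (x l) + 1) 0 = sInf (samplesWithPrefix F s M (x l)) ∧
    D.getD (entryAddr D (x l) + 2) 0 = sSup (samplesWithPrefix F s M (x l)) :=
    hval (mem_prefixKeys_iff.2 hne)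
  have hleast := isLeast_samplesWithPrefix hne
  have hgreat := isGreatest_samplesWithPrefix hne
  generalize sInf (samplesWithPrefix F s M (x l)) = j₁ at *
  generalize sSup (samplesWithPrefix F s M (x l)) = j₂ at *
  rw [hx l hl] at hleast hgreat
  have hfinal := fun j hj => lt_iff_of_least_shift hJ hleast hgreat
    (fun i hi j hj he => Nat.find_min hex hi ⟨j, hj, he⟩) (j := j) hj
  have hbd : ∀ j ∈ J, a / 2 ^ k * 2 ^ k ≤ j ∧ j < (a / 2 ^ k + 1) * 2 ^ k := by
    rintro j ⟨-, hj⟩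
    rw [← hj]
    refine ⟨Nat.div_mul_le_self _ _, ?_⟩
    rw [add_mul, one_mul]
    exact Nat.lt_div_mul_add (by positivity)
  have hj1 := hbd _ hleast.1.1
  have hj2 := hbd _ hgreat.1.1
  have hj1M := hleast.1.1.1
  have hj2M := hgreat.1.1.1
  refine Run.seq (Run.assign (by omega) h.lt_two_pow rfl ?_ ?_)
  · simp only [Expr.Fits, Expr.val, BinOp.eval, f42]
    have h2 : ∀ y, y % 2 < 2 := fun y => Nat.mod_lt _ two_pos
    refine ⟨⟨by omega, trivial⟩, ⟨⟨trivial, trivial, by omega⟩, by omega⟩, ?_⟩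
    split_ifs
    · have := h2 (v₂ 28 >>> (l - 1))
      omega
    · rw [zero_mul]; positivity
  have e37 : Expr.val D v₂ (.bin .mul (.bin .lt (.num 0) (.var 42)) (.bin .mod (.bin .shr (.var 28)
      (.bin .sub (.var 42) (.num 1))) (.num 2))) = 0 ↔ (l = 0 ∨ q / 2 ^ (l - 1) % 2 = 0) := by
    simp only [Expr.val, BinOp.eval, f42, f28, Nat.shiftRight_eq_div_pow]
    split_ifs with h0
    · rw [one_mul]
      exact ⟨Or.inr, fun h => h.resolve_left (by omega)⟩
    · simp [show l = 0 by omega]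
  refine Run.ite (by norm_num) (fun hc => ?_) fun hc => ?_
  · rw [Function.update_self, ne_eq, e37] at hc
    simp only [if_neg hc] at hfinal
    refine Run.assign (by omega) h.lt_two_pow rfl ?_ ?_
    · simp [-List.getD_eq_getElem?_getD, Expr.Fits, Expr.val, BinOp.eval, h52, hv2]
      omega
    · simp only [Expr.val, BinOp.eval, Function.update_self]
      rw [Function.update_of_ne (by norm_num), h52, hv2]
      exact ⟨fun i hi hik => hfinal i ⟨hi, hik⟩, by omega, hj2.2, hj2M⟩
  · rw [Function.update_self, e37] at hc
    simp only [if_pos hc] at hfinal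
    refine Run.assign (by omega) h.lt_two_pow rfl ?_ ?_
    · simp [-List.getD_eq_getElem?_getD, Expr.Fits, Expr.val, BinOp.eval, h52]
      omega
    · simp only [Expr.val, BinOp.eval, Function.update_self]
      rw [Function.update_of_ne (by norm_num), h52, hv1]
      exact ⟨fun i hi hik => hfinal i ⟨hi, hik⟩, hj1.1, hj1.2.le, hj1M.le⟩

/-- The window is shorter than `sampleDist T.length`, so `N` rounds suffice. Its ends are a maximum
and a minimum, expressed by truncated subtraction. -/
theorem run_windowProg (h : IsMergeData w T D) {α : List (Fin σ)} {b e r x j : ℕ}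
    (hα : IsSAInterval T α b e) (hr : r < T.length) (h0 : v 0 = b) (h1 : v 1 = e)
    (h2 : v 2 = α.length) (h6 : v 6 = T.length) (h7 : v 7 = r) (h20 : v 20 = sampleDist T.length)
    (h29 : v 29 = j) (hj : j ≤ T.length / sampleDist T.length)
    (hx : IsInsertionPoint T (α ++ rankedSuffix T r) x)
    (hxj : max b (sampleDist T.length * j) ≤ x ∧
      x ≤ min (e + 1) (sampleDist T.length * j + sampleDist T.length - 1))
    (hN : sampleDist T.length ≤ 2 ^ N) :
    Run w t N T D windowProg v fun v' => v' 10 = x := by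
  have hw := h.le_width
  have hn := h.mul_length_lt
  have hL := h.sampleDist_pos
  have hL' := sampleDist_le h.pos
  have he := hα.lt_length
  have hbe := hα.1
  have hpl := hα.saEntry_add_le le_rfl hα.1
  have hmul : sampleDist T.length * j ≤ T.length :=
    (Nat.mul_le_mul_left _ hj).trans (Nat.mul_div_le _ _)
  set L := sampleDist T.length with hLdef
  obtain ⟨hx1, hx2⟩ := hxj
  refine Run.seq (Run.assign (by omega) h.lt_two_pow rfl ?_ ?_)
  · simp [Expr.Fits, Expr.val, BinOp.eval, h0, h20, h29]
    omega
  have e40 : Expr.val D v (.bin .add (.var 0) (.bin .sub (.bin .mul (.var 20) (.var 29)) (.var 0))) =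
      max b (L * j) := by
    simp only [Expr.val, BinOp.eval, h0, h20, h29]
    omega
  rw [e40]
  refine Run.seq (Run.assign (by omega) h.lt_two_pow rfl ?_ ?_)
  · simp [Expr.Fits, Expr.val, h1]
    omega
  refine Run.seq (Run.assign (by omega) h.lt_two_pow rfl ?_ ?_)
  · simp [Expr.Fits, Expr.val, BinOp.eval, h20, h29]
    omega
  set v₁ := Function.update (Function.update v 40 (max b (L * j))) 30
    (Expr.val D (Function.update v 40 (max b (L * j))) (.bin .add (.var 1) (.num 1))) with hv₁
  have e41 : Expr.val D v₁ (.bin .sub (.var 30) (.bin .sub (.var 30) (.bin .sub (.bin .add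
      (.bin .mul (.var 20) (.var 29)) (.var 20)) (.num 1)))) = min (e + 1) (L * j + L - 1) := by
    simp [hv₁, Expr.val, BinOp.eval, h1, h20, h29]
    omega
  rw [e41]
  refine Run.seq (Run.mono (Run.binarySearch (x := x) (by omega) h.lt_two_pow
    (by decide) ?_ ?_ ?_ ?_ ?_) ?_)
  · intro v' hv' hlo hhi
    rw [Function.update_self] at hhi
    rw [Function.update_of_ne (by norm_num), hv₁, Function.update_of_ne (by norm_num),
      Function.update_self] at hlo
    have e2 : v' 2 = α.length := by rw [hv' 2 (by norm_num)]; simpa [hv₁] using h2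
    have e6 : v' 6 = T.length := by rw [hv' 6 (by norm_num)]; simpa [hv₁] using h6
    have e7 : v' 7 = r := by rw [hv' 7 (by norm_num)]; simpa [hv₁] using h7
    refine Run.seq (Run.assign (by omega) h.lt_two_pow rfl (by simp [Expr.Fits]) ?_)
    refine Run.seq (Run.mono (Run.frame (h.run_countSAProg (by simpa using e6) ?_ ?_)) ?_)
    · simp [Expr.val]; omega
    · simp [e2]; omega
    rintro v'' ⟨h61, hfr⟩
    have e7' : v'' 7 = r := by rw [hfr 7 (by norm_num) rfl]; simpa using e7
    refine Run.assign (by omega) h.lt_two_pow rfl (by simp [Expr.Fits]) ?_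
    have hiff := hα.lt_insertionPoint_iff (i := v' 42) hr hx (by omega) (by omega)
    have e61 : v'' 61 = suffixCount T (saEntry T (v' 42) + α.length) := by
      rw [h61]; simp [Expr.val, e2]
    simp only [Expr.val, BinOp.eval, Function.update_self, e61, e7']
    rw [← not_lt (a := v' 42), hiff]
    split_ifs <;> simp <;> omega
  · simpa [hv₁] using hx1
  · simpa using hx2
  · simp only [Function.update_self]; omega
  · rw [Function.update_self, Function.update_of_ne (by norm_num), hv₁,
      Function.update_of_ne (by norm_num), Function.update_self]
    omega
  rintro v₂ ⟨h40, -⟩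
  refine Run.assign (by omega) h.lt_two_pow rfl (by simp [Expr.Fits]) ?_
  simpa [Expr.val] using h40

end IsMergeData


/-! ### Correctness of the search and of the merge -/

namespace IsMergeData

variable {σ : ℕ} {w t N : ℕ} {T : List (Fin σ)} {D : List ℕ} {v : ℕ → ℕ}

theorem run_searchProg (h : IsMergeData w T D) {α : List (Fin σ)} {b e r x : ℕ}
    (hα : IsSAInterval T α b e) (hr : r < T.length) (h0 : v 0 = b) (h1 : v 1 = e)
    (h2 : v 2 = α.length) (h6 : v 6 = T.length) (h7 : v 7 = r)
    (hx : IsInsertionPoint T (α ++ rankedSuffix T r) x)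
    (hN : 2 * Nat.size T.length + 1 < 2 ^ N) (hN' : sampleDist T.length ≤ 2 ^ N) :
    Run w t N T D searchProg v fun v' => v' 10 = x := by
  have hw := h.le_width
  have hn := h.mul_length_lt
  have hL := h.sampleDist_pos
  have he := hα.lt_length
  have hbL : b / sampleDist T.length ≤ T.length / sampleDist T.length :=
    Nat.div_le_div_right (hα.1.trans he.le)
  have heL : (e + 1) / sampleDist T.length ≤ T.length / sampleDist T.length :=
    Nat.div_le_div_right he
  have hdn : T.length / sampleDist T.length ≤ T.length := Nat.div_le_self _ _
  refine Run.seq (Run.assign (by omega) h.lt_two_pow rfl (by simp [Expr.Fits]) ?_)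
  refine Run.seq (Run.assign (by omega) h.lt_two_pow rfl (by simp [Expr.Fits]) ?_)
  refine Run.seq (Run.assign (by omega) h.lt_two_pow rfl ?_ ?_)
  · simp [Expr.Fits, Expr.val, h1]
    omega
  refine Run.seq (Run.assign (by omega) h.lt_two_pow rfl (by simp [Expr.Fits]) ?_)
  refine Run.seq (Run.assign (by omega) h.lt_two_pow rfl (by simp [Expr.Fits]) ?_)
  refine Run.seq (Run.mono (Run.frame (Q := fun v' =>
    v' 29 ≤ T.length / sampleDist T.length ∧ max b (sampleDist T.length * v' 29) ≤ x ∧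
      x ≤ min (e + 1) (sampleDist T.length * v' 29 + sampleDist T.length - 1)) ?_) ?_)
  · have g20 : D.getD 0 0 = sampleDist T.length := h.getD_zero
    refine Run.ite (by norm_num) (fun hc => ?_) fun hc => ?_
    · have hab : b / sampleDist T.length < (e + 1) / sampleDist T.length := by
        simpa [-List.getD_eq_getElem?_getD, Expr.val, BinOp.eval, h0, h1, g20] using hc
      have hb0 := Nat.zero_le (b / sampleDist T.length)
      refine Run.seq (Run.mono (Run.frame (h.run_levelProg (a := b / sampleDist T.length)
        (c := (e + 1) / sampleDist T.length) ?_ ?_ hab (by omega) (by omega))) ?_)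
      · simp [-List.getD_eq_getElem?_getD, Expr.val, BinOp.eval, h0, g20]
      · simp [-List.getD_eq_getElem?_getD, Expr.val, BinOp.eval, h1, g20]
      rintro v₁ ⟨⟨hks, hk, hmin⟩, hfr⟩
      generalize hkv : v₁ 23 = k at *
      have e2 : v₁ 2 = α.length := by rw [hfr 2 (by norm_num) rfl]; simpa using h2
      have e6 : v₁ 6 = T.length := by rw [hfr 6 (by norm_num) rfl]; simpa using h6
      have e7 : v₁ 7 = r := by rw [hfr 7 (by norm_num) rfl]; simpa using h7
      have e20 : v₁ 20 = sampleDist T.length := by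
        rw [hfr 20 (by norm_num) rfl]; simpa [-List.getD_eq_getElem?_getD, Expr.val] using g20
      have e21 : v₁ 21 = b / sampleDist T.length := by
        rw [hfr 21 (by norm_num) rfl]
        simp [-List.getD_eq_getElem?_getD, Expr.val, BinOp.eval, h0, g20]
      have e22 : v₁ 22 = (e + 1) / sampleDist T.length := by
        rw [hfr 22 (by norm_num) rfl]
        simp [-List.getD_eq_getElem?_getD, Expr.val, BinOp.eval, h1, g20]
      refine Run.seq (Run.mono (Run.frame (h.run_centreProg hα hr e2 e6 e7 e20 e22 hkv hab hk hmin
        rfl)) ?_)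
      rintro v₂ ⟨⟨f26, f27⟩, hfr₂⟩
      have f2 : v₂ 2 = α.length := by rw [hfr₂ 2 (by norm_num) rfl, e2]
      have f6 : v₂ 6 = T.length := by rw [hfr₂ 6 (by norm_num) rfl, e6]
      have f7 : v₂ 7 = r := by rw [hfr₂ 7 (by norm_num) rfl, e7]
      have f21 : v₂ 21 = b / sampleDist T.length := by rw [hfr₂ 21 (by norm_num) rfl, e21]
      have f23 : v₂ 23 = k := by rw [hfr₂ 23 (by norm_num) rfl, hkv]
      obtain ⟨-, hac, hcb⟩ := blockCenter_mem (by omega) hk hmin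
      obtain ⟨hbp, hpe⟩ := sampleRank_mem hL hac (e := e) (by omega)
      set i := sampleRank (sampleDist T.length) (blockCenter k (b / sampleDist T.length / 2 ^ k))
        with hi
      refine Run.seq (Run.mono (Run.frame (h.run_keyProg hα hr f2 f6 f7 hbp hpe rfl f26 f27)) ?_)
      rintro v₃ ⟨g28, hfr₃⟩
      have g21 : v₃ 21 = b / sampleDist T.length := by rw [hfr₃ 21 (by norm_num) rfl, f21]
      have g23 : v₃ 23 = k := by rw [hfr₃ 23 (by norm_num) rfl, f23]
      refine Run.mono (h.run_prefixProg g23 g21 g28 hks (by omega)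
        (stringKey_lt _ _ _ _ (rankedSuffix_length_le _ _)) hN) ?_
      rintro v₄ ⟨hcmp, hj1, hj2, hj3⟩
      refine ⟨hj3, hα.insertionPoint_window hL hx hab hk (fun j hj hjk => ?_) hj1 hj2 hj3⟩
      -- The comparison of keys is turned back into one of strings: behind `α` and the common prefix
      -- with the centre, the searched string continues as the suffix of `T` that was ranked for the
      -- key.
      rw [hcmp j hj hjk, hi, ← hjk]
      obtain ⟨hd, -⟩ := saEntry_add_lcpLength hr (T.drop (saEntry T i + α.length))
      rw [← f27] at hd
      refine sampleKey_lt_stringKey_iff hL hj hd ?_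
      rw [hjk, ← hi, hα.rankedSuffix_eq hbp hpe, lcpLength_append_left, ← f27, ← List.drop_drop,
        ← rankedSuffix_eq_drop hr, ← List.drop_drop, List.drop_left]
    · have hab : ¬ b / sampleDist T.length < (e + 1) / sampleDist T.length := by
        simpa [-List.getD_eq_getElem?_getD, Expr.val, BinOp.eval, h0, h1, g20] using hc
      obtain ⟨hbx, hxe⟩ := hα.insertionPoint_mem hx
      refine Run.skip ?_
      -- Without a sample in `[b..e]` the whole interval lies between two consecutive multiples of
      -- the distance, so the default `b / L` in register `29` is correct.
      suffices key : ∀ j, j = b / sampleDist T.length → j ≤ T.length / sampleDist T.length ∧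
          max b (sampleDist T.length * j) ≤ x ∧
            x ≤ min (e + 1) (sampleDist T.length * j + sampleDist T.length - 1) from
        key _ (by simp [-List.getD_eq_getElem?_getD, Expr.val, BinOp.eval, h0, g20])
      rintro j rfl
      refine ⟨hbL, max_le hbx ((Nat.mul_div_le _ _).trans hbx), le_min hxe ?_⟩
      have h3 : e + 1 < (e + 1) / sampleDist T.length * sampleDist T.length + sampleDist T.length :=
        Nat.lt_div_mul_add hL
      have h4 := Nat.mul_le_mul_right (sampleDist T.length) (not_lt.1 hab)
      rw [mul_comm (sampleDist T.length)]
      omega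
  · rintro v₁ ⟨⟨hj, hwin⟩, hfr⟩
    refine h.run_windowProg hα hr ?_ ?_ ?_ ?_ ?_ ?_ rfl hj hx hwin hN'
    · rw [hfr 0 (by norm_num) rfl]; simpa using h0
    · rw [hfr 1 (by norm_num) rfl]; simpa using h1
    · rw [hfr 2 (by norm_num) rfl]; simpa using h2
    · rw [hfr 6 (by norm_num) rfl]; simpa using h6
    · rw [hfr 7 (by norm_num) rfl]; simpa using h7
    · rw [hfr 20 (by norm_num) rfl]
      simpa [-List.getD_eq_getElem?_getD, Expr.val] using h.getD_zero

theorem run_mergeProg (h : IsMergeData w T D) {α β : List (Fin σ)} {b₁ e₁ b₂ e₂ : ℕ}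
    (hα : IsSAInterval T α b₁ e₁) (hβ : IsSAInterval T β b₂ e₂) (h0 : v 0 = b₁) (h1 : v 1 = e₁)
    (h2 : v 2 = α.length) (h3 : v 3 = b₂) (h4 : v 4 = e₂) (h5 : v 5 = β.length)
    (h6 : v 6 = T.length) (hN : 2 * Nat.size T.length + 1 < 2 ^ N)
    (hN' : sampleDist T.length ≤ 2 ^ N) :
    Run w t N T D mergeProg v fun v' => IsMergeOutput T (α ++ β) v' := by
  have hw := h.le_width
  have hn := h.mul_length_lt
  have he₁ := hα.lt_length
  have he₂ := hβ.lt_length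
  have hαn := hα.saEntry_add_le le_rfl hα.1
  refine Run.ite (by norm_num) (fun hc => ?_) fun hc => ?_
  · have hβ0 : β ≠ [] := by
      rintro rfl
      exact hc (by simp [h5])
    obtain ⟨x, hx⟩ := exists_isInsertionPoint T (α ++ rankedSuffix T b₂)
    obtain ⟨y, hy⟩ := exists_isInsertionPoint T (α ++ rankedSuffix T e₂)
    have hxm := hα.insertionPoint_mem hx
    have hym := hα.insertionPoint_mem hy
    have hocc := hα.mem_occPositions_append_iff hβ0 hβ hx hy rfl
    -- The occurrences are the half-open range from `x` to `y'`; the program reports `y' - 1` as its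
    -- right end.
    set y' := if y ≤ e₁ ∧ suffixCount T (saEntry T y + α.length) = e₂ + 1 then y + 1 else y with hy'
    refine Run.seq (Run.assign (by omega) h.lt_two_pow rfl (by simp [Expr.Fits]) ?_)
    simp only [Expr.val, h3]
    refine Run.seq (Run.mono (Run.frame (h.run_searchProg hα (lt_of_le_of_lt hβ.1 he₂)
      (by simpa using h0) (by simpa using h1) (by simpa using h2) (by simpa using h6) (by simp)
      hx hN hN')) ?_)
    rintro v₁ ⟨e10, hfr⟩
    refine Run.seq (Run.assign (by omega) h.lt_two_pow rfl (by simp [Expr.Fits]) ?_)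
    refine Run.seq (Run.assign (by omega) h.lt_two_pow rfl (by simp [Expr.Fits]) ?_)
    have e0 : v₁ 0 = b₁ := by rw [hfr 0 (by norm_num) rfl]; simpa using h0
    have e1 : v₁ 1 = e₁ := by rw [hfr 1 (by norm_num) rfl]; simpa using h1
    have e2 : v₁ 2 = α.length := by rw [hfr 2 (by norm_num) rfl]; simpa using h2
    have e4 : v₁ 4 = e₂ := by rw [hfr 4 (by norm_num) rfl]; simpa using h4
    have e6 : v₁ 6 = T.length := by rw [hfr 6 (by norm_num) rfl]; simpa using h6
    refine Run.seq (Run.mono (Run.frame (h.run_searchProg hα he₂ (by simpa using e0)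
      (by simpa using e1) (by simpa using e2) (by simpa using e6) (by simp [Expr.val, e4])
      hy hN hN')) ?_)
    rintro v₂ ⟨f10, hfr₂⟩
    have f1 : v₂ 1 = e₁ := by rw [hfr₂ 1 (by norm_num) rfl]; simpa using e1
    have f2 : v₂ 2 = α.length := by rw [hfr₂ 2 (by norm_num) rfl]; simpa using e2
    have f4 : v₂ 4 = e₂ := by rw [hfr₂ 4 (by norm_num) rfl]; simpa using e4
    have f6 : v₂ 6 = T.length := by rw [hfr₂ 6 (by norm_num) rfl]; simpa using e6
    have f8 : v₂ 8 = x := by rw [hfr₂ 8 (by norm_num) rfl]; simpa [Expr.val] using e10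
    refine Run.seq (Run.assign (by omega) h.lt_two_pow rfl (by simp [Expr.Fits]) ?_)
    simp only [Expr.val, f10]
    refine Run.seq (Run.assign (by omega) h.lt_two_pow rfl ?_ ?_)
    · simp [Expr.Fits, Expr.val, f1]
      omega
    refine Run.seq (Run.mono (Run.frame (Q := fun v' => v' 9 = y') ?_) ?_)
    · refine Run.ite (by norm_num) (fun hc => ?_) fun hc => ?_
      · have hye : y ≤ e₁ := by
          simpa [Expr.val, BinOp.eval, f1, f10, Nat.lt_succ_iff] using hc
        refine Run.seq (Run.assign (by omega) h.lt_two_pow rfl (by simp [Expr.Fits]) ?_)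
        refine Run.seq (Run.mono (Run.frame (h.run_countSAProg (by simpa using f6) ?_ ?_)) ?_)
        · simp [Expr.val, f10]; omega
        · simp [f2]; omega
        rintro v₃ ⟨h61, hfr₃⟩
        have g4 : v₃ 4 = e₂ := by rw [hfr₃ 4 (by norm_num) rfl]; simpa using f4
        have g10 : v₃ 10 = y := by rw [hfr₃ 10 (by norm_num) rfl]; simpa using f10
        have g61 : v₃ 61 = suffixCount T (saEntry T y + α.length) := by
          rw [h61]; simp [Expr.val, f2, f10]
        refine Run.assign (by omega) h.lt_two_pow rfl ?_ ?_
        · simp only [Expr.Fits, Expr.val, BinOp.eval, g4, g10]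
          refine ⟨trivial, ⟨trivial, trivial, by omega, by omega⟩, ?_⟩
          split_ifs <;> omega
        · simp only [Expr.val, BinOp.eval, Function.update_self, g4, g10, g61, hy', hye, true_and]
          split_ifs <;> rfl
      · have hye : ¬ y ≤ e₁ := by
          simpa [Expr.val, BinOp.eval, f1, f10, Nat.lt_succ_iff] using hc
        refine Run.skip ?_
        simp [hy', hye]
    rintro v₃ ⟨g9, hfr₃⟩
    have g8 : v₃ 8 = x := by rw [hfr₃ 8 (by norm_num) rfl]; simpa using f8
    refine Run.seq (Run.assign (by omega) h.lt_two_pow rfl (by simp [Expr.Fits]) ?_)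
    refine Run.seq (Run.assign (by omega) h.lt_two_pow rfl (by simp [Expr.Fits]) ?_)
    refine Run.assign (by omega) h.lt_two_pow rfl (by simp [Expr.Fits]; omega) ?_
    by_cases hxy : x < y'
    · left
      refine ⟨by simp [Expr.val, BinOp.eval, g8, g9, hxy], ?_⟩
      suffices IsSAInterval T (α ++ β) x (y' - 1) by
        simpa [Expr.val, BinOp.eval, g8, g9] using this
      refine ⟨by omega, ?_⟩
      ext i
      rw [hocc i, Set.mem_Icc]
      omega
    · right
      refine ⟨by simp [Expr.val, BinOp.eval, g8, g9]; omega, ?_⟩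
      ext i
      rw [hocc i]
      simp only [Set.mem_empty_iff_false, iff_false]
      omega
  -- For empty `β` the suffix equal to `α` counts as well, although its rest is empty and has no
  -- rank; the answer is the interval of `α` itself.
  · have hβ0 : β = [] := List.length_eq_zero_iff.1 (h5 ▸ hc)
    refine Run.seq (Run.assign (by omega) h.lt_two_pow rfl (by simp [Expr.Fits]) ?_)
    refine Run.seq (Run.assign (by omega) h.lt_two_pow rfl (by simp [Expr.Fits]) ?_)
    refine Run.assign (by omega) h.lt_two_pow rfl (by simp [Expr.Fits]; omega) ?_
    left
    rw [hβ0, List.append_nil]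
    refine ⟨by simp [Expr.val], ?_⟩
    simpa [Expr.val, h0, h1] using hα

end IsMergeData

/-! ### Iterated logarithms -/

theorem size_le_logb_add_one {n : ℕ} (hn : 0 < n) : (Nat.size n : ℝ) ≤ Real.logb 2 n + 1 := by
  have hs := Nat.size_pos.2 hn
  have h := Nat.lt_size.1 (Nat.sub_lt hs one_pos)
  have h2 : ((2 : ℝ) ^ (Nat.size n - 1)) ≤ n := by exact_mod_cast h
  have h3 := Real.logb_le_logb_of_le (b := 2) (by norm_num) (by positivity) h2
  rw [Real.logb_pow, Real.logb_self_eq_one (by norm_num), mul_one, Nat.cast_sub hs] at h3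
  push_cast at h3
  linarith

/-- With `s ≤ lg n + 1 ≤ 2 * lg n` for `n ≥ 2`, the left-hand side is at most `3 * (lg lg n + 2) +
1`, whence the constant `10 = 3 + 7`. -/
theorem rounds_le {n : ℕ} (hn : 0 < n) : ((3 * Nat.size (Nat.size n) + 1 : ℕ) : ℝ) ≤
    10 * max 1 (Real.logb 2 (Real.logb 2 n)) := by
  rcases Nat.lt_or_ge n 2 with h | h
  · obtain rfl : n = 1 := by omega
    have : Nat.size (Nat.size 1) = 1 := by simp
    rw [this]
    have := le_max_left 1 (Real.logb 2 (Real.logb 2 ((1 : ℕ) : ℝ)))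
    norm_num at this ⊢
  · have h1 := size_le_logb_add_one hn
    have h2 := size_le_logb_add_one (Nat.size_pos.2 hn)
    have hy : 1 ≤ Real.logb 2 n := by
      rw [Real.le_logb_iff_rpow_le (by norm_num) (by positivity)]
      simpa using by exact_mod_cast h
    have hs : (0 : ℝ) < Nat.size n := by exact_mod_cast Nat.size_pos.2 hn
    have h3 : Real.logb 2 (Nat.size n) ≤ Real.logb 2 (2 * Real.logb 2 n) :=
      Real.logb_le_logb_of_le (by norm_num) hs (by linarith)
    rw [Real.logb_mul (by norm_num) (by linarith), Real.logb_self_eq_one (by norm_num)] at h3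
    have h4 := le_max_left 1 (Real.logb 2 (Real.logb 2 n))
    have h5 := le_max_right 1 (Real.logb 2 (Real.logb 2 n))
    push_cast
    linarith

/-- The two bounds serve the search over prefix lengths and the search between samples; the search
for the level is covered by the first one. -/
theorem rounds_suffice (s : ℕ) : 2 * s + 1 < 2 ^ (3 * Nat.size s + 1) ∧
    s ^ 3 ≤ 2 ^ (3 * Nat.size s + 1) := by
  have h := Nat.lt_size_self s
  have h1 : 2 ^ (3 * Nat.size s + 1) = 2 * (2 ^ Nat.size s) ^ 3 := by
    rw [pow_succ, mul_comm 3, pow_mul]; ring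
  have h2 : s ^ 3 ≤ (2 ^ Nat.size s) ^ 3 := Nat.pow_le_pow_left h.le 3
  have h3 : 2 ^ Nat.size s ≤ (2 ^ Nat.size s) ^ 3 := Nat.le_self_pow (by norm_num) _
  omega

/-- The alphabet size is polynomial in the text length `n`; the word size is `κ` times the number
of binary digits of `n`; one program serves all texts; the data structure `D` depends only on the
text and takes at most `C * n` bits; every access to the compressed suffix tree costs `t`. -/
theorem mainTheorem3 (a : ℕ) :
    ∃ (κ : ℕ) (P : Prog) (C : ℝ), 1 ≤ κ ∧
      ∀ (σ : ℕ) (T : List (Fin σ)), σ ≤ a * T.length ^ a →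
        ∃ D : List ℕ,
          (∀ x ∈ D, x < 2 ^ (κ * Nat.size T.length)) ∧
          ((D.length * (κ * Nat.size T.length) : ℕ) : ℝ) ≤ C * T.length ∧
          ∀ t : ℕ, 1 ≤ t →
            ∀ (α β : List (Fin σ)) (b₁ e₁ b₂ e₂ : ℕ),
              IsSAInterval T α b₁ e₁ → IsSAInterval T β b₂ e₂ →
                ∃ (s : ℕ → ℕ) (c : ℕ),
                  Exec (κ * Nat.size T.length) t T D P
                    (mergeInput b₁ e₁ α.length b₂ e₂ β.length T.length) s c ∧
                  IsMergeOutput T (α ++ β) s ∧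
                  (c : ℝ) ≤ C * (t * max 1 (Real.logb 2 (Real.logb 2 T.length))) := by
  refine ⟨64, mergeProg, 200000 + 10 * mergeProg.cost 1 1, by norm_num, fun σ T _ => ?_⟩
  -- In the empty text nothing has an interval, so no query has to be answered.
  rcases Nat.eq_zero_or_pos T.length with hT | hT
  · refine ⟨[], by simp, by simp [hT], fun t _ α β b₁ e₁ b₂ e₂ hα _ => ?_⟩
    have := hα.lt_length
    omega
  obtain ⟨D, hD, hbits⟩ := exists_isMergeData T hT
  refine ⟨D, hD.lt_two_pow, ?_, fun t ht α β b₁ e₁ b₂ e₂ hα hβ => ?_⟩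
  · have h1 : ((D.length * (64 * Nat.size T.length) : ℕ) : ℝ) ≤ 200000 * T.length := by
      exact_mod_cast hbits
    have h2 : (0 : ℝ) ≤ 10 * mergeProg.cost 1 1 * T.length := by positivity
    linarith
  · have hn := hD.mul_length_lt
    have h1 := hα.1
    have h2 := hα.lt_length
    have h3 := hβ.1
    have h4 := hβ.lt_length
    have h5 := hα.saEntry_add_le le_rfl h1
    have h6 := hβ.saEntry_add_le le_rfl h3
    obtain ⟨hN, hN'⟩ := rounds_suffice (Nat.size T.length)
    set N := 3 * Nat.size (Nat.size T.length) + 1 with hNdef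
    have hrun := hD.run_mergeProg (t := t) (N := N)
      (v := mergeInput b₁ e₁ α.length b₂ e₂ β.length T.length) hα hβ rfl rfl rfl rfl rfl rfl rfl
      hN hN'
    obtain ⟨s, c, v', hex, hc, hsv, hout⟩ := hrun
      (mergeInput b₁ e₁ α.length b₂ e₂ β.length T.length) (fun r => by
        rcases lt_or_ge r 7 with hr | hr
        · interval_cases r <;> simp [mergeInput] <;> omega
        · rw [mergeInput, List.getD_eq_default _ _ (by simpa using hr)]
          positivity) fun r _ => rfl
    refine ⟨s, c, hex, ?_, ?_⟩
    · simpa only [IsMergeOutput, hsv 0 (by norm_num), hsv 1 (by norm_num), hsv 2 (by norm_num)]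
        using hout
    · have h7 := hc.trans (Prog.cost_le_of_flat ht (by omega) (P := mergeProg) rfl)
      have h8 := rounds_le hT
      rw [← hNdef] at h8
      generalize mergeProg.cost 1 1 = K at h7 ⊢
      have h9 : (c : ℝ) ≤ K * (t * N) := by exact_mod_cast h7
      have h10 := le_max_left 1 (Real.logb 2 (Real.logb 2 T.length))
      set m := max 1 (Real.logb 2 (Real.logb 2 T.length)) with hm
      calc (c : ℝ) ≤ K * (t * N) := h9
        _ ≤ K * (t * (10 * m)) := by gcongr
        _ ≤ (200000 + 10 * K) * (t * m) := by
          have : (0 : ℝ) ≤ 200000 * (t * m) := by positivity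
          linarith
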